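/- Let $B>0$ and let $v:\mathbb{R}\to\mathbb{R}$ satisfy $\max(v,0)\in L^2_{\mathrm{loc}}(\mathbb{R})$ and $\max(-v,0)\in L^2(\mathbb{R})+L^\infty(\mathbb{R})$. Assume that the finite limits $v_\pm:=\lim_{x\to\pm\infty}v(x)$ exist and that $v_+\neq v_-$. For $p\in\mathbb{R}$ let $$h_v(p)=-\partial_x^2+(p+Bx)^2+v(x)$$ on $L^2(\mathbb{R})$, and let $$H_L+V=(-i\partial_x)^2+(-i\partial_y+Bx)^2+v(x)$$ on $L^2(\mathbb{R}^2)$, each operator being the closure of its restriction to $C_c^\infty$. Then: 1. For every $p\in\mathbb{R}$ the operator $h_v(p)$ is self-adjoint, and its spectrum is purely discrete and simple, consisting of eigenvalues $\epsilon_0(p)<\epsilon_1(p)<\epsilon_2(p)<\cdots$ with $\epsilon_n(p)\to\infty$ as $n\to\infty$. 2. For every $n\in\mathbb{N}_0$, $$\lim_{p\to-\infty}\epsilon_n(p)=v_++B(2n+1),\qquad \lim_{p\to+\infty}\epsilon_n(p)=v_-+B(2n+1).$$ 3. No eigenvalue branch $\epsilon_n(\cdot)$, $n\in\mathbb{N}_0$,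 is constant in $p$. 4. The operator $H_L+V$ is self-adjoint and its spectrum is purely absolutely continuous, i.e. the spectral measure of $H_L+V$ at every vector of $L^2(\mathbb{R}^2)$ is absolutely continuous with respect to the Lebesgue measure. -/

import Mathlib

open Set Filter Topology MeasureTheory
open scoped ContDiff

namespace TransInv

/-! ### Unbounded operators in a complex Hilbert space -/

section Operators

variable {E : Type*} [NormedAddCommGroup E] [InnerProductSpace ℂ E]

/-- `z` is in the resolvent set of `A`: the operator `A - z` maps the domain of `A` bijectively
onto `E` and its inverse `R` is bounded. -/
def IsResolventPoint (A : E →ₗ.[ℂ] E) (z : ℂ) : Prop :=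
  ∃ R : E →L[ℂ] E,
    (∀ f : E, ∃ h : R f ∈ A.domain, A ⟨R f, h⟩ - z • R f = f) ∧
    ∀ x : A.domain, R (A x - z • (x : E)) = x

/-- The spectrum of an unbounded operator: the complement of the resolvent set. -/
def opSpectrum (A : E →ₗ.[ℂ] E) : Set ℂ := {z | ¬ IsResolventPoint A z}

/-- The eigenspace `ker (A - z)`. -/
def opEigenspace (A : E →ₗ.[ℂ] E) (z : ℂ) : Submodule ℂ E where
  carrier := {f | ∃ h : f ∈ A.domain, A ⟨f, h⟩ = z • f}
  zero_mem' := ⟨A.domain.zero_mem, by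
    have h : A (0 : A.domain) = 0 := A.map_zero
    rw [smul_zero]; exact h⟩
  add_mem' := by
    rintro f g ⟨hf, hf'⟩ ⟨hg, hg'⟩
    refine ⟨A.domain.add_mem hf hg, ?_⟩
    have h := A.map_add ⟨f, hf⟩ ⟨g, hg⟩
    rw [smul_add, ← hf', ← hg', ← h]
    rfl
  smul_mem' := by
    rintro c f ⟨hf, hf'⟩
    refine ⟨A.domain.smul_mem c hf, ?_⟩
    have h := A.map_smul c ⟨f, hf⟩
    rw [smul_comm, ← hf', ← h]
    rfl

/-- The spectrum of `A` is purely discrete and simple, and it consists of the eigenvalues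
`ε 0 < ε 1 < ε 2 < …`, which tend to infinity.
(There is at most one such sequence `ε` for a given `A`.) -/
structure HasSimpleDiscreteSpectrum (A : E →ₗ.[ℂ] E) (ε : ℕ → ℝ) : Prop where
  strictMono : StrictMono ε
  tendsto_atTop : Tendsto ε atTop atTop
  spectrum_eq : opSpectrum A = range (fun n => (ε n : ℂ))
  simple : ∀ n, Module.finrank ℂ (opEigenspace A (ε n : ℂ)) = 1

/-- `μ` is the spectral measure of the self-adjoint operator `A` at the vector `ψ`, that is,
the finite Borel measure on the line with
`⟪ψ, (A - z)⁻¹ ψ⟫ = ∫ (t - z)⁻¹ dμ(t)` for all non-real `z`. -/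
def IsSpectralMeasure (A : E →ₗ.[ℂ] E) (ψ : E) (μ : Measure ℝ) : Prop :=
  IsFiniteMeasure μ ∧ ∀ z : ℂ, z.im ≠ 0 → ∀ f : A.domain, A f - z • (f : E) = ψ →
    inner ℂ ψ (f : E) = ∫ t : ℝ, ((t : ℂ) - z)⁻¹ ∂μ

/-- `A` is self-adjoint with purely absolutely continuous spectrum: the spectral measure at
every vector is absolutely continuous with respect to the Lebesgue measure. -/
def HasPurelyACSpectrum [CompleteSpace E] (A : E →ₗ.[ℂ] E) : Prop :=
  IsSelfAdjoint A ∧ ∀ ψ : E, ∃ μ : Measure ℝ, IsSpectralMeasure A ψ μ ∧ μ ≪ volume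

end Operators

/-! ### The potential -/

/-- `v₊ ∈ L²_loc(ℝ)` and `v₋ ∈ (L² + L^∞)(ℝ)`, where `v₊ = max(v, 0)` and `v₋ = max(-v, 0)`. -/
def CondV1 (v : ℝ → ℝ) : Prop :=
  (∀ K : Set ℝ, IsCompact K → MemLp (fun x => max (v x) 0) 2 (volume.restrict K)) ∧
  ∃ f g : ℝ → ℝ, MemLp f 2 volume ∧ MemLp g ⊤ volume ∧
    ∀ᵐ x ∂volume, max (-v x) 0 = f x + g x

/-! ### The fiber operators on `L²(ℝ)` -/

/-- The differential expression `-φ'' + (p + B x)² φ + v φ`. -/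
noncomputable def fiberExpr (B : ℝ) (v : ℝ → ℝ) (p : ℝ) (φ : ℝ → ℂ) : ℝ → ℂ :=
  fun x => -deriv (deriv φ) x + (((p + B * x) ^ 2 : ℝ) : ℂ) * φ x + (v x : ℂ) * φ x

theorem fiberExpr_add (B : ℝ) (v : ℝ → ℝ) (p : ℝ) {φ χ : ℝ → ℂ}
    (hφ : ContDiff ℝ ∞ φ) (hχ : ContDiff ℝ ∞ χ) :
    fiberExpr B v p (φ + χ) = fiberExpr B v p φ + fiberExpr B v p χ := by
  have h1 : deriv (φ + χ) = deriv φ + deriv χ := by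
    funext x
    exact deriv_add (hφ.differentiable (by simp) x) (hχ.differentiable (by simp) x)
  have h2 : deriv (deriv φ + deriv χ) = deriv (deriv φ) + deriv (deriv χ) := by
    funext x
    exact deriv_add ((hφ.deriv' (n := ∞)).differentiable (by simp) x)
      ((hχ.deriv' (n := ∞)).differentiable (by simp) x)
  funext x
  simp only [fiberExpr, h1, h2, Pi.add_apply]
  ring

theorem fiberExpr_smul (B : ℝ) (v : ℝ → ℝ) (p : ℝ) (c : ℂ) (φ : ℝ → ℂ) :
    fiberExpr B v p (c • φ) = c • fiberExpr B v p φ := by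
  have h1 : ∀ χ : ℝ → ℂ, deriv (c • χ) = c • deriv χ := by
    intro χ
    funext x
    exact deriv_const_smul_field c χ
  funext x
  simp only [fiberExpr, h1, Pi.smul_apply, smul_eq_mul]
  ring

/-- The graph of the differential expression on `C_c^∞(ℝ)`, as a subspace of
`L²(ℝ) × L²(ℝ)`. -/
noncomputable def fiberCoreGraph (B : ℝ) (v : ℝ → ℝ) (p : ℝ) :
    Submodule ℂ (Lp ℂ 2 (volume : Measure ℝ) × Lp ℂ 2 (volume : Measure ℝ)) where
  carrier := {q | ∃ φ : ℝ → ℂ, ContDiff ℝ ∞ φ ∧ HasCompactSupport φ ∧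
    q.1 =ᵐ[volume] φ ∧ q.2 =ᵐ[volume] fiberExpr B v p φ}
  zero_mem' := ⟨0, contDiff_const, HasCompactSupport.zero, Lp.coeFn_zero _ _ _, by
    have h : fiberExpr B v p 0 = 0 := by simpa using fiberExpr_smul B v p 0 0
    rw [h]; exact Lp.coeFn_zero _ _ _⟩
  add_mem' := by
    rintro a b ⟨φ, hφ, hφc, h1, h2⟩ ⟨χ, hχ, hχc, h3, h4⟩
    refine ⟨φ + χ, hφ.add hχ, hφc.add hχc, (Lp.coeFn_add _ _).trans (h1.add h3), ?_⟩
    rw [fiberExpr_add B v p hφ hχ]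
    exact (Lp.coeFn_add _ _).trans (h2.add h4)
  smul_mem' := by
    rintro c a ⟨φ, hφ, hφc, h1, h2⟩
    refine ⟨c • φ, hφ.const_smul c, hφc.smul_left (f := fun _ => c),
      (Lp.coeFn_smul _ _).trans (h1.const_smul c), ?_⟩
    rw [fiberExpr_smul]
    exact (Lp.coeFn_smul _ _).trans (h2.const_smul c)

/-- The graph is single-valued, so it is the graph of an operator. -/
theorem fiberCoreGraph_fst_eq_zero (B : ℝ) (v : ℝ → ℝ) (p : ℝ) :
    ∀ q ∈ fiberCoreGraph B v p, q.1 = 0 → q.2 = 0 := by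
  rintro ⟨a, b⟩ ⟨φ, hφ, -, h1, h2⟩ (rfl : a = 0)
  have h0 : φ =ᵐ[volume] (fun _ => (0 : ℂ)) := h1.symm.trans (Lp.coeFn_zero _ _ _)
  have hz : φ = 0 :=
    (hφ.continuous.ae_eq_iff_eq volume continuous_const).1 h0
  have h : fiberExpr B v p φ = 0 := by
    rw [hz]; simpa using fiberExpr_smul B v p 0 0
  rw [h] at h2
  exact (Lp.eq_zero_iff_ae_eq_zero).2 h2

/-- The fiber operator `h_v(p) = -∂² + (p + B x)² + v(x)` on `L²(ℝ)`: the closure of its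
restriction to `C_c^∞(ℝ)`. -/
noncomputable def fiberOp (B : ℝ) (v : ℝ → ℝ) (p : ℝ) :
    Lp ℂ 2 (volume : Measure ℝ) →ₗ.[ℂ] Lp ℂ 2 (volume : Measure ℝ) :=
  (fiberCoreGraph B v p).toLinearPMap.closure

/-! ### The perturbed Landau Hamiltonian on `L²(ℝ²)` -/

/-- `-i ∂_x φ`. -/
noncomputable def momentumX (φ : ℝ × ℝ → ℂ) : ℝ × ℝ → ℂ :=
  fun q => -Complex.I * deriv (fun s => φ (s, q.2)) q.1

/-- `(-i ∂_y + B x) φ`. -/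
noncomputable def momentumY (B : ℝ) (φ : ℝ × ℝ → ℂ) : ℝ × ℝ → ℂ :=
  fun q => -Complex.I * deriv (fun s => φ (q.1, s)) q.2 + ((B * q.1 : ℝ) : ℂ) * φ q

/-- The differential expression `(-i ∂_x)² φ + (-i ∂_y + B x)² φ + v(x) φ`. -/
noncomputable def landauExpr (B : ℝ) (v : ℝ → ℝ) (φ : ℝ × ℝ → ℂ) : ℝ × ℝ → ℂ :=
  fun q => momentumX (momentumX φ) q + momentumY B (momentumY B φ) q + (v q.1 : ℂ) * φ q

theorem momentumX_eq {φ : ℝ × ℝ → ℂ} (hφ : ContDiff ℝ ∞ φ) :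
    momentumX φ = fun q => -Complex.I * fderiv ℝ φ q (1, 0) := by
  funext q
  have h1 : HasDerivAt (fun s : ℝ => (s, q.2)) ((1 : ℝ), (0 : ℝ)) q.1 :=
    (hasDerivAt_id q.1).prodMk (hasDerivAt_const q.1 q.2)
  have h2 : HasFDerivAt φ (fderiv ℝ φ q) (q.1, q.2) :=
    (hφ.differentiable (by simp) q).hasFDerivAt
  have h3 : HasDerivAt (fun s => φ (s, q.2)) (fderiv ℝ φ q (1, 0)) q.1 :=
    h2.comp_hasDerivAt q.1 h1
  simp only [momentumX, h3.deriv]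

theorem momentumY_eq (B : ℝ) {φ : ℝ × ℝ → ℂ} (hφ : ContDiff ℝ ∞ φ) :
    momentumY B φ =
      fun q => -Complex.I * fderiv ℝ φ q (0, 1) + ((B * q.1 : ℝ) : ℂ) * φ q := by
  funext q
  have h1 : HasDerivAt (fun s : ℝ => (q.1, s)) ((0 : ℝ), (1 : ℝ)) q.2 :=
    (hasDerivAt_const q.2 q.1).prodMk (hasDerivAt_id q.2)
  have h2 : HasFDerivAt φ (fderiv ℝ φ q) (q.1, q.2) :=
    (hφ.differentiable (by simp) q).hasFDerivAt
  have h3 : HasDerivAt (fun s => φ (q.1, s)) (fderiv ℝ φ q (0, 1)) q.2 :=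
    h2.comp_hasDerivAt q.2 h1
  simp only [momentumY, h3.deriv]

theorem contDiff_momentumX {φ : ℝ × ℝ → ℂ} (hφ : ContDiff ℝ ∞ φ) :
    ContDiff ℝ ∞ (momentumX φ) := by
  rw [momentumX_eq hφ]
  exact contDiff_const.mul ((hφ.fderiv_right (m := ∞) (by simp)).clm_apply contDiff_const)

theorem contDiff_momentumY (B : ℝ) {φ : ℝ × ℝ → ℂ} (hφ : ContDiff ℝ ∞ φ) :
    ContDiff ℝ ∞ (momentumY B φ) := by
  rw [momentumY_eq B hφ]
  exact (contDiff_const.mul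
    ((hφ.fderiv_right (m := ∞) (by simp)).clm_apply contDiff_const)).add
    ((Complex.ofRealCLM.contDiff.comp (contDiff_const.mul contDiff_fst)).mul hφ)

theorem momentumX_add {φ χ : ℝ × ℝ → ℂ} (hφ : ContDiff ℝ ∞ φ) (hχ : ContDiff ℝ ∞ χ) :
    momentumX (φ + χ) = momentumX φ + momentumX χ := by
  rw [momentumX_eq hφ, momentumX_eq hχ, momentumX_eq (φ := φ + χ) (hφ.add hχ)]
  funext q
  rw [fderiv_add (hφ.differentiable (by simp) q) (hχ.differentiable (by simp) q)]
  simp only [add_apply, Pi.add_apply]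
  ring

theorem momentumY_add (B : ℝ) {φ χ : ℝ × ℝ → ℂ} (hφ : ContDiff ℝ ∞ φ)
    (hχ : ContDiff ℝ ∞ χ) :
    momentumY B (φ + χ) = momentumY B φ + momentumY B χ := by
  rw [momentumY_eq B hφ, momentumY_eq B hχ, momentumY_eq B (φ := φ + χ) (hφ.add hχ)]
  funext q
  rw [fderiv_add (hφ.differentiable (by simp) q) (hχ.differentiable (by simp) q)]
  simp only [add_apply, Pi.add_apply]
  ring

theorem landauExpr_add (B : ℝ) (v : ℝ → ℝ) {φ χ : ℝ × ℝ → ℂ}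
    (hφ : ContDiff ℝ ∞ φ) (hχ : ContDiff ℝ ∞ χ) :
    landauExpr B v (φ + χ) = landauExpr B v φ + landauExpr B v χ := by
  funext q
  simp only [landauExpr, momentumX_add hφ hχ, momentumY_add B hφ hχ,
    momentumX_add (contDiff_momentumX hφ) (contDiff_momentumX hχ),
    momentumY_add B (contDiff_momentumY B hφ) (contDiff_momentumY B hχ), Pi.add_apply]
  ring

theorem landauExpr_smul (B : ℝ) (v : ℝ → ℝ) (c : ℂ) (φ : ℝ × ℝ → ℂ) :
    landauExpr B v (c • φ) = c • landauExpr B v φ := by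
  have hd : ∀ (g : ℝ → ℂ) (s : ℝ), deriv (fun t => c * g t) s = c * deriv g s :=
    fun g s => deriv_const_mul_field c
  have h1 : ∀ χ : ℝ × ℝ → ℂ, momentumX (c • χ) = c • momentumX χ := by
    intro χ
    funext q
    simp only [momentumX, Pi.smul_apply, smul_eq_mul, hd]
    ring
  have h2 : ∀ χ : ℝ × ℝ → ℂ, momentumY B (c • χ) = c • momentumY B χ := by
    intro χ
    funext q
    simp only [momentumY, Pi.smul_apply, smul_eq_mul, hd]
    ring
  funext q
  simp only [landauExpr, h1, h2, Pi.smul_apply, smul_eq_mul]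
  ring

/-- The graph of the differential expression on `C_c^∞(ℝ²)`, as a subspace of
`L²(ℝ²) × L²(ℝ²)`. -/
noncomputable def landauCoreGraph (B : ℝ) (v : ℝ → ℝ) :
    Submodule ℂ (Lp ℂ 2 (volume : Measure (ℝ × ℝ)) × Lp ℂ 2 (volume : Measure (ℝ × ℝ))) where
  carrier := {q | ∃ φ : ℝ × ℝ → ℂ, ContDiff ℝ ∞ φ ∧ HasCompactSupport φ ∧
    q.1 =ᵐ[volume] φ ∧ q.2 =ᵐ[volume] landauExpr B v φ}
  zero_mem' := ⟨0, contDiff_const, HasCompactSupport.zero, Lp.coeFn_zero _ _ _, by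
    have h : landauExpr B v 0 = 0 := by simpa using landauExpr_smul B v 0 0
    rw [h]; exact Lp.coeFn_zero _ _ _⟩
  add_mem' := by
    rintro a b ⟨φ, hφ, hφc, h1, h2⟩ ⟨χ, hχ, hχc, h3, h4⟩
    refine ⟨φ + χ, hφ.add hχ, hφc.add hχc, (Lp.coeFn_add _ _).trans (h1.add h3), ?_⟩
    rw [landauExpr_add B v hφ hχ]
    exact (Lp.coeFn_add _ _).trans (h2.add h4)
  smul_mem' := by
    rintro c a ⟨φ, hφ, hφc, h1, h2⟩
    refine ⟨c • φ, hφ.const_smul c, hφc.smul_left (f := fun _ => c),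
      (Lp.coeFn_smul _ _).trans (h1.const_smul c), ?_⟩
    rw [landauExpr_smul]
    exact (Lp.coeFn_smul _ _).trans (h2.const_smul c)

/-- The graph is single-valued, so it is the graph of an operator. -/
theorem landauCoreGraph_fst_eq_zero (B : ℝ) (v : ℝ → ℝ) :
    ∀ q ∈ landauCoreGraph B v, q.1 = 0 → q.2 = 0 := by
  rintro ⟨a, b⟩ ⟨φ, hφ, -, h1, h2⟩ (rfl : a = 0)
  have h0 : φ =ᵐ[volume] (fun _ => (0 : ℂ)) := h1.symm.trans (Lp.coeFn_zero _ _ _)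
  have hz : φ = 0 :=
    (hφ.continuous.ae_eq_iff_eq volume continuous_const).1 h0
  have h : landauExpr B v φ = 0 := by
    rw [hz]; simpa using landauExpr_smul B v 0 0
  rw [h] at h2
  exact (Lp.eq_zero_iff_ae_eq_zero).2 h2

/-- The operator `H_L + V = (-i ∂_x)² + (-i ∂_y + B x)² + v(x)` on `L²(ℝ²)`: the closure of
its restriction to `C_c^∞(ℝ²)`. -/
noncomputable def landauOp (B : ℝ) (v : ℝ → ℝ) :
    Lp ℂ 2 (volume : Measure (ℝ × ℝ)) →ₗ.[ℂ] Lp ℂ 2 (volume : Measure (ℝ × ℝ)) :=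
  (landauCoreGraph B v).toLinearPMap.closure

end TransInv

/-! Everything reduces to one-dimensional operators. The potential does not depend on `y`, so a
Fourier transform in `y` turns `H_L + V` into the family `h_v(2πξ)`. A shift of `x` by `p / B` turns
`h_v(p)` into the fixed oscillator `-∂² + B² x²` plus the travelling potential `v(x - p / B)`.
Oscillator states are localized, so they see only `v₊` as `p → -∞` and only `v₋` as `p → +∞`. Hence
the `n`-th eigenvalue tends to `v₊ + B (2n + 1)`, respectively `v₋ + B (2n + 1)`, and since `v₊ ≠
v₋` no branch is constant.

Each branch is moreover real analytic in `p`, and a nonconstant real analytic function pulls null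
sets back to null sets (`measure_preimage_eq_zero_of_analytic`). If `Φ` is the partial Fourier
transform of `ψ` and `b p n` are the eigenvectors of `h_v(p)`, the spectral measure of `H_L + V` at
`ψ` is the sum over `n` of the images of `|⟪b (2πξ) n, Φ ξ⟫|² dξ` under `ξ ↦ ε_n(2πξ)`. It is
therefore absolutely continuous (`SquareBounded.exists_spectralMeasure`).

The potential enters only through a bound `|v| ≤ |f| + c` with `f ∈ L²`, which the local hypotheses
and the limits at infinity provide. All analysis is done on polynomials times a Gaussian, where the
oscillator acts algebraically. The range of the oscillator plus `M` on these functions is dense, and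
energy estimates bound `x` and `v` relative to it with norm `O(M^(-1/2))`. A Neumann series then
gives a compact inverse of `h_v(p) + M`, analytic in `p` (`isInverseOf_fiberRes`,
`analyticAt_fiberRes`). Self-adjointness and discreteness follow from this inverse. Analyticity
comes from the implicit function theorem, with Weyl's inequality identifying the branches
(`EigenSystem.analyticAt`). The asymptotics come from the resolvent identity and Weyl's inequality
(`tendsto_eigenvalue`). Simplicity is a Wronskian argument (`exists_eq_smul_of_eigen`).

For the plane, a weak equation for `H_L + V` passes to almost every fiber (`ae_inner_fiberOp`). This
gives both the triviality of the deficiency spaces and the fiberwise form of the resolvent. -/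

namespace TransInv

section

/-! ### Symmetric graphs, self-adjointness, and discrete spectrum through a compact inverse -/

section AbstractOperators

variable {E : Type*} [NormedAddCommGroup E] [InnerProductSpace ℂ E]

local notation "⟪" x ", " y "⟫" => inner ℂ x y

/-- A linear relation on which the form `⟪x, A y⟫ - ⟪A x, y⟫` vanishes. -/
def SymmGraph (G : Submodule ℂ (E × E)) : Prop :=
  ∀ a ∈ G, ∀ b ∈ G, ⟪a.1, b.2⟫ = ⟪a.2, b.1⟫

theorem SymmGraph.closure {G : Submodule ℂ (E × E)} (h : SymmGraph G) :
    SymmGraph G.topologicalClosure := by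
  have h1 : ∀ a ∈ G, ∀ b ∈ G.topologicalClosure, ⟪a.1, b.2⟫ = ⟪a.2, b.1⟫ := by
    intro a ha
    have hc : IsClosed {b : E × E | ⟪a.1, b.2⟫ = ⟪a.2, b.1⟫} :=
      isClosed_eq (by fun_prop) (by fun_prop)
    exact fun b hb => closure_minimal (fun b hb => h a ha b hb) hc hb
  intro a ha b hb
  have hc : IsClosed {a : E × E | ⟪a.1, b.2⟫ = ⟪a.2, b.1⟫} :=
    isClosed_eq (by fun_prop) (by fun_prop)
  exact closure_minimal (fun a ha => h1 a ha b hb) hc ha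

/-- Closability: if `(0, y)` is a limit of graph elements, symmetry makes `y` orthogonal to the
dense set of first components. -/
theorem SymmGraph.snd_eq_zero {G : Submodule ℂ (E × E)} (h : SymmGraph G)
    (hd : Dense (Prod.fst '' (G : Set (E × E)))) :
    ∀ q ∈ G.topologicalClosure, q.1 = 0 → q.2 = 0 := by
  rintro ⟨x, y⟩ hq (rfl : x = 0)
  refine hd.eq_zero_of_inner_right ℂ (x := y) ?_
  intro w hw
  obtain ⟨a, ha, rfl⟩ := hw
  have := h.closure a (G.le_topologicalClosure ha) _ hq
  simpa using this

/-- `LinearPMap.closure` returns its argument unchanged when the operator is not closable, so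
closability has to be established before the closure means anything. -/
theorem SymmGraph.closure_graph {G : Submodule ℂ (E × E)} (h : SymmGraph G)
    (hsv : ∀ q ∈ G, q.1 = 0 → q.2 = 0)
    (hd : Dense (Prod.fst '' (G : Set (E × E)))) :
    G.toLinearPMap.closure.graph = G.topologicalClosure := by
  have h0 : G.toLinearPMap.graph = G := Submodule.toLinearPMap_graph_eq G hsv
  have h1 : G.toLinearPMap.IsClosable :=
    ⟨G.topologicalClosure.toLinearPMap, by
      rw [h0, Submodule.toLinearPMap_graph_eq _ (h.snd_eq_zero hd)]⟩
  rw [← h1.graph_closure_eq_closure_graph, h0]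

theorem dense_domain_of_graph_eq {G : Submodule ℂ (E × E)} {A : E →ₗ.[ℂ] E}
    (hA : A.graph = G.topologicalClosure)
    (hd : Dense (Prod.fst '' (G : Set (E × E)))) : Dense (A.domain : Set E) := by
  refine hd.mono ?_
  rintro _ ⟨a, ha, rfl⟩
  exact LinearPMap.mem_domain_of_mem_graph
    (show (a.1, a.2) ∈ A.graph from hA ▸ G.le_topologicalClosure ha)

/-- For `y` in the domain of the adjoint, solve `(A - z) x₀ = (A* - z) y`. Then `y - x₀` is
orthogonal to the range of `A - z̄`, which is everything, so `y = x₀` lies in the domain. Real `z`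
is allowed. -/
theorem isSelfAdjoint_of_surjective [CompleteSpace E] {A : E →ₗ.[ℂ] E}
    (hd : Dense (A.domain : Set E)) (hs : SymmGraph A.graph) (z : ℂ)
    (h1 : ∀ f : E, ∃ x : A.domain, A x - z • (x : E) = f)
    (h2 : ∀ f : E, ∃ x : A.domain, A x - (starRingEnd ℂ z) • (x : E) = f) :
    IsSelfAdjoint A := by
  have hsym : ∀ x y : A.domain, ⟪(x : E), A y⟫ = ⟪A x, (y : E)⟫ := fun x y =>
    hs _ (A.mem_graph x) _ (A.mem_graph y)
  have hle : A ≤ A.adjoint :=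
    LinearPMap.IsFormalAdjoint.le_adjoint hd (fun x y => (hsym x y).symm)
  rw [LinearPMap.isSelfAdjoint_def]
  refine (LinearPMap.eq_of_le_of_domain_eq hle (le_antisymm hle.1 ?_)).symm
  intro y hy
  obtain ⟨x0, hx0⟩ := h1 (A.adjoint ⟨y, hy⟩ - z • y)
  have key : ∀ x : A.domain, ⟪y - (x0 : E), A x - (starRingEnd ℂ z) • (x : E)⟫ = 0 := by
    intro x
    have ha : ⟪A.adjoint ⟨y, hy⟩, (x : E)⟫ = ⟪y, A x⟫ :=
      LinearPMap.adjoint_isFormalAdjoint hd ⟨y, hy⟩ x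
    have hb : A.adjoint ⟨y, hy⟩ = A x0 - z • (x0 : E) + z • y := by rw [hx0]; abel
    rw [hb] at ha
    simp only [inner_sub_left, inner_add_left, inner_smul_left, inner_sub_right,
      inner_smul_right] at ha ⊢
    rw [hsym x0 x, ← ha]
    ring
  obtain ⟨x, hx⟩ := h2 (y - x0)
  have := key x
  rw [hx, inner_self_eq_zero, sub_eq_zero] at this
  rw [this]; exact x0.2

/-- `K` is the inverse of `A + M`. -/
def IsInverseOf (K : E →L[ℂ] E) (A : E →ₗ.[ℂ] E) (M : ℝ) : Prop :=
  ∀ x y, (x, y) ∈ A.graph ↔ K (y + (M : ℂ) • x) = x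

/-- For a symmetric operator an everywhere defined right inverse is also a left inverse: the defect
`d` lies in the kernel of `A + M`, and pairing it with `(A + M) K d = d` gives `⟪d, d⟫ = 0`. -/
theorem isInverseOf_of_mem {A : E →ₗ.[ℂ] E} (hs : SymmGraph A.graph) {K : E →L[ℂ] E} {M : ℝ}
    (hK : ∀ f, (K f, f - (M : ℂ) • K f) ∈ A.graph) : IsInverseOf K A M := by
  intro x y
  constructor
  · intro hxy
    have hd : (x - K (y + (M : ℂ) • x), y - (y + (M : ℂ) • x - (M : ℂ) • K (y + (M : ℂ) • x)))
        ∈ A.graph := A.graph.sub_mem hxy (hK _)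
    set d := x - K (y + (M : ℂ) • x) with hdd
    have e : y - (y + (M : ℂ) • x - (M : ℂ) • K (y + (M : ℂ) • x)) = -((M : ℂ) • d) := by
      rw [hdd, smul_sub]; abel
    rw [e] at hd
    have h1 := hs _ hd _ (hK d)
    simp only [inner_sub_right, inner_smul_right, inner_neg_left, inner_smul_left,
      Complex.conj_ofReal] at h1
    have h2 : ⟪d, d⟫ = 0 := by linear_combination h1
    rw [inner_self_eq_zero] at h2
    rw [hdd, sub_eq_zero] at h2
    exact h2.symm
  · intro h
    have := hK (y + (M : ℂ) • x)
    rw [h] at this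
    simpa using this

theorem IsInverseOf.mem {A : E →ₗ.[ℂ] E} {K : E →L[ℂ] E} {M : ℝ} (h : IsInverseOf K A M) (f : E) :
    (K f, f - (M : ℂ) • K f) ∈ A.graph := by
  rw [h]; simp

theorem IsInverseOf.inner_comm {A : E →ₗ.[ℂ] E} {K : E →L[ℂ] E} {M : ℝ} (h : IsInverseOf K A M)
    (hs : SymmGraph A.graph) (f g : E) : ⟪K f, g⟫ = ⟪f, K g⟫ := by
  have := hs _ (h.mem f) _ (h.mem g)
  simp only [inner_sub_right, inner_sub_left, inner_smul_right, inner_smul_left,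
    Complex.conj_ofReal] at this
  linear_combination this

theorem IsInverseOf.injective {A : E →ₗ.[ℂ] E} {K : E →L[ℂ] E} {M : ℝ} (h : IsInverseOf K A M)
    {f : E} (hf : K f = 0) : f = 0 := by
  have := h.mem f
  rw [hf] at this
  simpa using A.graph_fst_eq_zero_snd this rfl

theorem IsInverseOf.isSelfAdjoint [CompleteSpace E] {A : E →ₗ.[ℂ] E} {K : E →L[ℂ] E} {M : ℝ}
    (h : IsInverseOf K A M) (hs : SymmGraph A.graph) (hd : Dense (A.domain : Set E)) :
    IsSelfAdjoint A := by
  have key : ∀ f : E, ∃ x : A.domain, A x - (-(M : ℂ)) • (x : E) = f := by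
    intro f
    obtain ⟨x, hx, hx'⟩ := (LinearPMap.mem_graph_iff _).1 (h.mem f)
    refine ⟨x, ?_⟩
    simp only at hx hx'
    rw [hx', hx]; simp
  refine isSelfAdjoint_of_surjective hd hs (-(M : ℂ)) key ?_
  simpa using key

/-- Eigenvectors, in terms of the inverse of `A + M`. -/
theorem IsInverseOf.eigen_iff {A : E →ₗ.[ℂ] E} {K : E →L[ℂ] E} {M : ℝ} (h : IsInverseOf K A M)
    (x : E) (z : ℂ) : (x, z • x) ∈ A.graph ↔ (z + M) • K x = x := by
  rw [h, ← add_smul, map_smul]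

theorem mem_opEigenspace_iff {A : E →ₗ.[ℂ] E} {x : E} {z : ℂ} :
    x ∈ opEigenspace A z ↔ (x, z • x) ∈ A.graph := by
  rw [LinearPMap.mem_graph_iff]
  constructor
  · rintro ⟨h, h'⟩
    exact ⟨⟨x, h⟩, rfl, h'⟩
  · rintro ⟨⟨y, hy⟩, rfl, h⟩
    exact ⟨hy, h⟩

/-- An orthonormal basis of eigenvectors, with increasing eigenvalues. -/
structure EigenSystem (A : E →ₗ.[ℂ] E) (ε : ℕ → ℝ) (b : HilbertBasis ℕ ℂ E) : Prop where
  strictMono : StrictMono ε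
  tendsto : Tendsto ε atTop atTop
  mem : ∀ n, (b n, (ε n : ℂ) • b n) ∈ A.graph

/-- In the coordinates of the eigenbasis the operator is multiplication by `ε`; simplicity and the
list of eigenvalues are read off from this. -/
theorem EigenSystem.inner_eq_zero {A : E →ₗ.[ℂ] E} {ε : ℕ → ℝ} {b : HilbertBasis ℕ ℂ E}
    (h : EigenSystem A ε b) (hs : SymmGraph A.graph) {x y : E} (hx : (x, y) ∈ A.graph) (n : ℕ) :
    ⟪b n, y⟫ = ε n * ⟪b n, x⟫ := by
  have := hs _ (h.mem n) _ hx
  simpa [inner_smul_left] using this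

theorem HilbertBasis.ext_inner (b : HilbertBasis ℕ ℂ E) {x y : E}
    (h : ∀ n, ⟪b n, x⟫ = ⟪b n, y⟫) : x = y := by
  apply b.repr.injective
  ext n
  simpa [b.repr_apply_apply] using h n

theorem EigenSystem.eq_smul {A : E →ₗ.[ℂ] E} {ε : ℕ → ℝ} {b : HilbertBasis ℕ ℂ E}
    (h : EigenSystem A ε b) (hs : SymmGraph A.graph) {x : E} {n : ℕ}
    (hx : (x, (ε n : ℂ) • x) ∈ A.graph) : x = ⟪b n, x⟫ • b n := by
  refine HilbertBasis.ext_inner b fun m => ?_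
  rw [inner_smul_right, orthonormal_iff_ite.1 b.orthonormal]
  by_cases hmn : m = n
  · simp [hmn]
  · have := h.inner_eq_zero hs hx m
    rw [inner_smul_right] at this
    have h2 : ((ε n : ℂ) - ε m) * ⟪b m, x⟫ = 0 := by linear_combination this
    rcases mul_eq_zero.1 h2 with h3 | h3
    · rw [sub_eq_zero] at h3
      exact absurd (h.strictMono.injective (by exact_mod_cast h3)).symm hmn
    · simp [h3, hmn]

theorem EigenSystem.eigenvalue_mem {A : E →ₗ.[ℂ] E} {ε : ℕ → ℝ} {b : HilbertBasis ℕ ℂ E}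
    (h : EigenSystem A ε b) (hs : SymmGraph A.graph) {x : E} (hx0 : x ≠ 0) {z : ℂ}
    (hx : (x, z • x) ∈ A.graph) : ∃ n, z = ε n := by
  by_contra! hz
  refine hx0 (HilbertBasis.ext_inner b fun n => ?_)
  have := h.inner_eq_zero hs hx n
  rw [inner_smul_right] at this
  have h2 : (z - ε n) * ⟪b n, x⟫ = 0 := by linear_combination this
  rcases mul_eq_zero.1 h2 with h3 | h3
  · exact absurd (sub_eq_zero.1 h3) (hz n)
  · simpa using h3

theorem EigenSystem.hasSimpleDiscreteSpectrum [CompleteSpace E] {A : E →ₗ.[ℂ] E} {ε : ℕ → ℝ}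
    {b : HilbertBasis ℕ ℂ E} (h : EigenSystem A ε b) (hs : SymmGraph A.graph) {K : E →L[ℂ] E}
    {M : ℝ} (hK : IsInverseOf K A M) (hc : IsCompactOperator K) :
    HasSimpleDiscreteSpectrum A ε where
  strictMono := h.strictMono
  tendsto_atTop := h.tendsto
  spectrum_eq := by
    ext z
    simp only [opSpectrum, mem_ofPred_eq, mem_range]
    constructor
    · intro hz
      by_contra! hn
      refine hz ?_
      -- For `z = -M` the resolvent is `K` itself; otherwise the Riesz–Schauder alternative applies
      -- to `K` at `(z + M)⁻¹`.
      by_cases hzM : z + M = 0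
      · have hzM' : z = -(M : ℂ) := by linear_combination hzM
        refine ⟨K, fun f => ?_, fun x => ?_⟩
        · obtain ⟨⟨x, hxd⟩, hx, hx'⟩ := (LinearPMap.mem_graph_iff _).1 (hK.mem f)
          simp only at hx hx'
          subst hx
          refine ⟨hxd, ?_⟩
          rw [hx', hzM']; simp
        · have := (hK _ _).1 (A.mem_graph x)
          rw [hzM', neg_smul, sub_neg_eq_add, this]
      · have hμ : (z + M)⁻¹ ≠ 0 := inv_ne_zero hzM
        rcases hc.hasEigenvalue_or_mem_resolventSet hμ with he | he
        · obtain ⟨x, hx⟩ := he.exists_hasEigenvector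
          have h1 : K x = (z + M)⁻¹ • x := hx.apply_eq_smul
          obtain ⟨n, hn'⟩ := h.eigenvalue_mem hs hx.2 ((hK.eigen_iff x z).2 (by
            rw [h1, smul_smul, mul_inv_cancel₀ hzM, one_smul]))
          exact absurd hn'.symm (hn n)
        · obtain ⟨u, hu⟩ := he
          set S : E →L[ℂ] E := ↑u⁻¹ with hS
          have hu' : (u : E →L[ℂ] E) = (z + M)⁻¹ • 1 - K := by
            rw [hu, Algebra.algebraMap_eq_smul_one]
          have hSl : ∀ x, S ((z + M)⁻¹ • x - K x) = x := fun x => by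
            have := congrArg (fun T : E →L[ℂ] E => T x) u.inv_mul
            simpa [hu'] using this
          have hSr : ∀ x, (z + M)⁻¹ • S x - K (S x) = x := fun x => by
            have := congrArg (fun T : E →L[ℂ] E => T x) u.mul_inv
            simpa [hu'] using this
          -- With `S = ((z + M)⁻¹ - K)⁻¹`, the equation `(A - z) x = f` reads `K f = (z + M) ((z +
          -- M)⁻¹ x - K x)`, so the resolvent is `(z + M)⁻¹ S K`.
          have main : ∀ x f, (z + M)⁻¹ • S (K f) = x ↔ (x, f + z • x) ∈ A.graph := by
            intro x f
            rw [hK, add_assoc, ← add_smul, map_add, map_smul]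
            constructor
            · rintro rfl
              have e := hSr (K f)
              rw [map_smul, smul_smul, mul_inv_cancel₀ hzM, one_smul]
              exact (sub_eq_iff_eq_add.1 e).symm
            · intro e
              have e1 : K f = (z + M) • ((z + M)⁻¹ • x - K x) := by
                rw [smul_sub, smul_smul, mul_inv_cancel₀ hzM, one_smul]
                exact eq_sub_of_add_eq e
              rw [e1, map_smul, hSl, smul_smul, inv_mul_cancel₀ hzM, one_smul]
          refine ⟨(z + M)⁻¹ • (S.comp K), fun f => ?_, fun x => ?_⟩
          · have := (main _ f).1 rfl
            obtain ⟨⟨x, hxd⟩, hx, hx'⟩ := (LinearPMap.mem_graph_iff _).1 this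
            simp only at hx hx'
            subst hx
            refine ⟨hxd, ?_⟩
            exact (congrArg (· - _) hx').trans (by simp)
          · exact (main x (A x - z • (x : E))).2 (by simp)
    · rintro ⟨n, rfl⟩ ⟨R, -, hR⟩
      obtain ⟨x, hx, hx'⟩ := (LinearPMap.mem_graph_iff _).1 (h.mem n)
      have := hR x
      simp only at hx hx'
      rw [hx', hx, sub_self, map_zero] at this
      exact b.orthonormal.ne_zero n this.symm
  simple n := by
    refine finrank_eq_one_iff_of_nonzero' (⟨b n, mem_opEigenspace_iff.2 (h.mem n)⟩ :
      opEigenspace A (ε n : ℂ)) ?_ |>.2 ?_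
    · intro h0
      exact b.orthonormal.ne_zero n (congrArg Subtype.val h0)
    · rintro ⟨x, hx⟩
      refine ⟨⟪b n, x⟫, Subtype.ext ?_⟩
      exact (h.eq_smul hs (mem_opEigenspace_iff.1 hx)).symm

end AbstractOperators

end

section

/-! ### Compact operators: eigenbases and Weyl's inequality -/

section SpectralTheory

variable {E : Type*} [NormedAddCommGroup E] [InnerProductSpace ℂ E]

local notation "⟪" x ", " y "⟫" => inner ℂ x y

/-- An orthonormal family of eigenvectors of a compact operator, with eigenvalues bounded away
from zero, is finite. -/
theorem finite_of_isCompactOperator {ι : Type*} {K : E →L[ℂ] E} (hc : IsCompactOperator K)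
    {e : ι → E} (he : Orthonormal ℂ e) {μ : ι → ℂ} (hμ : ∀ i, K (e i) = μ i • e i) {δ : ℝ}
    (hδ : 0 < δ) : {i | δ ≤ ‖μ i‖}.Finite := by
  by_contra hinf
  have hinf : {i | δ ≤ ‖μ i‖}.Infinite := hinf
  let f := hinf.natEmbedding
  obtain ⟨C, hC, hC'⟩ := hc.image_subset_compact_of_bounded (Metric.isBounded_closedBall (x := (0 : E)) (r := 1))
  have hmem : ∀ n, K (e (f n)) ∈ C := fun n => hC' ⟨e (f n), by simp [he.1], rfl⟩
  obtain ⟨a, -, φ, hφ, hlim⟩ := hC.tendsto_subseq hmem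
  have hcau := hlim.cauchySeq
  rw [Metric.cauchySeq_iff] at hcau
  obtain ⟨N, hN⟩ := hcau δ hδ
  have h1 := hN N le_rfl (N + 1) (Nat.le_succ N)
  simp only [Function.comp_apply] at h1
  set i : ι := (f (φ N)).1
  set j : ι := (f (φ (N + 1))).1
  have hij : i ≠ j := fun h => by
    have := hφ.injective (f.injective (Subtype.ext h))
    omega
  have h2 : δ ≤ ‖μ i‖ := (f (φ N)).2
  rw [dist_eq_norm, hμ, hμ] at h1
  -- Pairing with `e i` shows that distinct images stay at distance at least `δ`, so no subsequence
  -- of them is Cauchy.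
  have h3 : ⟪e i, μ i • e i - μ j • e j⟫ = μ i := by
    rw [inner_sub_right, inner_smul_right, inner_smul_right, he.2 hij,
      inner_self_eq_norm_sq_to_K, he.1]
    simp
  have h4 := norm_inner_le_norm (𝕜 := ℂ) (e i) (μ i • e i - μ j • e j)
  rw [h3, he.1, one_mul] at h4
  linarith

/-- An infinite set of reals with finite initial segments is enumerated increasingly by `ℕ`. -/
theorem exists_strictMono_enumeration {S : Set ℝ} (hinf : S.Infinite)
    (hfin : ∀ c, (S ∩ Iic c).Finite) :
    ∃ e : ℕ ≃ S, StrictMono (fun n => (e n : ℝ)) ∧ Tendsto (fun n => (e n : ℝ)) atTop atTop := by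
  classical
  have hlf : ∀ a b : S, (Icc a b).Finite := fun a b =>
    Finite.of_finite_image ((hfin b).subset (by rintro _ ⟨x, hx, rfl⟩; exact ⟨x.2, hx.2⟩))
      Subtype.val_injective.injOn
  -- A locally finite linear order with a least element and no maximal one is order isomorphic to
  -- `ℕ`.
  let _ : LocallyFiniteOrder S := LocallyFiniteOrder.ofFiniteIcc hlf
  obtain ⟨x0, hx0⟩ := hinf.nonempty
  obtain ⟨m, hm, hmin⟩ := (hfin x0).exists_minimal ⟨x0, hx0, mem_Iic.2 le_rfl⟩
  have hbot : ∀ a : S, (⟨m, hm.1⟩ : S) ≤ a := fun a => by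
    rcases le_total (a : ℝ) m with h | h
    · exact hmin ⟨a.2, h.trans hm.2⟩ h
    · exact h
  let _ : OrderBot S := OrderBot.mk (toBot := ⟨⟨m, hm.1⟩⟩) hbot
  have : NoMaxOrder S := ⟨fun a => by
    by_contra! h
    exact hinf ((hfin a).subset fun x hx => ⟨hx, h ⟨x, hx⟩⟩)⟩
  let _ : SuccOrder S := LinearLocallyFiniteOrder.succOrder S
  let _ : PredOrder S := LinearLocallyFiniteOrder.predOrder S
  let o : S ≃o ℕ := orderIsoNatOfLinearSuccPredArch
  refine ⟨o.symm.toEquiv, o.symm.strictMono, ?_⟩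
  refine tendsto_atTop_atTop_of_monotone (fun a b h => o.symm.monotone h) fun c => ?_
  by_contra! h
  have : (Set.range fun n => (o.symm n : ℝ)).Finite :=
    (hfin c).subset (by rintro _ ⟨n, rfl⟩; exact ⟨(o.symm n).2, (h n).le⟩)
  exact Set.infinite_range_of_injective
    (f := fun n => (o.symm n : ℝ)) (fun a b h => o.symm.injective (Subtype.ext h)) this

/-- Since eigenspaces are lines, one unit eigenvector per eigenvalue suffices. Compactness of `K`
leaves finitely many eigenvalues below each bound, the spectral theorem for `K` makes the family
complete, and infinite dimension makes it infinite. -/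
theorem exists_eigenSystem [CompleteSpace E] {A : E →ₗ.[ℂ] E} (hs : SymmGraph A.graph) {K : E →L[ℂ] E} {M : ℝ}
    (hK : IsInverseOf K A M) (hc : IsCompactOperator K) (hinf : ¬ FiniteDimensional ℂ E)
    {m : ℝ} (hbelow : ∀ t : ℝ, ∀ x, (x, (t : ℂ) • x) ∈ A.graph → x ≠ 0 → m ≤ t)
    (hone : ∀ t : ℝ, ∀ x y, (x, (t : ℂ) • x) ∈ A.graph → (y, (t : ℂ) • y) ∈ A.graph → x ≠ 0 →
      ∃ c : ℂ, y = c • x) :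
    ∃ (ε : ℕ → ℝ) (b : HilbertBasis ℕ ℂ E), EigenSystem A ε b := by
  classical
  set S : Set ℝ := {t | ∃ x, x ≠ 0 ∧ (x, (t : ℂ) • x) ∈ A.graph} with hS
  have hunit : ∀ t : S, ∃ x : E, ‖x‖ = 1 ∧ (x, ((t : ℝ) : ℂ) • x) ∈ A.graph := by
    rintro ⟨t, x, hx0, hx⟩
    refine ⟨((‖x‖ : ℂ)⁻¹) • x, by simp [norm_smul, norm_ne_zero_iff.2 hx0], ?_⟩
    have := A.graph.smul_mem ((‖x‖ : ℂ)⁻¹) hx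
    rwa [Prod.smul_mk, smul_comm] at this
  choose e he1 he2 using hunit
  have heo : Orthonormal ℂ e := by
    refine ⟨he1, fun s t hst => ?_⟩
    have := hs _ (he2 s) _ (he2 t)
    simp only [inner_smul_right, inner_smul_left, Complex.conj_ofReal] at this
    have h2 : (((t : ℝ) : ℂ) - (s : ℝ)) * ⟪e s, e t⟫ = 0 := by linear_combination this
    rcases mul_eq_zero.1 h2 with h3 | h3
    · rw [sub_eq_zero] at h3
      exact absurd (Subtype.ext (by exact_mod_cast h3.symm)) hst
    · exact h3
  have hsm : ∀ t : S, (((t : ℝ) : ℂ) + M) • K (e t) = e t := fun t =>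
    (hK.eigen_iff _ _).1 (he2 t)
  have hne : ∀ t : S, (((t : ℝ) : ℂ) + M) ≠ 0 := fun t h0 => by
    have := hsm t
    rw [h0, zero_smul] at this
    exact heo.ne_zero t this.symm
  have hKe : ∀ t : S, K (e t) = (((t : ℝ) : ℂ) + M)⁻¹ • e t := fun t => by
    conv_rhs => rw [← hsm t]
    rw [smul_smul, inv_mul_cancel₀ (hne t), one_smul]
  have hfin : ∀ c, (S ∩ Iic c).Finite := by
    intro c
    -- An eigenvalue `t ∈ [m, c]` satisfies `|t + M| ≤ |m| + |c| + |M| + 1`, so the eigenvalue `(t +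
    -- M)⁻¹` of `K` is at least this large in modulus.
    have hδ : 0 < (|m| + |c| + |M| + 1)⁻¹ := by positivity
    refine ((finite_of_isCompactOperator hc heo hKe hδ).image Subtype.val).subset ?_
    rintro t ⟨ht, htc⟩
    refine ⟨⟨t, ht⟩, ?_, rfl⟩
    obtain ⟨x, hx0, hx⟩ := ht
    have hmt := hbelow t x hx hx0
    have hn : ‖(((t : ℝ) : ℂ) + M)‖ ≤ |m| + |c| + |M| + 1 := by
      rw [← Complex.ofReal_add, Complex.norm_real, Real.norm_eq_abs]
      have h1 : |t| ≤ |m| + |c| := by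
        rw [abs_le]; constructor
        · linarith [neg_abs_le m, abs_nonneg c]
        · linarith [le_abs_self c, abs_nonneg m, show t ≤ c from htc]
      linarith [abs_add_le t M]
    rw [Set.mem_ofPred_eq, norm_inv]
    exact inv_anti₀ (norm_pos_iff.2 (hne ⟨t, x, hx0, hx⟩)) hn
  have hsymm : (K : E →ₗ[ℂ] E).IsSymmetric := fun x y => hK.inner_comm hs x y
  have hbot : (Submodule.span ℂ (range e))ᗮ = ⊥ := by
    rw [Submodule.eq_bot_iff]
    intro x hx
    have hx' : ∀ t, ⟪e t, x⟫ = 0 := fun t =>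
      hx _ (Submodule.subset_span (mem_range_self t))
    have h0 := ContinuousLinearMap.orthogonalComplement_iSup_eigenspaces_eq_bot hc hsymm
    -- Every eigenvector of `K` has a nonzero real eigenvalue `r`, hence is an eigenvector of `A` at
    -- `r⁻¹ - M` and a multiple of a chosen one.
    rw [Submodule.eq_bot_iff] at h0
    refine h0 x ?_
    rw [← Submodule.iInf_orthogonal, Submodule.mem_iInf]
    intro μ
    rw [Submodule.mem_orthogonal]
    intro y hy
    have hy' : K y = μ • y := Module.End.mem_eigenspace_iff.1 hy
    by_cases hy0 : y = 0
    · simp [hy0]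
    have hμ0 : μ ≠ 0 := fun h => hy0 (hK.injective (by rw [hy', h, zero_smul]))
    have hμr : (starRingEnd ℂ) μ = μ := hsymm.conj_eigenvalue_eq_self
      (Module.End.hasEigenvalue_of_hasEigenvector ⟨hy, hy0⟩)
    obtain ⟨r, hr⟩ := Complex.conj_eq_iff_real.1 hμr
    have hr0 : (r : ℂ) ≠ 0 := hr ▸ hμ0
    have hmem : (y, ((r⁻¹ - M : ℝ) : ℂ) • y) ∈ A.graph := by
      rw [hK.eigen_iff, hy', smul_smul, hr]
      push_cast
      rw [sub_add_cancel, inv_mul_cancel₀ hr0, one_smul]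
    set t : S := ⟨r⁻¹ - M, y, hy0, hmem⟩
    obtain ⟨c, hc⟩ := hone _ _ y (he2 t) hmem (heo.ne_zero t)
    rw [hc, inner_smul_left, hx', mul_zero]
  have hSinf : S.Infinite := by
    intro hfS
    refine hinf ?_
    have : Finite (range e) := by
      have := hfS.to_subtype
      exact Finite.Set.finite_range e
    have hfd : FiniteDimensional ℂ (Submodule.span ℂ (range e)) :=
      FiniteDimensional.span_of_finite ℂ (Set.toFinite _)
    have htop : Submodule.span ℂ (range e) = ⊤ := by
      rw [← Submodule.orthogonal_orthogonal (Submodule.span ℂ (range e)), hbot,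
        Submodule.bot_orthogonal_eq_top]
    rw [htop] at hfd
    exact Module.Finite.equiv (Submodule.topEquiv)
  obtain ⟨o, ho, ho'⟩ := exists_strictMono_enumeration hSinf hfin
  have hrange : range (e ∘ o) = range e := o.surjective.range_comp e
  refine ⟨fun n => (o n : ℝ), HilbertBasis.mkOfOrthogonalEqBot (heo.comp o o.injective)
    (by rw [hrange, hbot]), ho, ho', fun n => ?_⟩
  simpa using he2 (o n)

theorem re_inner_le_of_eigenbasis {L : E →L[ℂ] E} (hL : ∀ x y, ⟪L x, y⟫ = ⟪x, L y⟫)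
    {c : HilbertBasis ℕ ℂ E} {ν : ℕ → ℝ} (hc : ∀ n, L (c n) = (ν n : ℂ) • c n) {x : E} {t : ℝ}
    (h : ∀ n, ⟪c n, x⟫ = 0 ∨ ν n ≤ t) : (⟪x, L x⟫).re ≤ t * ‖x‖ ^ 2 := by
  have h1 := Complex.hasSum_re (c.hasSum_inner_mul_inner x (L x))
  have h2 := (Complex.hasSum_re (c.hasSum_inner_mul_inner x x)).mul_left t
  have h3 : (⟪x, x⟫).re = ‖x‖ ^ 2 := by
    rw [inner_self_eq_norm_sq_to_K]; norm_cast
  rw [← h3]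
  refine hasSum_le (fun n => ?_) h1 h2
  have e1 : ⟪c n, L x⟫ = ν n * ⟪c n, x⟫ := by
    rw [← hL, hc, inner_smul_left, Complex.conj_ofReal]
  have e2 : ⟪x, c n⟫ * ⟪c n, x⟫ = ((‖⟪c n, x⟫‖ ^ 2 : ℝ) : ℂ) := by
    rw [← inner_conj_symm x (c n), Complex.conj_mul']; norm_cast
  rw [e1, mul_left_comm, e2, ← Complex.ofReal_mul, Complex.ofReal_re, Complex.ofReal_re]
  rcases h n with h0 | h0
  · simp [h0]
  · exact mul_le_mul_of_nonneg_right h0 (by positivity)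

/-- Weyl's inequality for eigenvalues listed in decreasing order. -/
theorem weyl_le {K L : E →L[ℂ] E} (hK : ∀ x y, ⟪K x, y⟫ = ⟪x, K y⟫)
    (hL : ∀ x y, ⟪L x, y⟫ = ⟪x, L y⟫) {b c : HilbertBasis ℕ ℂ E} {μ ν : ℕ → ℝ}
    (hμ : Antitone μ) (hν : Antitone ν) (hb : ∀ n, K (b n) = (μ n : ℂ) • b n)
    (hc : ∀ n, L (c n) = (ν n : ℂ) • c n) (n : ℕ) : μ n ≤ ν n + ‖K - L‖ := by
  -- There are `n` equations in `n + 1` unknowns, so some nonzero `x` in the span of `b 0, …, b n`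
  -- is orthogonal to `c 0, …, c (n - 1)`. The quadratic forms at `x` compare `μ n` with `ν n`.
  let T : (Fin (n + 1) → ℂ) →ₗ[ℂ] (Fin n → ℂ) :=
    LinearMap.pi fun j => ∑ i : Fin (n + 1), ⟪c j, b i⟫ • LinearMap.proj i
  have hT : LinearMap.ker T ≠ ⊥ := LinearMap.ker_ne_bot_of_finrank_lt (by simp)
  obtain ⟨a, ha, ha0⟩ := Submodule.exists_mem_ne_zero_of_ne_bot hT
  set x : E := ∑ i : Fin (n + 1), a i • b i with hx
  have hbx : ∀ m, ⟪b m, x⟫ = ∑ i : Fin (n + 1), if m = i then a i else 0 := fun m => by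
    rw [hx, inner_sum]
    refine Finset.sum_congr rfl fun i _ => ?_
    rw [inner_smul_right, orthonormal_iff_ite.1 b.orthonormal, mul_ite, mul_one, mul_zero]
  have hx0 : x ≠ 0 := by
    intro h0
    refine ha0 (funext fun i => ?_)
    have := hbx i
    rw [h0, inner_zero_right] at this
    simpa [Fin.val_inj] using this.symm
  have hcx : ∀ m, ⟪c m, x⟫ = 0 ∨ ν m ≤ ν n := fun m => by
    rcases lt_or_ge m n with hm | hm
    · left
      have := congrFun (LinearMap.mem_ker.1 ha) ⟨m, hm⟩
      simp only [T, LinearMap.pi_apply, LinearMap.coe_sum, Finset.sum_apply,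
        LinearMap.smul_apply, LinearMap.proj_apply, smul_eq_mul, Pi.zero_apply] at this
      rw [hx, inner_sum, ← this]
      exact Finset.sum_congr rfl fun i _ => by rw [inner_smul_right, mul_comm]
    · exact Or.inr (hν hm)
  have h1 := re_inner_le_of_eigenbasis hL hc hcx
  -- The upper bound for `-K` is the lower bound `μ n ‖x‖² ≤ ⟪x, K x⟫`.
  have h2 := re_inner_le_of_eigenbasis (L := -K) (x := x) (c := b) (ν := fun m => -μ m)
    (t := -μ n) (fun x y => by simp [hK]) (fun m => by simp [hb]) (fun m => by
      rcases le_or_gt m n with hm | hm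
      · exact Or.inr (neg_le_neg (hμ hm))
      · left
        rw [hbx]
        exact Finset.sum_eq_zero fun i _ => if_neg (by omega))
  have h3 : (⟪x, (K - L) x⟫).re ≤ ‖K - L‖ * ‖x‖ ^ 2 := by
    refine (Complex.re_le_norm _).trans ((norm_inner_le_norm _ _).trans ?_)
    have := (K - L).le_opNorm x
    nlinarith [norm_nonneg x]
  simp only [sub_apply, neg_apply, inner_sub_right, inner_neg_right,
    Complex.sub_re, Complex.neg_re] at h2 h3
  have hpos : 0 < ‖x‖ ^ 2 := by positivity
  nlinarith

theorem abs_eigenvalue_sub_le {K L : E →L[ℂ] E} (hK : ∀ x y, ⟪K x, y⟫ = ⟪x, K y⟫)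
    (hL : ∀ x y, ⟪L x, y⟫ = ⟪x, L y⟫) {b c : HilbertBasis ℕ ℂ E} {μ ν : ℕ → ℝ}
    (hμ : Antitone μ) (hν : Antitone ν) (hb : ∀ n, K (b n) = (μ n : ℂ) • b n)
    (hc : ∀ n, L (c n) = (ν n : ℂ) • c n) (n : ℕ) : |μ n - ν n| ≤ ‖K - L‖ := by
  rw [abs_sub_le_iff]
  have h1 := weyl_le hK hL hμ hν hb hc n
  have h2 := weyl_le hL hK hν hμ hc hb n
  rw [norm_sub_rev] at h2
  constructor <;> linarith

end SpectralTheory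

end

section

/-! ### Analytic continuation of simple eigenvalues -/

section AnalyticPerturbation

variable {E : Type*} [NormedAddCommGroup E] [InnerProductSpace ℂ E]

local notation "⟪" x ", " y "⟫" => inner ℂ x y

/-- The linearization `(χ, c) ↦ (K χ - μ χ - c φ, ⟪φ, χ⟫)` of the eigenvalue equation. -/
noncomputable def eigenLinearization (K : E →L[ℂ] E) (φ : E) (μ : ℂ) : E × ℂ →L[ℂ] E × ℂ :=
  ((K - μ • ContinuousLinearMap.id ℂ E).comp (ContinuousLinearMap.fst ℂ E ℂ) -
    (ContinuousLinearMap.snd ℂ E ℂ).smulRight φ).prod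
    ((innerSL ℂ φ).comp (ContinuousLinearMap.fst ℂ E ℂ))

theorem eigenLinearization_apply (K : E →L[ℂ] E) (φ : E) (μ : ℂ) (y : E × ℂ) :
    eigenLinearization K φ μ y = (K y.1 - μ • y.1 - y.2 • φ, ⟪φ, y.1⟫) := rfl

/-- Pairing the first component with `φ` determines `c`; what remains is `K - μ` on the complement
of `φ`, which is injective by simplicity. Surjectivity comes from the Riesz–Schauder alternative for
`K` plus the projection onto `φ`, for which `μ` is no longer an eigenvalue. -/
theorem bijective_eigenLinearization [CompleteSpace E] {K : E →L[ℂ] E} (hc : IsCompactOperator K)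
    (hs : ∀ x y, ⟪K x, y⟫ = ⟪x, K y⟫) {φ : E} (hφ : ‖φ‖ = 1) {μ : ℝ} (hμ : μ ≠ 0)
    (hKφ : K φ = (μ : ℂ) • φ) (hone : ∀ x, K x = (μ : ℂ) • x → ∃ c : ℂ, x = c • φ) :
    Function.Bijective (eigenLinearization K φ (μ : ℂ)) := by
  have hφφ : ⟪φ, φ⟫ = 1 := by rw [inner_self_eq_norm_sq_to_K, hφ]; simp
  have hφK : ∀ x, ⟪φ, K x⟫ = μ * ⟪φ, x⟫ := fun x => by
    rw [← hs, hKφ, inner_smul_left, Complex.conj_ofReal]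
  have hker : ∀ x, K x = (μ : ℂ) • x → ⟪φ, x⟫ = 0 → x = 0 := by
    intro x hx h0
    obtain ⟨c, rfl⟩ := hone x hx
    rw [inner_smul_right, hφφ, mul_one] at h0
    rw [h0, zero_smul]
  constructor
  · refine (injective_iff_map_eq_zero _).2 ?_
    rintro ⟨x, c⟩ h
    rw [eigenLinearization_apply, Prod.mk_eq_zero] at h
    obtain ⟨h1, h2⟩ := h
    simp only at h1 h2
    have h3 : c = 0 := by
      have := congrArg (fun y => ⟪φ, y⟫) h1
      simp only [inner_sub_right, inner_smul_right, hφK, hφφ, h2, inner_zero_right] at this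
      linear_combination -this
    rw [h3, zero_smul, sub_zero, sub_eq_zero] at h1
    rw [hker x h1 h2, h3]; rfl
  · set P : E →L[ℂ] E := (innerSL ℂ φ).smulRight φ with hP
    have hPx : ∀ x, P x = ⟪φ, x⟫ • φ := fun x => rfl
    have hPc : IsCompactOperator P :=
      (isCompactOperator_of_locallyCompactSpace_dom (innerSL ℂ φ)).clm_comp
        (ContinuousLinearMap.toSpanSingleton ℂ φ)
    have hTc : IsCompactOperator (K + P) := hc.add hPc
    have hμc : (μ : ℂ) ≠ 0 := by exact_mod_cast hμ
    have hres : (μ : ℂ) ∈ resolventSet ℂ (K + P) := by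
      refine (hTc.hasEigenvalue_or_mem_resolventSet hμc).resolve_left fun he => ?_
      obtain ⟨x, hx⟩ := he.exists_hasEigenvector
      have h1 : K x + ⟪φ, x⟫ • φ = (μ : ℂ) • x := hx.apply_eq_smul
      have h2 : ⟪φ, x⟫ = 0 := by
        have := congrArg (fun y => ⟪φ, y⟫) h1
        simp only [inner_add_right, inner_smul_right, hφK, hφφ] at this
        linear_combination this
      rw [h2, zero_smul, add_zero] at h1
      exact hx.2 (hker x h1 h2)
    obtain ⟨u, hu⟩ := hres
    have hsurj : ∀ g, ∃ x, K x + ⟪φ, x⟫ • φ - (μ : ℂ) • x = g := by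
      intro g
      refine ⟨-((u⁻¹ : (E →L[ℂ] E)ˣ) : E →L[ℂ] E) g, ?_⟩
      have := congrArg (fun T : E →L[ℂ] E => T g) u.mul_inv
      rw [hu, Algebra.algebraMap_eq_smul_one] at this
      simp only [mul_apply_eq_comp, sub_apply,
        smul_apply, one_apply_eq_self, add_apply,
        hPx] at this
      simp only [map_neg, inner_neg_right, smul_neg, neg_smul]
      refine Eq.trans ?_ this
      abel
    rintro ⟨g, a⟩
    obtain ⟨x, hx⟩ := hsurj (g - ⟪φ, g⟫ • φ)
    have h0 : ⟪φ, x⟫ = 0 := by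
      have := congrArg (fun y => ⟪φ, y⟫) hx
      simp only [inner_add_right, inner_sub_right, inner_smul_right, hφK, hφφ] at this
      linear_combination this
    refine ⟨(x + a • φ, -⟪φ, g⟫), ?_⟩
    rw [h0, zero_smul, add_zero] at hx
    rw [eigenLinearization_apply, Prod.mk.injEq]
    constructor
    · simp only [map_add, map_smul, hKφ, smul_add, neg_smul]
      rw [smul_comm a, ← sub_eq_iff_eq_add'.2 (sub_eq_iff_eq_add.1 hx.symm)]
      abel
    · simp only [inner_add_right, inner_smul_right, h0, hφφ, zero_add, mul_one]

/-- Analytic continuation of a simple eigenvalue and of its eigenvector. -/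
theorem exists_eigen_branch [CompleteSpace E] {K : ℂ → E →L[ℂ] E} {p₀ : ℂ} (hK : AnalyticAt ℂ K p₀)
    (hc : IsCompactOperator (K p₀))
    (hs : ∀ x y, ⟪K p₀ x, y⟫ = ⟪x, K p₀ y⟫) {φ : E} (hφ : ‖φ‖ = 1) {μ : ℝ} (hμ : μ ≠ 0)
    (hKφ : K p₀ φ = (μ : ℂ) • φ) (hone : ∀ x, K p₀ x = (μ : ℂ) • x → ∃ c : ℂ, x = c • φ) :
    ∃ (Φ : ℂ → E) (l : ℂ → ℂ), ContinuousAt Φ p₀ ∧ AnalyticAt ℂ l p₀ ∧ Φ p₀ = φ ∧ l p₀ = μ ∧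
      ∀ᶠ p in 𝓝 p₀, K p (Φ p) = l p • Φ p := by
  -- The normalization fixes `⟪φ, χ⟫` rather than the norm of `χ`: it is complex linear in `χ`, so
  -- the complex analytic implicit function theorem applies.
  set f : ℂ × (E × ℂ) → E × ℂ := fun q => (K q.1 q.2.1 - q.2.2 • q.2.1, innerSL ℂ φ q.2.1) with hf
  set u : ℂ × (E × ℂ) := (p₀, (φ, (μ : ℂ))) with hu
  have hKc : ContDiffAt ℂ ω (fun q : ℂ × (E × ℂ) => K q.1) u :=
    (hK.contDiffAt (n := ω)).comp u contDiffAt_fst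
  have hfc : ContDiffAt ℂ ω f u := by
    refine ContDiffAt.prodMk ?_ ?_
    · exact (hKc.clm_apply (by fun_prop)).sub (by fun_prop)
    · fun_prop
  have hω : (ω : ℕ∞ω) ≠ 0 := by simp
  have hfd : HasFDerivAt f (fderiv ℂ f u) u :=
    (hfc.differentiableAt hω).hasFDerivAt
  have hcomp : fderiv ℂ f u ∘L .inr ℂ ℂ (E × ℂ) = eigenLinearization (K p₀) φ (μ : ℂ) := by
    have h1 : HasFDerivAt (fun y : E × ℂ => f (p₀, y)) (fderiv ℂ f u ∘L .inr ℂ ℂ (E × ℂ)) (φ, (μ : ℂ)) := by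
      exact HasFDerivAt.comp (φ, (μ : ℂ)) hfd (hasFDerivAt_prodMk_right p₀ (φ, (μ : ℂ)))
    refine h1.unique ?_
    have h2 : HasFDerivAt (fun y : E × ℂ => y.2 • y.1)
        ((μ : ℂ) • ContinuousLinearMap.fst ℂ E ℂ + (ContinuousLinearMap.snd ℂ E ℂ).smulRight φ)
        (φ, (μ : ℂ)) :=
      HasFDerivAt.fun_smul (c := fun y : E × ℂ => y.2) (f := fun y : E × ℂ => y.1)
        (x := (φ, (μ : ℂ))) hasFDerivAt_snd hasFDerivAt_fst
    have h3 : HasFDerivAt (fun y : E × ℂ => K p₀ y.1) ((K p₀).comp (ContinuousLinearMap.fst ℂ E ℂ))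
        (φ, (μ : ℂ)) := ((K p₀).comp (ContinuousLinearMap.fst ℂ E ℂ)).hasFDerivAt
    have h4 : HasFDerivAt (fun y : E × ℂ => innerSL ℂ φ y.1)
        ((innerSL ℂ φ).comp (ContinuousLinearMap.fst ℂ E ℂ)) (φ, (μ : ℂ)) :=
      ((innerSL ℂ φ).comp (ContinuousLinearMap.fst ℂ E ℂ)).hasFDerivAt
    have h5 : eigenLinearization (K p₀) φ (μ : ℂ) =
        ((K p₀).comp (ContinuousLinearMap.fst ℂ E ℂ) - ((μ : ℂ) • ContinuousLinearMap.fst ℂ E ℂ +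
          (ContinuousLinearMap.snd ℂ E ℂ).smulRight φ)).prod
        ((innerSL ℂ φ).comp (ContinuousLinearMap.fst ℂ E ℂ)) := by
      ext y <;> simp [eigenLinearization_apply]
    rw [h5]
    exact (h3.sub h2).prodMk h4
  have hinv : (fderiv ℂ f u ∘L .inr ℂ ℂ (E × ℂ)).IsInvertible := by
    rw [hcomp]
    have hb := bijective_eigenLinearization hc hs hφ hμ hKφ hone
    exact ⟨ContinuousLinearEquiv.ofBijective _ (LinearMap.ker_eq_bot.2 hb.1)
      (LinearMap.range_eq_top.2 hb.2), by ext <;> rfl⟩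
  have hψ := hfc.contDiffAt_implicitFunction hω hinv
  have hψ0 := hfc.implicitFunction_apply_self hω hinv
  have hψe := hfc.eventually_apply_implicitFunction hω hinv
  set ψ := hfc.implicitFunction hω hinv
  refine ⟨fun p => (ψ p).1, fun p => (ψ p).2, hψ.continuousAt.fst, ?_, ?_, ?_, ?_⟩
  · exact hψ.snd.analyticAt
  · exact congrArg Prod.fst hψ0
  · exact congrArg Prod.snd hψ0
  · filter_upwards [hψe] with p hp
    have := congrArg Prod.fst hp
    simp only [hf, hu, hKφ, sub_self] at this
    exact sub_eq_zero.1 this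

/-- The projection onto a line does not depend on the phase of the spanning vector. This allows
eigenvectors picked without any continuity to be replaced by the continuous branch. -/
theorem rankOne_smul_self {u : E} {c : ℂ} (h : c ≠ 0) (hu : ‖u‖ = 1) :
    InnerProductSpace.rankOne ℂ u u =
      ((‖c • u‖ : ℂ) ^ 2)⁻¹ • InnerProductSpace.rankOne ℂ (c • u) (c • u) := by
  have hc : (‖c‖ : ℂ) ^ 2 ≠ 0 := by simpa using h
  ext x
  simp only [smul_apply, InnerProductSpace.rankOne_apply, inner_smul_left,
    smul_smul, norm_smul, hu, mul_one]
  congr 1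
  rw [mul_right_comm, Complex.conj_mul', inv_mul_cancel_left₀ hc]

/-- Analyticity of the simple eigenvalues of an operator family with analytic resolvent, and
continuity of the eigenprojections. -/
theorem EigenSystem.analyticAt [CompleteSpace E] {A : ℝ → E →ₗ.[ℂ] E} {ε : ℝ → ℕ → ℝ}
    {b : ℝ → HilbertBasis ℕ ℂ E} (hs : ∀ p, SymmGraph (A p).graph)
    (hE : ∀ p, EigenSystem (A p) (ε p) (b p)) {p₀ M : ℝ} {K : ℂ → E →L[ℂ] E}
    (hK : AnalyticAt ℂ K p₀) (hc : IsCompactOperator (K p₀))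
    (hinv : ∀ᶠ p : ℝ in 𝓝 p₀, IsInverseOf (K p) (A p) M)
    (hpos : ∀ᶠ p : ℝ in 𝓝 p₀, ∀ n, 0 < ε p n + M) (n : ℕ) :
    AnalyticAt ℝ (fun p => ε p n) p₀ ∧
      ContinuousAt (fun p => InnerProductSpace.rankOne ℂ (b p n) (b p n)) p₀ := by
  set μ : ℝ → ℕ → ℝ := fun p n => (ε p n + M)⁻¹ with hμ
  have hKc : ContinuousAt (fun p : ℝ => K p) p₀ :=
    ContinuousAt.comp (f := fun p : ℝ => (p : ℂ)) hK.continuousAt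
      Complex.continuous_ofReal.continuousAt
  have hKb : ∀ p : ℝ, IsInverseOf (K p) (A p) M → (∀ n, 0 < ε p n + M) → ∀ n,
      K p (b p n) = (μ p n : ℂ) • b p n := by
    intro p h hp n
    have h1 := (h.eigen_iff _ _).1 ((hE p).mem n)
    have h2 : ((ε p n : ℂ) + M) ≠ 0 := by
      have := (hp n).ne'
      exact_mod_cast this
    conv_rhs => rw [← h1]
    simp only [hμ]
    push_cast
    rw [smul_smul, inv_mul_cancel₀ h2, one_smul]
  have hanti : ∀ p : ℝ, (∀ n, 0 < ε p n + M) → Antitone (μ p) := by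
    intro p hp i j hij
    exact inv_anti₀ (hp i) (by simpa using (hE p).strictMono.monotone hij)
  have hinv0 := hinv.self_of_nhds
  have hpos0 := hpos.self_of_nhds
  -- Weyl's inequality bounds the variation of each `μ p m` by `‖K p - K p₀‖`, which gives
  -- continuity of the ordered eigenvalues before any analyticity.
  have hμcont : ∀ m, ContinuousAt (fun p => μ p m) p₀ := by
    intro m
    have h1 : Tendsto (fun p : ℝ => ‖K p - K p₀‖) (𝓝 p₀) (𝓝 0) := by
      have := (hKc.sub (continuousAt_const (y := K p₀))).norm
      simpa [ContinuousAt] using this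
    refine tendsto_iff_norm_sub_tendsto_zero.2 (squeeze_zero' ?_ ?_ h1)
    · exact Eventually.of_forall fun _ => norm_nonneg _
    · filter_upwards [hinv, hpos] with p h1 h2
      exact abs_eigenvalue_sub_le (h1.inner_comm (hs p)) (hinv0.inner_comm (hs p₀))
        (hanti p h2) (hanti p₀ hpos0) (hKb p h1 h2) (hKb p₀ hinv0 hpos0) m
  have hεcont : ∀ m, ContinuousAt (fun p => ε p m) p₀ := by
    intro m
    have : ContinuousAt (fun p => (μ p m)⁻¹ - M) p₀ :=
      ((hμcont m).inv₀ (inv_ne_zero (hpos0 m).ne')).sub continuousAt_const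
    simpa [hμ] using this
  have hμn : μ p₀ n ≠ 0 := inv_ne_zero (hpos0 n).ne'
  obtain ⟨Φ, l, hΦ, hl, hΦ0, hl0, hΦl⟩ := exists_eigen_branch hK hc
    (hinv0.inner_comm (hs p₀)) ((b p₀).orthonormal.1 n) hμn (hKb p₀ hinv0 hpos0 n) (by
      intro x hx
      refine ⟨_, (hE p₀).eq_smul (hs p₀) ((hinv0.eigen_iff _ _).2 ?_)⟩
      have h2 : ((ε p₀ n : ℂ) + M) ≠ 0 := by
        have := (hpos0 n).ne'
        exact_mod_cast this
      rw [hx]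
      simp only [hμ]
      push_cast
      rw [smul_smul, mul_inv_cancel₀ h2, one_smul])
  have hofReal : Tendsto (fun p : ℝ => (p : ℂ)) (𝓝 p₀) (𝓝 (p₀ : ℂ)) :=
    Complex.continuous_ofReal.continuousAt
  have hl0' : l p₀ ≠ 0 := by rw [hl0]; exact_mod_cast hμn
  have hlinv : AnalyticAt ℂ (fun p => (l p)⁻¹ - M) p₀ := (hl.inv hl0').sub analyticAt_const
  -- For real `p` near `p₀` the number `(l p)⁻¹ - M` is an eigenvalue of a symmetric operator, so
  -- taking the real part loses nothing.
  have hre : AnalyticAt ℝ (fun p : ℝ => ((l p)⁻¹ - M).re) p₀ :=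
    (Complex.reCLM.analyticAt _).comp
      ((hlinv.restrictScalars (𝕜 := ℝ)).comp (Complex.ofRealCLM.analyticAt p₀))
  have hre0 : ((l p₀)⁻¹ - M).re = ε p₀ n := by
    rw [hl0]
    simp only [hμ]
    push_cast
    rw [inv_inv, add_sub_cancel_right, Complex.ofReal_re]
  have hlow : ∀ᶠ p : ℝ in 𝓝 p₀, ∀ m < n, ε p m < ((l p)⁻¹ - M).re := by
    have : ∀ m ∈ Finset.range n, ∀ᶠ p : ℝ in 𝓝 p₀, ε p m < ((l p)⁻¹ - M).re := by
      intro m hm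
      refine (hεcont m).eventually_lt hre.continuousAt ?_
      rw [hre0]
      exact (hE p₀).strictMono (Finset.mem_range.1 hm)
    simpa using (Finset.eventually_all (Finset.range n)).2 this
  have hhigh : ∀ᶠ p : ℝ in 𝓝 p₀, ((l p)⁻¹ - M).re < ε p (n + 1) := by
    refine hre.continuousAt.eventually_lt (hεcont (n + 1)) ?_
    rw [hre0]
    exact (hE p₀).strictMono (Nat.lt_succ_self n)
  have hΦne : ∀ᶠ p : ℝ in 𝓝 p₀, Φ p ≠ 0 := by
    refine hofReal.eventually (hΦ.eventually_ne ?_)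
    rw [hΦ0]
    exact (b p₀).orthonormal.ne_zero n
  have hlne : ∀ᶠ p : ℝ in 𝓝 p₀, l p ≠ 0 := hofReal.eventually (hl.continuousAt.eventually_ne hl0')
  -- The continued eigenvalue lies strictly above all `ε p m` with `m < n` and strictly below `ε p
  -- (n + 1)`, so it can only be `ε p n`.
  have hmem : ∀ᶠ p : ℝ in 𝓝 p₀, Φ p ≠ 0 ∧ ε p n = ((l p)⁻¹ - M).re ∧
      (Φ p, (ε p n : ℂ) • Φ p) ∈ (A p).graph := by
    filter_upwards [hinv, hlow, hhigh, hΦne, hlne, hofReal.eventually hΦl] with p h1 h2 h3 h4 h5 h6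
    have h7 : (Φ p, ((l p)⁻¹ - M) • Φ p) ∈ (A p).graph := by
      rw [h1.eigen_iff, h6, smul_smul, sub_add_cancel, inv_mul_cancel₀ h5, one_smul]
    obtain ⟨m, hm⟩ := (hE p).eigenvalue_mem (hs p) h4 h7
    rw [hm] at h7 h3 h2
    simp only [Complex.ofReal_re] at h2 h3
    have hmn : m = n := by
      rcases lt_trichotomy m n with h | h | h
      · exact absurd (h2 m h) (lt_irrefl _)
      · exact h
      · exact absurd h3 (not_lt.2 ((hE p).strictMono.monotone h))
    subst hmn
    exact ⟨h4, by rw [hm, Complex.ofReal_re], h7⟩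
  constructor
  · exact hre.congr (hmem.mono fun p h => h.2.1.symm)
  · have h1 : ContinuousAt (fun p : ℝ => Φ p) p₀ :=
      ContinuousAt.comp (f := fun p : ℝ => (p : ℂ)) hΦ hofReal
    have h2 : ContinuousAt (fun p : ℝ => ((‖Φ p‖ : ℂ) ^ 2)⁻¹ •
        InnerProductSpace.rankOne ℂ (Φ p) (Φ p)) p₀ := by
      have hn : ContinuousAt (fun p : ℝ => (‖Φ p‖ : ℂ) ^ 2) p₀ :=
        (ContinuousAt.comp (f := fun p : ℝ => ‖Φ p‖) (g := fun r : ℝ => (r : ℂ))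
          Complex.continuous_ofReal.continuousAt h1.norm).pow 2
      have hne : ((‖Φ p₀‖ : ℂ) ^ 2) ≠ 0 := by
        have : Φ p₀ ≠ 0 := Filter.Eventually.self_of_nhds (p := fun p : ℝ => Φ p ≠ 0) hΦne
        simpa using this
      refine ContinuousAt.smul (hn.inv₀ hne) ?_
      · have hcont : Continuous fun u : E => InnerProductSpace.rankOne ℂ u u := by
          exact ((ContinuousLinearMap.smulRightL ℂ E E).continuous.comp
            (innerSL ℂ (E := E)).continuous).clm_apply continuous_id
        exact hcont.continuousAt.comp h1
    refine h2.congr ?_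
    filter_upwards [hmem] with p hp
    have h3 := (hE p).eq_smul (hs p) hp.2.2
    have h4 : inner ℂ (b p n) (Φ p) ≠ 0 := fun h0 => hp.1 (by rw [h3, h0, zero_smul])
    rw [rankOne_smul_self h4 ((b p).orthonormal.1 n), ← h3]

end AnalyticPerturbation

/-- The preimage of a null set under a nonconstant real analytic function is a null set. -/
theorem measure_preimage_eq_zero_of_analytic {f : ℝ → ℝ} (hf : ∀ x, AnalyticAt ℝ f x)
    (hne : ∃ x y, f x ≠ f y) {N : Set ℝ} (hN : volume N = 0) : volume (f ⁻¹' N) = 0 := by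
  have hd : ∀ x, AnalyticAt ℝ (deriv f) x := fun x => (hf x).deriv
  -- Zeros of `f'` are isolated: otherwise the identity theorem gives `f' = 0` everywhere and `f` is
  -- constant.
  have hloc : ∀ x, ∀ᶠ y in 𝓝[≠] x, deriv f y ≠ 0 := by
    intro x
    refine (hd x).eventually_eq_zero_or_eventually_ne_zero.resolve_left fun h0 => ?_
    have h1 := (show AnalyticOnNhd ℝ (deriv f) univ from fun y _ => hd y).eq_of_eventuallyEq
      (g := fun _ => 0) (fun y _ => analyticAt_const) h0
    obtain ⟨a, b, hab⟩ := hne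
    exact hab (is_const_of_deriv_eq_zero (fun y => (hf y).differentiableAt) (congrFun h1) a b)
  have hzero : volume {x | deriv f x = 0} = 0 := by
    refine measure_null_of_locally_null _ fun x _ =>
      ⟨{x | deriv f x = 0} ∩ {y | y ≠ x → deriv f y ≠ 0}, ?_, ?_⟩
    · exact inter_mem self_mem_nhdsWithin
        (mem_nhdsWithin_of_mem_nhds (eventually_nhdsWithin_iff.1 (hloc x)))
    · refine measure_mono_null (t := {x}) ?_ (by simp)
      intro y hy
      by_contra h
      exact hy.2 h hy.1
  have hreg : volume ({x | deriv f x ≠ 0} ∩ f ⁻¹' N) = 0 := by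
    refine measure_null_of_locally_null _ fun x hx => ?_
    have hsd : HasStrictDerivAt f (deriv f x) x := (hf x).hasStrictDerivAt
    have hoh := hsd.hasStrictFDerivAt_equiv hx.1
    have hopen : IsOpen {x | deriv f x ≠ 0} :=
      isOpen_ne_fun (continuous_iff_continuousAt.2 fun x => (hd x).continuousAt) continuous_const
    let e := hoh.toOpenPartialHomeomorph f
    have hxs : x ∈ e.source := hoh.mem_toOpenPartialHomeomorph_source
    -- `N` need not be measurable; its measurable hull is still null and makes the change of
    -- variables applicable.
    set N' := toMeasurable volume N
    have hN' : volume N' = 0 := by rw [measure_toMeasurable, hN]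
    have hcont : Continuous f := continuous_iff_continuousAt.2 fun y => (hf y).continuousAt
    set s := (e.source ∩ {x | deriv f x ≠ 0}) ∩ f ⁻¹' N' with hs
    have hsm : MeasurableSet s :=
      ((e.open_source.inter hopen).measurableSet).inter
        (hcont.measurable (measurableSet_toMeasurable _ _))
    refine ⟨s, ?_, ?_⟩
    · refine inter_mem (mem_nhdsWithin_of_mem_nhds
        ((e.open_source.inter hopen).mem_nhds ⟨hxs, hx.1⟩)) ?_
      exact mem_of_superset self_mem_nhdsWithin
        fun y hy => subset_toMeasurable volume N hy.2
    · have hinj : InjOn f s := e.injOn.mono fun y hy => hy.1.1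
      -- By injectivity on `s`, the integral of `|f'|` over `s` is the measure of `f '' s`, which is
      -- zero. As `f' ≠ 0` on `s`, this forces `s` to be null.
      have h1 := lintegral_image_eq_lintegral_abs_deriv_mul hsm
        (fun y _ => (hf y).differentiableAt.hasDerivAt.hasDerivWithinAt) hinj (fun _ => 1)
      have h2 : volume (f '' s) = 0 := measure_mono_null (by
        rintro _ ⟨y, hy, rfl⟩
        exact hy.2) hN'
      rw [setLIntegral_one, h2] at h1
      have h3 := (lintegral_eq_zero_iff' (by
        have : Measurable (deriv f) := measurable_deriv f
        fun_prop)).1 h1.symm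
      have h4 : ∀ᵐ y ∂(volume.restrict s), y ∈ s := ae_restrict_mem hsm
      have h5 : ∀ᵐ y ∂(volume.restrict s), False := by
        filter_upwards [h3, h4] with y hy hys
        simp only [mul_one, Pi.zero_apply, ENNReal.ofReal_eq_zero] at hy
        exact hys.1.2 (abs_nonpos_iff.1 hy)
      simpa [ae_iff] using h5
  refine measure_mono_null (t := {x | deriv f x = 0} ∪ ({x | deriv f x ≠ 0} ∩ f ⁻¹' N)) ?_
    (measure_union_null hzero hreg)
  intro y hy
  by_cases h : deriv f y = 0
  · exact Or.inl h
  · exact Or.inr ⟨h, hy⟩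

end

section

/-- The Hilbert space `L²(ℝ)`. -/
noncomputable abbrev L2R := Lp ℂ 2 (volume : Measure ℝ)

local notation "⟪" x ", " y "⟫" => inner ℂ x y

theorem inner_toLp {α : Type*} [MeasurableSpace α] {μ : Measure α} {f g : α → ℂ}
    (hf : MemLp f 2 μ) (hg : MemLp g 2 μ) :
    ⟪hf.toLp f, hg.toLp g⟫ = ∫ x, (starRingEnd ℂ) (f x) * g x ∂μ := by
  rw [L2.inner_def]
  refine integral_congr_ae ?_
  filter_upwards [hf.coeFn_toLp, hg.coeFn_toLp] with x h1 h2
  rw [h1, h2, RCLike.inner_apply, mul_comm]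

/-! ### Injectivity of the Fourier transform on integrable functions -/

section FourierInjective

/-- By duality: every test function is the Fourier transform of a Schwartz function, and the
transform can be moved from that function to `f`. -/
theorem ae_eq_zero_of_fourier_eq_zero {f : ℝ → ℂ} (hf : Integrable f)
    (h : ∀ ξ : ℝ, FourierTransform.fourier f ξ = 0) : f =ᵐ[volume] 0 := by
  refine ae_eq_zero_of_integral_contDiff_smul_eq_zero hf.locallyIntegrable fun g hg hgc => ?_
  have hg' : ContDiff ℝ ∞ (fun x => (g x : ℂ)) := Complex.ofRealCLM.contDiff.comp hg
  have hgc' : HasCompactSupport (fun x => (g x : ℂ)) := hgc.comp_left (g := fun r : ℝ => (r : ℂ)) rfl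
  let χ : SchwartzMap ℝ ℂ := hgc'.toSchwartzMap hg'
  let ψ : SchwartzMap ℝ ℂ := FourierTransformInv.fourierInv χ
  have h1 : ∀ x, FourierTransform.fourier (ψ : ℝ → ℂ) x = g x := fun x => by
    have h2 : FourierTransform.fourier ψ = χ := FourierTransform.fourier_fourierInv_eq χ
    have h3 := SchwartzMap.fourier_coe ψ
    rw [← h3, h2]
    rfl
  have h4 := VectorFourier.integral_fourierIntegral_smul_eq_flip (μ := volume) (ν := volume)
    (L := innerₗ ℝ) Real.continuous_fourierChar continuous_inner hf ψ.integrable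
  have h5 : ∫ x, FourierTransform.fourier f x • ψ x = ∫ x, f x • FourierTransform.fourier (ψ : ℝ → ℂ) x := by
    simpa [flip_innerₗ] using! h4
  simp only [h, zero_smul, integral_zero, h1] at h5
  rw [h5]
  refine integral_congr_ae (Eventually.of_forall fun x => ?_)
  simp [mul_comm]

end FourierInjective

/-! ### Polynomials times the Gaussian: algebra and density in `L²(ℝ)` -/

section PolyGaussian

open Polynomial

variable {B : ℝ}

theorem integrable_eval_mul_exp (P : ℂ[X]) {b : ℝ} (hb : 0 < b) :
    Integrable (fun x : ℝ => P.eval (x : ℂ) * (Real.exp (-b * x ^ 2) : ℂ)) := by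
  induction P using Polynomial.induction_on' with
  | add p q hp hq => simpa [add_mul] using! hp.add hq
  | monomial n a =>
    have h := (integrable_rpow_mul_exp_neg_mul_sq hb (s := n) (by
      have : (0 : ℝ) ≤ n := n.cast_nonneg
      linarith)).ofReal (𝕜 := ℂ)
    refine (h.const_mul a).congr (Eventually.of_forall fun x => ?_)
    simp [Real.rpow_natCast, mul_assoc]

/-- The function `P(x) exp(-B x² / 2)`. -/
noncomputable def polyGauss (B : ℝ) (P : ℂ[X]) (x : ℝ) : ℂ :=
  P.eval (x : ℂ) * (Real.exp (-(B / 2) * x ^ 2) : ℂ)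

/-- Differentiation, on the level of the polynomial prefactor. -/
noncomputable def polyD (B : ℝ) (P : ℂ[X]) : ℂ[X] := derivative P - C (B : ℂ) * X * P

theorem hasDerivAt_polyGauss (P : ℂ[X]) (x : ℝ) :
    HasDerivAt (polyGauss B P) (polyGauss B (polyD B P) x) x := by
  have h1 : HasDerivAt (fun y : ℝ => P.eval (y : ℂ)) (P.derivative.eval (x : ℂ)) x :=
    (P.hasDerivAt (x : ℂ)).comp_ofReal
  have h2 : HasDerivAt (fun y : ℝ => (Real.exp (-(B / 2) * y ^ 2) : ℂ))
      ((Real.exp (-(B / 2) * x ^ 2) * (-(B / 2) * (2 * x)) : ℝ) : ℂ) x := by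
    have h := (((hasDerivAt_pow 2 x).const_mul (-(B / 2))).exp).ofReal_comp
    simpa using h
  refine (h1.mul h2).congr_deriv ?_
  simp only [polyGauss, polyD, eval_sub, eval_mul, eval_C, eval_X]
  push_cast
  ring

theorem contDiff_polyGauss (P : ℂ[X]) {n : ℕ∞ω} : ContDiff ℝ n (polyGauss B P) := by
  have h1 : ContDiff ℝ n (fun x : ℝ => P.eval (x : ℂ)) := by
    have : (fun x : ℝ => P.eval (x : ℂ)) = fun x : ℝ => ∑ i ∈ P.support, P.coeff i * (x : ℂ) ^ i := by
      funext x; rw [eval_eq_sum]; rfl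
    rw [this]
    exact ContDiff.sum fun i _ => contDiff_const.mul (Complex.ofRealCLM.contDiff.pow i)
  have h2 : ContDiff ℝ n (fun x : ℝ => Real.exp (-(B / 2) * x ^ 2)) := by fun_prop
  exact h1.mul (Complex.ofRealCLM.contDiff.comp h2)

theorem polyGauss_mul (P Q : ℂ[X]) (x : ℝ) :
    polyGauss B P x * polyGauss B Q x = (P * Q).eval (x : ℂ) * (Real.exp (-B * x ^ 2) : ℂ) := by
  have : Real.exp (-B * x ^ 2) = Real.exp (-(B / 2) * x ^ 2) * Real.exp (-(B / 2) * x ^ 2) := by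
    rw [← Real.exp_add]; congr 1; ring
  rw [this]
  simp only [polyGauss, eval_mul]
  push_cast
  ring

theorem conj_polyGauss (P : ℂ[X]) (x : ℝ) :
    (starRingEnd ℂ) (polyGauss B P x) = polyGauss B (P.map (starRingEnd ℂ)) x := by
  simp only [polyGauss, map_mul, Complex.conj_ofReal]
  congr 1
  have := Polynomial.eval_map_apply (f := starRingEnd ℂ) (p := P) (x : ℂ)
  rw [Complex.conj_ofReal] at this
  exact this.symm

theorem integrable_polyGauss_mul (hB : 0 < B) (P Q : ℂ[X]) :
    Integrable (fun x => polyGauss B P x * polyGauss B Q x) := by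
  simp_rw [polyGauss_mul]
  exact integrable_eval_mul_exp _ hB

theorem memLp_polyGauss (hB : 0 < B) (P : ℂ[X]) : MemLp (polyGauss B P) 2 volume := by
  have hc : Continuous (polyGauss B P) := (contDiff_polyGauss (n := 0) P).continuous
  rw [memLp_two_iff_integrable_sq_norm hc.aestronglyMeasurable]
  refine (integrable_polyGauss_mul hB (P.map (starRingEnd ℂ)) P).norm.congr
    (Eventually.of_forall fun x => ?_)
  simp only
  rw [← conj_polyGauss, norm_mul, RCLike.norm_conj, sq]

theorem polyGauss_add (P Q : ℂ[X]) : polyGauss B (P + Q) = polyGauss B P + polyGauss B Q := by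
  funext x; simp [polyGauss, add_mul]

theorem polyGauss_smul (c : ℂ) (P : ℂ[X]) : polyGauss B (c • P) = c • polyGauss B P := by
  funext x; simp [polyGauss, mul_assoc]

theorem polyGauss_X_mul (P : ℂ[X]) (x : ℝ) : polyGauss B (X * P) x = x * polyGauss B P x := by
  simp [polyGauss, mul_assoc]

/-- `P ↦ P(x) exp(-B x² / 2)` as a map into `L²(ℝ)`. -/
noncomputable def polyToL2 (hB : 0 < B) : ℂ[X] →ₗ[ℂ] L2R where
  toFun P := (memLp_polyGauss hB P).toLp _
  map_add' P Q := by
    rw [← MemLp.toLp_add]; exact MemLp.toLp_congr _ _ (by rw [polyGauss_add])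
  map_smul' c P := by
    rw [RingHom.id_apply, ← MemLp.toLp_const_smul]
    exact MemLp.toLp_congr _ _ (by rw [polyGauss_smul])

theorem coeFn_polyToL2 (hB : 0 < B) (P : ℂ[X]) : polyToL2 hB P =ᵐ[volume] polyGauss B P :=
  (memLp_polyGauss hB P).coeFn_toLp

theorem inner_polyToL2 (hB : 0 < B) (P Q : ℂ[X]) :
    ⟪polyToL2 hB P, polyToL2 hB Q⟫ =
      ∫ x, polyGauss B (P.map (starRingEnd ℂ)) x * polyGauss B Q x := by
  refine (inner_toLp (memLp_polyGauss hB P) (memLp_polyGauss hB Q)).trans ?_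
  simp_rw [conj_polyGauss]

theorem map_polyD (P : ℂ[X]) :
    (polyD B P).map (starRingEnd ℂ) = polyD B (P.map (starRingEnd ℂ)) := by
  simp [polyD, derivative_map]

theorem inner_polyD (hB : 0 < B) (P Q : ℂ[X]) :
    ⟪polyToL2 hB P, polyToL2 hB (polyD B Q)⟫ = -⟪polyToL2 hB (polyD B P), polyToL2 hB Q⟫ := by
  rw [inner_polyToL2, inner_polyToL2, map_polyD]
  exact integral_mul_deriv_eq_deriv_mul_of_integrable (fun x _ => hasDerivAt_polyGauss _ x)
    (fun x _ => hasDerivAt_polyGauss _ x) (integrable_polyGauss_mul hB _ _)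
    (integrable_polyGauss_mul hB _ _) (integrable_polyGauss_mul hB _ _)

theorem inner_X_mul (hB : 0 < B) (P Q : ℂ[X]) :
    ⟪polyToL2 hB P, polyToL2 hB (X * Q)⟫ = ⟪polyToL2 hB (X * P), polyToL2 hB Q⟫ := by
  rw [inner_polyToL2, inner_polyToL2]
  congr 1
  funext x
  rw [Polynomial.map_mul, map_X, polyGauss_X_mul, polyGauss_X_mul]
  ring

theorem polyD_X_mul (P : ℂ[X]) : polyD B (X * P) = P + X * polyD B P := by
  simp only [polyD, derivative_mul, derivative_X]; ring

theorem polyD_add (P Q : ℂ[X]) : polyD B (P + Q) = polyD B P + polyD B Q := by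
  simp only [polyD, derivative_add]; ring

theorem polyD_smul (c : ℂ) (P : ℂ[X]) : polyD B (c • P) = c • polyD B P := by
  simp only [polyD, derivative_smul, smul_sub, mul_smul_comm]

theorem polyToL2_injective (hB : 0 < B) : Function.Injective (polyToL2 hB) := by
  rw [injective_iff_map_eq_zero]
  intro P h
  have h1 : polyGauss B P =ᵐ[volume] fun _ => 0 :=
    (coeFn_polyToL2 hB P).symm.trans (by rw [h]; exact Lp.coeFn_zero _ _ _)
  have h2 : polyGauss B P = fun _ => 0 :=
    ((contDiff_polyGauss (n := 0) P).continuous.ae_eq_iff_eq volume continuous_const).1 h1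
  refine Polynomial.eq_zero_of_infinite_isRoot P ?_
  refine (infinite_range_of_injective Complex.ofReal_injective).mono ?_
  rintro _ ⟨x, rfl⟩
  have h3 := congrFun h2 x
  simp only [polyGauss, mul_eq_zero] at h3
  exact h3.resolve_right (by exact_mod_cast (Real.exp_pos _).ne')

/-- `-∂² + B² x²` on the level of the polynomial prefactor. -/
noncomputable def polyH (B : ℝ) (P : ℂ[X]) : ℂ[X] :=
  -polyD B (polyD B P) + C ((B : ℂ) ^ 2) * (X * (X * P))

/-- Conjugation by the Gaussian cancels the quadratic potential and leaves Hermite's operator, which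
does not raise degrees. -/
theorem polyH_eq (P : ℂ[X]) :
    polyH B P = -derivative (derivative P) + C (2 * (B : ℂ)) * (X * derivative P) + C (B : ℂ) * P := by
  simp only [polyH, polyD, derivative_sub, derivative_mul, derivative_X, derivative_C, C_mul, C_pow,
    map_ofNat]
  ring

/-- The Hermite polynomials, through the raising operator `B x - ∂`. -/
noncomputable def hermP (B : ℝ) : ℕ → ℂ[X]
  | 0 => 1
  | n + 1 => C (2 * (B : ℂ)) * X * hermP B n - derivative (hermP B n)

/-- The raising operator `2 B X - d/dX` increases the eigenvalue by `2 B`: the inductive step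
combines `2 B X` times the eigenvalue equation with its derivative. -/
theorem polyH_hermP (n : ℕ) : polyH B (hermP B n) = C ((B : ℂ) * (2 * n + 1)) * hermP B n := by
  induction n with
  | zero => simp [polyH_eq, hermP]
  | succ n ih =>
    rw [polyH_eq] at ih ⊢
    have ih' := congrArg derivative ih
    simp only [derivative_add, derivative_neg, derivative_mul, derivative_C, derivative_X, zero_mul,
      zero_add, one_mul] at ih'
    simp only [hermP, derivative_sub, derivative_mul, derivative_C, derivative_X, zero_mul,
      zero_add, mul_one, derivative_add]
    push_cast at ih ih' ⊢
    simp only [C_mul, C_add, map_ofNat, C_1] at ih ih' ⊢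
    linear_combination (2 * C (B : ℂ) * X) * ih - ih'

theorem degree_hermP (hB : 0 < B) (n : ℕ) : (hermP B n).degree = n := by
  have hB' : (2 * (B : ℂ)) ≠ 0 := by simpa using hB.ne'
  induction n with
  | zero => simp [hermP]
  | succ n ih =>
    have h1 : (C (2 * (B : ℂ)) * X * hermP B n).degree = ((n + 1 : ℕ) : WithBot ℕ) := by
      rw [degree_mul, degree_mul, degree_C hB', degree_X, ih]
      push_cast; rw [zero_add, add_comm]
    rw [hermP, degree_sub_eq_left_of_degree_lt, h1]
    rw [h1]
    refine (degree_derivative_le).trans_lt ?_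
    rw [ih]
    exact_mod_cast Nat.lt_succ_self n

theorem span_hermP (hB : 0 < B) : Submodule.span ℂ (range (hermP B)) = ⊤ := by
  let S : Polynomial.Sequence ℂ := ⟨hermP B, degree_hermP hB⟩
  exact S.span fun n => isUnit_iff_ne_zero.2 (leadingCoeff_ne_zero.2 (by
    intro h
    have := degree_hermP hB n
    rw [show hermP B n = 0 from h] at this
    simp at this))

/-- Completing the square: half of the Gaussian exponent absorbs any exponential `e^{c|x|}`. -/
theorem exp_mul_abs_le {c x : ℝ} (hB : 0 < B) :
    Real.exp (c * |x|) * Real.exp (-(B / 2) * x ^ 2) ≤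
      Real.exp (c ^ 2 / B) * Real.exp (-(B / 4) * x ^ 2) := by
  rw [← Real.exp_add, ← Real.exp_add, Real.exp_le_exp]
  have h1 : 0 ≤ (c - B / 2 * |x|) ^ 2 / B := by positivity
  have h2 : (c - B / 2 * |x|) ^ 2 / B = c ^ 2 / B - c * |x| + B / 4 * |x| ^ 2 := by
    field_simp; ring
  rw [sq_abs] at h2
  linarith

/-- Orthogonality to all polynomials times the Gaussian means that every moment of `G = e^{-B x² /
2} f` vanishes. Since `G` is integrable against every exponential, its Fourier integral may be
expanded in powers and integrated termwise, so it vanishes and `G = 0`. -/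
theorem orthogonal_range_polyToL2 (hB : 0 < B) : (LinearMap.range (polyToL2 hB))ᗮ = ⊥ := by
  rw [Submodule.eq_bot_iff]
  intro f hf
  have hfL : MemLp f 2 volume := Lp.memLp f
  have hmom : ∀ n : ℕ, ∫ x : ℝ, (x : ℂ) ^ n * ((Real.exp (-(B / 2) * x ^ 2) : ℂ) * f x) = 0 := by
    intro n
    have h1 := hf _ (LinearMap.mem_range_self (polyToL2 hB) (X ^ n))
    rw [L2.inner_def] at h1
    rw [← h1]
    refine integral_congr_ae ?_
    filter_upwards [coeFn_polyToL2 hB (X ^ n)] with x hx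
    rw [hx, RCLike.inner_apply, conj_polyGauss]
    simp [polyGauss]
    ring
  set G : ℝ → ℂ := fun x => (Real.exp (-(B / 2) * x ^ 2) : ℂ) * f x with hG
  have hexp : ∀ c : ℝ, Integrable (fun x => Real.exp (c * |x|) * ‖G x‖) := by
    intro c
    have h4 : MemLp (fun x => Real.exp (c ^ 2 / B) * Real.exp (-(B / 4) * x ^ 2)) 2 (volume : Measure ℝ) := by
      refine MemLp.const_mul ?_ _
      rw [memLp_two_iff_integrable_sq (by fun_prop)]
      refine (integrable_exp_neg_mul_sq (half_pos hB)).congr (Eventually.of_forall fun x => ?_)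
      simp only
      rw [← Real.exp_nat_mul]; congr 1; push_cast; ring
    have h5 := h4.integrable_mul hfL.norm
    refine h5.mono' ?_ (Eventually.of_forall fun x => ?_)
    · have := hfL.1
      have h6 : AEStronglyMeasurable (fun x : ℝ => Real.exp (c * |x|)) volume := by
        fun_prop
      have h7 : AEStronglyMeasurable (fun x : ℝ => (Real.exp (-(B / 2) * x ^ 2) : ℂ)) volume := by
        fun_prop
      exact h6.mul (h7.mul this).norm
    · rw [Real.norm_of_nonneg (by positivity), hG, norm_mul, Complex.norm_real,
        Real.norm_of_nonneg (Real.exp_pos _).le, ← mul_assoc]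
      exact mul_le_mul_of_nonneg_right (exp_mul_abs_le hB) (norm_nonneg _)
  have hGm : AEStronglyMeasurable G volume := by
    have h7 : AEStronglyMeasurable (fun x : ℝ => (Real.exp (-(B / 2) * x ^ 2) : ℂ)) volume := by
      fun_prop
    exact h7.mul hfL.1
  have hGint : Integrable G := by
    have := hexp 0
    simp only [zero_mul, Real.exp_zero, one_mul] at this
    exact (integrable_norm_iff hGm).1 this
  have hG0 : G =ᵐ[volume] 0 := by
    refine ae_eq_zero_of_fourier_eq_zero hGint fun ξ => ?_
    rw [Real.fourier_eq']
    set a : ℂ := ((-2 * Real.pi * ξ : ℝ) : ℂ) * Complex.I with ha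
    -- The partial sums of `e^{a x} G` are dominated by `e^{‖a‖ |x|} |G|`, which is integrable by
    -- `hexp`.
    have hs : HasSum (fun n : ℕ => ∫ x : ℝ, (a * x) ^ n / (n.factorial : ℂ) * G x)
        (∫ x : ℝ, Complex.exp (a * x) * G x) := by
      refine hasSum_integral_of_dominated_convergence
        (fun n x => (‖a‖ * |x|) ^ n / (n.factorial : ℝ) * ‖G x‖) ?_ ?_ ?_ ?_ ?_
      · intro n
        have : AEStronglyMeasurable (fun x : ℝ => (a * x) ^ n / (n.factorial : ℂ)) volume := by
          fun_prop
        exact this.mul hGm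
      · intro n
        refine Eventually.of_forall fun x => ?_
        simp
      · refine Eventually.of_forall fun x => ?_
        exact (Real.summable_pow_div_factorial _).mul_right _
      · refine (hexp ‖a‖).congr (Eventually.of_forall fun x => ?_)
        simp only
        rw [tsum_mul_right, Real.exp_eq_exp_ℝ, NormedSpace.exp_eq_tsum_div]
      · refine Eventually.of_forall fun x => ?_
        refine HasSum.mul_right _ ?_
        rw [Complex.exp_eq_exp_ℂ]
        exact NormedSpace.expSeries_div_hasSum_exp _
    have h0 : ∀ n : ℕ, ∫ x : ℝ, (a * x) ^ n / (n.factorial : ℂ) * G x = 0 := by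
      intro n
      have : ∀ x : ℝ, (a * x) ^ n / (n.factorial : ℂ) * G x =
          (a ^ n / (n.factorial : ℂ)) * ((x : ℂ) ^ n * G x) := fun x => by ring
      simp_rw [this]
      rw [integral_const_mul, hmom, mul_zero]
    simp only [h0] at hs
    rw [← hs.unique hasSum_zero]
    refine integral_congr_ae (Eventually.of_forall fun x => ?_)
    simp only [smul_eq_mul, ha, RCLike.inner_apply, conj_trivial]
    congr 2
    push_cast
    ring
  refine (Lp.eq_zero_iff_ae_eq_zero).2 ?_
  filter_upwards [hG0] with x hx
  simp only [hG, Pi.zero_apply, mul_eq_zero] at hx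
  exact hx.resolve_left (by exact_mod_cast (Real.exp_pos _).ne')

end PolyGaussian

end

/-! ### The harmonic oscillator: Hermite basis and a priori bounds -/

section

local notation "⟪" x ", " y "⟫" => inner ℂ x y

open Polynomial

variable {B : ℝ}

theorem polyH_add (P Q : ℂ[X]) : polyH B (P + Q) = polyH B P + polyH B Q := by
  simp only [polyH, polyD_add]; ring

theorem polyH_smul (c : ℂ) (P : ℂ[X]) : polyH B (c • P) = c • polyH B P := by
  simp only [polyH, polyD_smul, mul_smul_comm, smul_add, smul_neg]

theorem polyToL2_C_mul (hB : 0 < B) (c : ℂ) (P : ℂ[X]) :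
    polyToL2 hB (C c * P) = c • polyToL2 hB P := by
  rw [← smul_eq_C_mul, map_smul]

theorem inner_polyH (hB : 0 < B) (P Q : ℂ[X]) :
    ⟪polyToL2 hB P, polyToL2 hB (polyH B Q)⟫ =
      ⟪polyToL2 hB (polyD B P), polyToL2 hB (polyD B Q)⟫ +
        B ^ 2 * ⟪polyToL2 hB (X * P), polyToL2 hB (X * Q)⟫ := by
  rw [polyH, map_add, map_neg, inner_add_right, inner_neg_right, inner_polyD, neg_neg,
    polyToL2_C_mul, inner_smul_right, inner_X_mul]

theorem inner_polyH_comm (hB : 0 < B) (P Q : ℂ[X]) :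
    ⟪polyToL2 hB P, polyToL2 hB (polyH B Q)⟫ = ⟪polyToL2 hB (polyH B P), polyToL2 hB Q⟫ := by
  rw [inner_polyH, ← inner_conj_symm (polyToL2 hB (polyH B P)), inner_polyH]
  simp [inner_conj_symm]

/-- The eigenvalues of the harmonic oscillator `-∂² + B² x²`. -/
noncomputable def landauLevel (B : ℝ) (n : ℕ) : ℝ := B * (2 * n + 1)

theorem landauLevel_pos (hB : 0 < B) (n : ℕ) : 0 < landauLevel B n := by
  unfold landauLevel; positivity

theorem landauLevel_strictMono (hB : 0 < B) : StrictMono (landauLevel B) := by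
  intro m n h
  unfold landauLevel
  have : (m : ℝ) < n := by exact_mod_cast h
  nlinarith

theorem polyToL2_polyH_hermP (hB : 0 < B) (n : ℕ) :
    polyToL2 hB (polyH B (hermP B n)) = (landauLevel B n : ℂ) • polyToL2 hB (hermP B n) := by
  rw [polyH_hermP, polyToL2_C_mul]
  congr 1
  unfold landauLevel
  push_cast; ring

theorem polyToL2_hermP_ne_zero (hB : 0 < B) (n : ℕ) : polyToL2 hB (hermP B n) ≠ 0 := by
  rw [Ne, map_eq_zero_iff _ (polyToL2_injective hB)]
  intro h
  have := degree_hermP hB n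
  simp [h] at this

theorem orthonormal_hermite (hB : 0 < B) : Orthonormal ℂ
    fun n => ((‖polyToL2 hB (hermP B n)‖ : ℂ)⁻¹) • polyToL2 hB (hermP B n) := by
  constructor
  · intro n
    simp [norm_smul, polyToL2_hermP_ne_zero hB n]
  · intro m n hmn
    simp only [inner_smul_left, inner_smul_right]
    have h1 := inner_polyH_comm hB (hermP B m) (hermP B n)
    rw [polyToL2_polyH_hermP, polyToL2_polyH_hermP, inner_smul_left, inner_smul_right,
      Complex.conj_ofReal] at h1
    have h2 : ((landauLevel B n : ℂ) - landauLevel B m) *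
        ⟪polyToL2 hB (hermP B m), polyToL2 hB (hermP B n)⟫ = 0 := by linear_combination h1
    rcases mul_eq_zero.1 h2 with h3 | h3
    · rw [sub_eq_zero] at h3
      exact absurd ((landauLevel_strictMono hB).injective (by exact_mod_cast h3)).symm hmn
    · rw [h3]; simp

theorem polyToL2_mem_span (hB : 0 < B) {S : Submodule ℂ L2R}
    (h : ∀ n, polyToL2 hB (hermP B n) ∈ S) (P : ℂ[X]) : polyToL2 hB P ∈ S := by
  have hP : P ∈ Submodule.span ℂ (range (hermP B)) := by rw [span_hermP hB]; trivial
  have h1 : Submodule.span ℂ (range (hermP B)) ≤ S.comap (polyToL2 hB) := by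
    rw [Submodule.span_le]; rintro _ ⟨n, rfl⟩; exact h n
  exact h1 hP

/-- The Hermite functions, as an orthonormal basis of `L²(ℝ)`. -/
noncomputable def hermBasis (hB : 0 < B) : HilbertBasis ℕ ℂ L2R :=
  HilbertBasis.mkOfOrthogonalEqBot (orthonormal_hermite hB) (by
    rw [Submodule.eq_bot_iff]
    intro f hf
    have h0 := orthogonal_range_polyToL2 hB
    rw [Submodule.eq_bot_iff] at h0
    refine h0 f ?_
    rintro _ ⟨P, rfl⟩
    refine hf _ (polyToL2_mem_span hB (fun n => ?_) P)
    have h1 := Submodule.smul_mem _ (‖polyToL2 hB (hermP B n)‖ : ℂ)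
      (Submodule.subset_span (R := ℂ) (mem_range_self
        (f := fun n => ((‖polyToL2 hB (hermP B n)‖ : ℂ)⁻¹) • polyToL2 hB (hermP B n)) n))
    have h2 : (‖polyToL2 hB (hermP B n)‖ : ℂ) ≠ 0 := by
      simpa using polyToL2_hermP_ne_zero hB n
    simpa only [smul_smul, mul_inv_cancel₀ h2, one_smul] using h1)

theorem hermBasis_apply (hB : 0 < B) (n : ℕ) :
    hermBasis hB n = ((‖polyToL2 hB (hermP B n)‖ : ℂ)⁻¹) • polyToL2 hB (hermP B n) := by
  simp [hermBasis]

theorem not_finiteDimensional_L2R : ¬ FiniteDimensional ℂ L2R := by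
  intro h
  have := (hermBasis one_pos).orthonormal.linearIndependent
  exact Set.infinite_univ (α := ℕ) (Set.finite_univ_iff.2 this.finite)

/-- `-∂² + B² x² + M` on polynomials times the Gaussian. -/
noncomputable def oscShift (hB : 0 < B) (M : ℝ) : ℂ[X] →ₗ[ℂ] L2R where
  toFun P := polyToL2 hB (polyH B P) + (M : ℂ) • polyToL2 hB P
  map_add' P Q := by rw [polyH_add]; simp only [map_add, smul_add]; abel
  map_smul' c P := by
    rw [polyH_smul]; simp only [map_smul, smul_add, RingHom.id_apply]; rw [smul_comm]

theorem oscShift_apply (hB : 0 < B) (M : ℝ) (P : ℂ[X]) :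
    oscShift hB M P = polyToL2 hB (polyH B P) + (M : ℂ) • polyToL2 hB P := rfl

theorem oscShift_hermP (hB : 0 < B) (M : ℝ) (n : ℕ) :
    oscShift hB M (hermP B n) = ((landauLevel B n + M : ℝ) : ℂ) • polyToL2 hB (hermP B n) := by
  rw [oscShift_apply, polyToL2_polyH_hermP, ← add_smul]; push_cast; rfl

/-- Each Hermite function is in the range because its level plus `M` is nonzero. A linear map on
polynomials that is bounded by `‖oscShift hB M P‖` therefore extends to a bounded operator, namely
the map composed with the oscillator resolvent. -/
theorem denseRange_oscShift (hB : 0 < B) {M : ℝ} (hM : 0 < M) : DenseRange (oscShift hB M) := by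
  have hd : Dense ((LinearMap.range (polyToL2 hB) : Submodule ℂ L2R) : Set L2R) := by
    rw [Submodule.dense_iff_topologicalClosure_eq_top, Submodule.topologicalClosure_eq_top_iff]
    exact orthogonal_range_polyToL2 hB
  refine hd.mono ?_
  rintro _ ⟨P, rfl⟩
  refine polyToL2_mem_span hB (S := LinearMap.range (oscShift hB M)) (fun n => ?_) P
  have h2 : ((landauLevel B n + M : ℝ) : ℂ) ≠ 0 := by
    exact_mod_cast (add_pos (landauLevel_pos hB n) hM).ne'
  refine ⟨((landauLevel B n + M : ℝ) : ℂ)⁻¹ • hermP B n, ?_⟩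
  rw [map_smul, oscShift_hermP, smul_smul, inv_mul_cancel₀ h2, one_smul]

theorem re_inner_self_eq (x : L2R) : (⟪x, x⟫).re = ‖x‖ ^ 2 := by
  rw [inner_self_eq_norm_sq_to_K]; norm_cast

/-- The quadratic form of the oscillator; it controls the derivative, the position and the norm at
once. -/
theorem energy_identity (hB : 0 < B) (M : ℝ) (P : ℂ[X]) :
    ‖polyToL2 hB (polyD B P)‖ ^ 2 + B ^ 2 * ‖polyToL2 hB (X * P)‖ ^ 2 + M * ‖polyToL2 hB P‖ ^ 2 =
      (⟪polyToL2 hB P, oscShift hB M P⟫).re := by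
  rw [oscShift_apply, inner_add_right, inner_smul_right, inner_polyH, Complex.add_re,
    Complex.add_re, re_inner_self_eq, Complex.re_ofReal_mul, re_inner_self_eq, ← Complex.ofReal_pow,
    Complex.re_ofReal_mul, re_inner_self_eq]

theorem energy_le (hB : 0 < B) (M : ℝ) (P : ℂ[X]) :
    ‖polyToL2 hB (polyD B P)‖ ^ 2 + B ^ 2 * ‖polyToL2 hB (X * P)‖ ^ 2 + M * ‖polyToL2 hB P‖ ^ 2 ≤
      ‖polyToL2 hB P‖ * ‖oscShift hB M P‖ := by
  rw [energy_identity]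
  exact (Complex.re_le_norm _).trans (norm_inner_le_norm _ _)

theorem norm_polyToL2_le' (hB : 0 < B) {M : ℝ} (hM : 0 < M) (P : ℂ[X]) :
    ‖polyToL2 hB P‖ ≤ M⁻¹ * ‖oscShift hB M P‖ := by
  have h := energy_le hB M P
  rw [inv_mul_eq_div, le_div_iff₀ hM]
  by_contra! h1
  have h2 : 0 < ‖polyToL2 hB P‖ := by
    by_contra! h3
    have : ‖polyToL2 hB P‖ = 0 := le_antisymm h3 (norm_nonneg _)
    rw [this, zero_mul] at h1
    exact absurd h1 (not_lt.2 (norm_nonneg _))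
  nlinarith [sq_nonneg ‖polyToL2 hB (polyD B P)‖, sq_nonneg (B * ‖polyToL2 hB (X * P)‖)]

/-- Weaker than `M⁻¹`, but this is the common rate at which the norm, the derivative and the
position are all controlled. -/
theorem norm_polyToL2_le (hB : 0 < B) {M : ℝ} (hM : 1 ≤ M) (P : ℂ[X]) :
    ‖polyToL2 hB P‖ ≤ (√M)⁻¹ * ‖oscShift hB M P‖ := by
  refine (norm_polyToL2_le' hB (by linarith) P).trans ?_
  gcongr
  exact Real.sqrt_le_iff.2 ⟨by linarith, by nlinarith⟩

theorem energy_le' (hB : 0 < B) {M : ℝ} (hM : 1 ≤ M) (P : ℂ[X]) :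
    ‖polyToL2 hB (polyD B P)‖ ^ 2 + (B * ‖polyToL2 hB (X * P)‖) ^ 2 ≤
      ((√M)⁻¹ * ‖oscShift hB M P‖) ^ 2 := by
  have h := energy_le hB M P
  have h1 := norm_polyToL2_le' hB (by linarith : 0 < M) P
  have h2 : ((√M)⁻¹ * ‖oscShift hB M P‖) ^ 2 = M⁻¹ * ‖oscShift hB M P‖ * ‖oscShift hB M P‖ := by
    rw [mul_pow, inv_pow, Real.sq_sqrt (by linarith)]; ring
  rw [h2]
  have h3 := mul_le_mul_of_nonneg_right h1 (norm_nonneg (oscShift hB M P))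
  have h4 : 0 ≤ M * ‖polyToL2 hB P‖ ^ 2 := by positivity
  rw [mul_pow]
  linarith

theorem norm_polyD_le (hB : 0 < B) {M : ℝ} (hM : 1 ≤ M) (P : ℂ[X]) :
    ‖polyToL2 hB (polyD B P)‖ ≤ (√M)⁻¹ * ‖oscShift hB M P‖ := by
  refine le_of_sq_le_sq ?_ (by positivity)
  nlinarith [energy_le' hB hM P, sq_nonneg (B * ‖polyToL2 hB (X * P)‖)]

theorem norm_X_mul_le (hB : 0 < B) {M : ℝ} (hM : 1 ≤ M) (P : ℂ[X]) :
    ‖polyToL2 hB (X * P)‖ ≤ B⁻¹ * (√M)⁻¹ * ‖oscShift hB M P‖ := by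
  have h : B * ‖polyToL2 hB (X * P)‖ ≤ (√M)⁻¹ * ‖oscShift hB M P‖ := by
    refine le_of_sq_le_sq ?_ (by positivity)
    nlinarith [energy_le' hB hM P, sq_nonneg ‖polyToL2 hB (polyD B P)‖]
  rw [mul_assoc, inv_mul_eq_div, le_div_iff₀ hB]
  linarith

/-- Separation property of the harmonic oscillator. -/
theorem norm_polyD_polyD_sq_le (hB : 0 < B) (P : ℂ[X]) :
    ‖polyToL2 hB (polyD B (polyD B P))‖ ^ 2 ≤
      ‖polyToL2 hB (polyH B P)‖ ^ 2 + 2 * B ^ 2 * ‖polyToL2 hB P‖ ^ 2 := by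
  set d := polyToL2 hB (polyD B (polyD B P)) with hd
  set y := polyToL2 hB (X * (X * P)) with hy
  have h1 : polyToL2 hB (polyH B P) = -d + ((B : ℂ) ^ 2) • y := by
    rw [polyH, map_add, map_neg, polyToL2_C_mul]
  have h2 : ⟪d, y⟫ = -⟪polyToL2 hB (X * polyD B P), polyToL2 hB (X * polyD B P)⟫ -
      2 * ⟪polyToL2 hB (polyD B P), polyToL2 hB (X * P)⟫ := by
    have e1 := inner_polyD hB (polyD B P) (X * (X * P))
    have e2 : polyD B (X * (X * P)) = X * (X * polyD B P) + (2 : ℂ) • (X * P) := by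
      rw [polyD_X_mul, polyD_X_mul, smul_eq_C_mul, map_ofNat]; ring
    rw [e2, map_add, map_smul, inner_add_right, inner_smul_right, inner_X_mul] at e1
    linear_combination e1
  have h3 : 2 * (⟪polyToL2 hB (polyD B P), polyToL2 hB (X * P)⟫).re = -‖polyToL2 hB P‖ ^ 2 := by
    have e1 := inner_polyD hB P (X * P)
    rw [polyD_X_mul, map_add, inner_add_right, inner_X_mul] at e1
    have e2 := congrArg Complex.re e1
    rw [Complex.add_re, Complex.neg_re, re_inner_self_eq,
      ← inner_conj_symm (polyToL2 hB (X * P)), Complex.conj_re] at e2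
    linarith
  have h4 : (⟪d, y⟫).re = -‖polyToL2 hB (X * polyD B P)‖ ^ 2 + ‖polyToL2 hB P‖ ^ 2 := by
    rw [h2, Complex.sub_re, Complex.neg_re, re_inner_self_eq]
    have : ((2 : ℂ) * ⟪polyToL2 hB (polyD B P), polyToL2 hB (X * P)⟫).re =
        2 * (⟪polyToL2 hB (polyD B P), polyToL2 hB (X * P)⟫).re := by simp
    rw [this, h3]; ring
  -- By `h4` the cross term equals `2 B² ‖x u'‖² - 2 B² ‖u‖²`; its positive part and `‖B² x² u‖²`
  -- are dropped.
  have h5 : ‖polyToL2 hB (polyH B P)‖ ^ 2 =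
      ‖d‖ ^ 2 - 2 * B ^ 2 * (⟪d, y⟫).re + ‖((B : ℂ) ^ 2) • y‖ ^ 2 := by
    rw [h1, norm_add_sq (𝕜 := ℂ), norm_neg, inner_neg_left, inner_smul_right, ← Complex.ofReal_pow]
    have : RCLike.re (-(((B ^ 2 : ℝ) : ℂ) * ⟪d, y⟫)) = -(B ^ 2 * (⟪d, y⟫).re) := by
      rw [map_neg]; exact congrArg Neg.neg (Complex.re_ofReal_mul _ _)
    rw [this]
    ring
  rw [h4] at h5
  nlinarith [sq_nonneg ‖((B : ℂ) ^ 2) • y‖, sq_nonneg ‖polyToL2 hB (X * polyD B P)‖, sq_nonneg B,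
    mul_nonneg (sq_nonneg B) (sq_nonneg ‖polyToL2 hB (X * polyD B P)‖)]

theorem integral_norm_mul_norm_le {α : Type*} [MeasurableSpace α] {μ : Measure α} {f g : α → ℂ}
    (hf : MemLp f 2 μ) (hg : MemLp g 2 μ) :
    ∫ x, ‖f x‖ * ‖g x‖ ∂μ ≤ ‖hf.toLp f‖ * ‖hg.toLp g‖ := by
  have h1 : ∫ x, ‖f x‖ * ‖g x‖ ∂μ = inner ℝ (hf.norm.toLp _) (hg.norm.toLp _) := by
    rw [L2.inner_def]
    refine integral_congr_ae ?_
    filter_upwards [hf.norm.coeFn_toLp, hg.norm.coeFn_toLp] with x h1 h2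
    rw [h1, h2]
    simp [mul_comm]
  have h2 := real_inner_le_norm (hf.norm.toLp _) (hg.norm.toLp _)
  rw [Lp.norm_toLp, Lp.norm_toLp, eLpNorm_norm, eLpNorm_norm] at h2
  rw [h1, Lp.norm_toLp, Lp.norm_toLp]
  exact h2

/-- An integrable function with integrable derivative vanishes at `-∞`; integrate from there. -/
theorem norm_le_integral_norm_deriv {F F' : ℝ → ℂ} (hF : ∀ x, HasDerivAt F (F' x) x)
    (hi : Integrable F) (hi' : Integrable F') (x : ℝ) : ‖F x‖ ≤ ∫ y, ‖F' y‖ := by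
  have h0 : Tendsto F atBot (𝓝 0) :=
    tendsto_zero_of_hasDerivAt_of_integrableOn_Iic (a := x) (fun y _ => hF y) hi'.integrableOn
      hi.integrableOn
  have h1 : ∫ y in Iic x, F' y = F x - 0 :=
    integral_Iic_of_hasDerivAt_of_tendsto' (fun y _ => hF y) hi'.integrableOn h0
  rw [sub_zero] at h1
  rw [← h1]
  refine (norm_integral_le_integral_norm _).trans ?_
  exact setIntegral_le_integral hi'.norm (Eventually.of_forall fun _ => norm_nonneg _)

/-- One-dimensional Sobolev inequality, from the derivative of `|u|²` and Cauchy–Schwarz. -/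
theorem polyGauss_norm_sq_le (hB : 0 < B) (P : ℂ[X]) (x : ℝ) :
    ‖polyGauss B P x‖ ^ 2 ≤ 2 * (‖polyToL2 hB P‖ * ‖polyToL2 hB (polyD B P)‖) := by
  set P' := P.map (starRingEnd ℂ)
  have h := norm_le_integral_norm_deriv
    (F := fun x => polyGauss B P' x * polyGauss B P x)
    (fun y => (hasDerivAt_polyGauss P' y).mul (hasDerivAt_polyGauss P y))
    (integrable_polyGauss_mul hB _ _)
    ((integrable_polyGauss_mul hB _ _).add (integrable_polyGauss_mul hB _ _)) x
  have e : ∀ (Q : ℂ[X]) x, ‖polyGauss B (Q.map (starRingEnd ℂ)) x‖ = ‖polyGauss B Q x‖ :=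
    fun Q x => by rw [← conj_polyGauss, RCLike.norm_conj]
  rw [norm_mul, e, ← sq] at h
  refine h.trans ?_
  have h1 := integral_norm_mul_norm_le (memLp_polyGauss hB P) (memLp_polyGauss hB (polyD B P))
  have h2 := (integrable_polyGauss_mul hB (polyD B P) P).norm
  have h3 := (integrable_polyGauss_mul hB P (polyD B P)).norm
  simp only [norm_mul] at h2 h3
  calc _ ≤ ∫ y, (‖polyGauss B P y‖ * ‖polyGauss B (polyD B P) y‖) * 2 := by
        refine integral_mono_of_nonneg (Eventually.of_forall fun _ => norm_nonneg _)
          (h3.mul_const 2) (Eventually.of_forall fun y => ?_)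
        refine (norm_add_le _ _).trans ?_
        rw [← map_polyD, norm_mul, norm_mul, e, e]
        linarith
    _ ≤ _ := by
        rw [integral_mul_const, mul_comm]
        exact mul_le_mul_of_nonneg_left h1 (by norm_num)

/-- The same argument for `x |u|²`. It yields decay of order `|x|^(-1/2)`, which makes a potential
supported far away a small perturbation. -/
theorem abs_mul_polyGauss_norm_sq_le (hB : 0 < B) (P : ℂ[X]) (x : ℝ) :
    |x| * ‖polyGauss B P x‖ ^ 2 ≤
      ‖polyToL2 hB P‖ ^ 2 + 2 * (‖polyToL2 hB (X * P)‖ * ‖polyToL2 hB (polyD B P)‖) := by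
  set P' := P.map (starRingEnd ℂ)
  have e : ∀ (Q : ℂ[X]) x, ‖polyGauss B (Q.map (starRingEnd ℂ)) x‖ = ‖polyGauss B Q x‖ :=
    fun Q x => by rw [← conj_polyGauss, RCLike.norm_conj]
  have h := norm_le_integral_norm_deriv
    (F := fun x => polyGauss B (X * P') x * polyGauss B P x)
    (fun y => (hasDerivAt_polyGauss (X * P') y).mul (hasDerivAt_polyGauss P y))
    (integrable_polyGauss_mul hB _ _)
    ((integrable_polyGauss_mul hB _ _).add (integrable_polyGauss_mul hB _ _)) x
  rw [norm_mul, polyGauss_X_mul, norm_mul, e, Complex.norm_real, Real.norm_eq_abs, mul_assoc,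
    ← sq] at h
  refine h.trans ?_
  have h0 := integral_norm_mul_norm_le (memLp_polyGauss hB P) (memLp_polyGauss hB P)
  have h1 := integral_norm_mul_norm_le (memLp_polyGauss hB (X * P)) (memLp_polyGauss hB (polyD B P))
  have i0 := (integrable_polyGauss_mul hB P P).norm
  have i1 := (integrable_polyGauss_mul hB (X * P) (polyD B P)).norm
  simp only [norm_mul] at i0 i1
  calc _ ≤ ∫ y, (‖polyGauss B P y‖ * ‖polyGauss B P y‖ +
          (‖polyGauss B (X * P) y‖ * ‖polyGauss B (polyD B P) y‖) * 2) := by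
        refine integral_mono_of_nonneg (Eventually.of_forall fun _ => norm_nonneg _)
          (i0.add (i1.mul_const 2)) (Eventually.of_forall fun y => ?_)
        refine (norm_add_le _ _).trans ?_
        rw [polyD_X_mul, polyGauss_add, Pi.add_apply, ← map_polyD, norm_mul, norm_mul,
          polyGauss_X_mul, polyGauss_X_mul, norm_mul (y : ℂ), e]
        simp only [polyGauss_X_mul, norm_mul (_ : ℂ) (polyGauss B P _)]
        have h5 := norm_add_le (polyGauss B P' y) (y * polyGauss B ((polyD B P).map (starRingEnd ℂ)) y)
        rw [norm_mul, e, e] at h5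
        have h6 := mul_le_mul_of_nonneg_right h5 (norm_nonneg (polyGauss B P y))
        simp only [Complex.norm_real] at h6 ⊢
        linarith
    _ ≤ _ := by
        rw [integral_add i0 (i1.mul_const 2), integral_mul_const]
        have e0 : ‖polyToL2 hB P‖ ^ 2 = ‖(memLp_polyGauss hB P).toLp _‖ * ‖(memLp_polyGauss hB P).toLp _‖ := sq _
        rw [e0]
        refine add_le_add h0 ?_
        rw [mul_comm]
        exact mul_le_mul_of_nonneg_left h1 (by norm_num)

theorem polyGauss_norm_le (hB : 0 < B) {M : ℝ} (hM : 1 ≤ M) (P : ℂ[X]) (x : ℝ) :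
    ‖polyGauss B P x‖ ≤ 2 * (√M)⁻¹ * ‖oscShift hB M P‖ := by
  refine le_of_sq_le_sq ?_ (by positivity)
  have h := polyGauss_norm_sq_le hB P x
  have h1 := norm_polyToL2_le hB hM P
  have h2 := norm_polyD_le hB hM P
  have h3 := mul_le_mul h1 h2 (norm_nonneg _) (by positivity)
  nlinarith [sq_nonneg ((√M)⁻¹ * ‖oscShift hB M P‖)]

end

/-! ### Relative bounds for the potential and operators relative to the oscillator -/

section

local notation "⟪" x ", " y "⟫" => inner ℂ x y

open Polynomial

/-- `v` is measurable and bounded by the sum of the square integrable function `|f|` and of the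
constant `c`. -/
structure SquareBounded (v f : ℝ → ℝ) (c : ℝ) : Prop where
  meas : AEStronglyMeasurable v volume
  memLp : MemLp f 2 volume
  bound : ∀ᵐ x, |v x| ≤ |f x| + c
  nonneg : 0 ≤ c

theorem eLpNorm_smul_add_le {f : ℝ → ℝ} (hf : MemLp f 2 volume) {φ : ℝ → ℂ}
    (hφ : MemLp φ 2 volume) {S c : ℝ} (hS : 0 ≤ S) (hc : 0 ≤ c) :
    MemLp (fun x => |f x| * S + c * ‖φ x‖) 2 volume ∧
    (eLpNorm (fun x => |f x| * S + c * ‖φ x‖) 2 volume).toReal ≤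
      (eLpNorm f 2 volume).toReal * S + c * (eLpNorm φ 2 volume).toReal := by
  have h1 : MemLp (fun x => |f x| * S) 2 volume := hf.abs.mul_const S
  have h2 : MemLp (fun x => c * ‖φ x‖) 2 volume := hφ.norm.const_mul c
  refine ⟨h1.add h2, ?_⟩
  have e1 : eLpNorm (fun x => |f x| * S) 2 volume = eLpNorm f 2 volume * ENNReal.ofReal S := by
    have h := eLpNorm_const_smul S (fun x => |f x|) 2 (volume : Measure ℝ)
    have h' : (S • fun x => |f x|) = fun x => |f x| * S := by
      funext x; simp [mul_comm]
    rw [h', show (fun x => |f x|) = fun x => ‖f x‖ from rfl, eLpNorm_norm] at h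
    rw [h, mul_comm, Real.enorm_eq_ofReal hS]
  have e2 : eLpNorm (fun x => c * ‖φ x‖) 2 volume = ENNReal.ofReal c * eLpNorm φ 2 volume := by
    have h := eLpNorm_const_smul c (fun x => ‖φ x‖) 2 (volume : Measure ℝ)
    rw [eLpNorm_norm, Real.enorm_eq_ofReal hc] at h
    exact h
  have h3 := eLpNorm_add_le h1.1 h2.1 (by norm_num : (1 : ENNReal) ≤ 2)
  rw [e1, e2] at h3
  have h4 := ENNReal.toReal_mono (by
    exact ENNReal.add_ne_top.2 ⟨ENNReal.mul_ne_top hf.2.ne ENNReal.ofReal_ne_top,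
      ENNReal.mul_ne_top ENNReal.ofReal_ne_top hφ.2.ne⟩) h3
  rw [ENNReal.toReal_add (ENNReal.mul_ne_top hf.2.ne ENNReal.ofReal_ne_top)
      (ENNReal.mul_ne_top ENNReal.ofReal_ne_top hφ.2.ne), ENNReal.toReal_mul, ENNReal.toReal_mul,
    ENNReal.toReal_ofReal hS, ENNReal.toReal_ofReal hc] at h4
  exact h4

namespace SquareBounded

variable {v f : ℝ → ℝ} {c : ℝ}

/-- The square integrable part of `v` is paired with the supremum of `φ`, the bounded part with `φ`
itself; this split underlies all estimates on the potential. -/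
theorem norm_mul_le (h : SquareBounded v f c) {φ : ℝ → ℂ} {S : ℝ} (hS : ∀ x, ‖φ x‖ ≤ S) :
    ∀ᵐ x, ‖(v x : ℂ) * φ x‖ ≤ |f x| * S + c * ‖φ x‖ := by
  filter_upwards [h.bound] with x hx
  rw [norm_mul, Complex.norm_real, Real.norm_eq_abs]
  have h1 := mul_le_mul_of_nonneg_right hx (norm_nonneg (φ x))
  have h2 := mul_le_mul_of_nonneg_left (hS x) (abs_nonneg (f x))
  linarith

theorem memLp_mul (h : SquareBounded v f c) {φ : ℝ → ℂ} (hφ : MemLp φ 2 volume) {S : ℝ}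
    (hS : ∀ x, ‖φ x‖ ≤ S) : MemLp (fun x => (v x : ℂ) * φ x) 2 volume := by
  have hS0 : 0 ≤ S := (norm_nonneg _).trans (hS 0)
  refine (eLpNorm_smul_add_le h.memLp hφ hS0 h.nonneg).1.mono' ?_ (h.norm_mul_le hS)
  exact (Complex.continuous_ofReal.comp_aestronglyMeasurable h.meas).mul hφ.1

theorem eLpNorm_mul_le (h : SquareBounded v f c) {φ : ℝ → ℂ} (hφ : MemLp φ 2 volume) {S : ℝ}
    (hS : ∀ x, ‖φ x‖ ≤ S) : (eLpNorm (fun x => (v x : ℂ) * φ x) 2 volume).toReal ≤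
      (eLpNorm f 2 volume).toReal * S + c * (eLpNorm φ 2 volume).toReal := by
  have hS0 : 0 ≤ S := (norm_nonneg _).trans (hS 0)
  have h0 := eLpNorm_smul_add_le h.memLp hφ hS0 h.nonneg
  refine le_trans (ENNReal.toReal_mono h0.1.2.ne ?_) h0.2
  exact eLpNorm_mono_ae_real (h.norm_mul_le hS)

end SquareBounded

variable {B : ℝ}

theorem exists_polyGauss_bound (hB : 0 < B) (P : ℂ[X]) : ∃ S, ∀ x, ‖polyGauss B P x‖ ≤ S :=
  ⟨_, fun x => polyGauss_norm_le hB le_rfl P x⟩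

section Potential

variable {v f : ℝ → ℝ} {c : ℝ}

theorem SquareBounded.memLp_polyGauss (h : SquareBounded v f c) (hB : 0 < B) (P : ℂ[X]) :
    MemLp (fun x => (v x : ℂ) * polyGauss B P x) 2 volume := by
  obtain ⟨S, hS⟩ := exists_polyGauss_bound hB P
  exact h.memLp_mul (TransInv.memLp_polyGauss hB P) hS

/-- Multiplication by the potential on polynomials times the Gaussian. -/
noncomputable def polyPot (hB : 0 < B) (h : SquareBounded v f c) : ℂ[X] →ₗ[ℂ] L2R where
  toFun P := (h.memLp_polyGauss hB P).toLp _
  map_add' P Q := by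
    rw [← MemLp.toLp_add]
    refine MemLp.toLp_congr _ _ (Eventually.of_forall fun x => ?_)
    simp [polyGauss_add, mul_add]
  map_smul' a P := by
    rw [RingHom.id_apply, ← MemLp.toLp_const_smul]
    refine MemLp.toLp_congr _ _ (Eventually.of_forall fun x => ?_)
    simp [polyGauss_smul, mul_left_comm]

theorem coeFn_polyPot (hB : 0 < B) (h : SquareBounded v f c) (P : ℂ[X]) :
    polyPot hB h P =ᵐ[volume] fun x => (v x : ℂ) * polyGauss B P x :=
  (h.memLp_polyGauss hB P).coeFn_toLp

/-- The potential is infinitesimally bounded with respect to the oscillator: the relative bound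
tends to zero as `M → ∞`. -/
theorem norm_polyPot_le (hB : 0 < B) (h : SquareBounded v f c) {M : ℝ} (hM : 1 ≤ M) (P : ℂ[X]) :
    ‖polyPot hB h P‖ ≤ (2 * (eLpNorm f 2 volume).toReal + c) * (√M)⁻¹ * ‖oscShift hB M P‖ := by
  have h1 := h.eLpNorm_mul_le (memLp_polyGauss hB P) (polyGauss_norm_le hB hM P)
  have e1 : ‖polyPot hB h P‖ = (eLpNorm (fun x => (v x : ℂ) * polyGauss B P x) 2 volume).toReal :=
    Lp.norm_toLp _ (h.memLp_polyGauss hB P)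
  have e2 : ‖polyToL2 hB P‖ = (eLpNorm (polyGauss B P) 2 volume).toReal :=
    Lp.norm_toLp _ (memLp_polyGauss hB P)
  rw [← e1, ← e2] at h1
  have h2 := mul_le_mul_of_nonneg_left (norm_polyToL2_le hB hM P) h.nonneg
  linarith

end Potential

section Operators

/-- `(-∂² + B² x² + M)⁻¹`. -/
noncomputable def oscInv (hB : 0 < B) (M : ℝ) : L2R →L[ℂ] L2R :=
  (polyToL2 hB).extendOfNorm (oscShift hB M)

/-- `x (-∂² + B² x² + M)⁻¹`. -/
noncomputable def posInv (hB : 0 < B) (M : ℝ) : L2R →L[ℂ] L2R :=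
  (polyToL2 hB ∘ₗ LinearMap.mulLeft ℂ X).extendOfNorm (oscShift hB M)

/-- `v(x) (-∂² + B² x² + M)⁻¹`. -/
noncomputable def potInv {v f : ℝ → ℝ} {c : ℝ} (hB : 0 < B) (h : SquareBounded v f c) (M : ℝ) :
    L2R →L[ℂ] L2R :=
  (polyPot hB h).extendOfNorm (oscShift hB M)

variable {M : ℝ}

theorem oscInv_oscShift (hB : 0 < B) (hM : 1 ≤ M) (P : ℂ[X]) :
    oscInv hB M (oscShift hB M P) = polyToL2 hB P :=
  LinearMap.extendOfNorm_eq (denseRange_oscShift hB (by linarith))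
    ⟨_, norm_polyToL2_le hB hM⟩ P

theorem posInv_oscShift (hB : 0 < B) (hM : 1 ≤ M) (P : ℂ[X]) :
    posInv hB M (oscShift hB M P) = polyToL2 hB (X * P) :=
  LinearMap.extendOfNorm_eq (denseRange_oscShift hB (by linarith))
    ⟨_, norm_X_mul_le hB hM⟩ P

theorem potInv_oscShift {v f : ℝ → ℝ} {c : ℝ} (hB : 0 < B) (h : SquareBounded v f c) (hM : 1 ≤ M)
    (P : ℂ[X]) : potInv hB h M (oscShift hB M P) = polyPot hB h P :=
  LinearMap.extendOfNorm_eq (denseRange_oscShift hB (by linarith))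
    ⟨_, norm_polyPot_le hB h hM⟩ P

theorem norm_oscInv_le (hB : 0 < B) (hM : 1 ≤ M) : ‖oscInv hB M‖ ≤ (√M)⁻¹ :=
  LinearMap.opNorm_extendOfNorm_le (denseRange_oscShift hB (by linarith)) (by positivity)
    (norm_polyToL2_le hB hM)

theorem norm_posInv_le (hB : 0 < B) (hM : 1 ≤ M) : ‖posInv hB M‖ ≤ B⁻¹ * (√M)⁻¹ :=
  LinearMap.opNorm_extendOfNorm_le (denseRange_oscShift hB (by linarith)) (by positivity)
    (norm_X_mul_le hB hM)

theorem norm_potInv_le {v f : ℝ → ℝ} {c : ℝ} (hB : 0 < B) (h : SquareBounded v f c) (hM : 1 ≤ M) :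
    ‖potInv hB h M‖ ≤ (2 * (eLpNorm f 2 volume).toReal + c) * (√M)⁻¹ :=
  LinearMap.opNorm_extendOfNorm_le (denseRange_oscShift hB (by linarith))
    (by have := h.nonneg; positivity) (norm_polyPot_le hB h hM)

theorem oscInv_hermBasis (hB : 0 < B) (hM : 1 ≤ M) (n : ℕ) :
    oscInv hB M (hermBasis hB n) = (((landauLevel B n + M)⁻¹ : ℝ) : ℂ) • hermBasis hB n := by
  have h2 : ((landauLevel B n + M : ℝ) : ℂ) ≠ 0 := by
    exact_mod_cast (add_pos (landauLevel_pos hB n) (by linarith)).ne'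
  have h1 : oscInv hB M (polyToL2 hB (hermP B n)) =
      ((landauLevel B n + M : ℝ) : ℂ)⁻¹ • polyToL2 hB (hermP B n) := by
    have h0 := oscInv_oscShift hB hM (hermP B n)
    rw [oscShift_hermP, map_smul] at h0
    conv_rhs => rw [← h0, smul_smul]
    rw [inv_mul_cancel₀ h2, one_smul]
  rw [hermBasis_apply, map_smul, h1, smul_comm, Complex.ofReal_inv]

theorem oscInv_inner_comm (hB : 0 < B) (hM : 1 ≤ M) (x y : L2R) :
    ⟪oscInv hB M x, y⟫ = ⟪x, oscInv hB M y⟫ := by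
  have hd := denseRange_oscShift hB (M := M) (by linarith)
  have hc : ∀ x, IsClosed {y | ⟪oscInv hB M x, y⟫ = ⟪x, oscInv hB M y⟫} := fun x =>
    isClosed_eq (by fun_prop) (by fun_prop)
  have hc' : ∀ y, IsClosed {x | ⟪oscInv hB M x, y⟫ = ⟪x, oscInv hB M y⟫} := fun y =>
    isClosed_eq (by fun_prop) (by fun_prop)
  refine hd.induction_on (p := fun x => ⟪oscInv hB M x, y⟫ = ⟪x, oscInv hB M y⟫) x (hc' y) fun P => ?_
  refine hd.induction_on (p := fun y => ⟪oscInv hB M (oscShift hB M P), y⟫ =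
    ⟪oscShift hB M P, oscInv hB M y⟫) y (hc _) fun Q => ?_
  rw [oscInv_oscShift hB hM, oscInv_oscShift hB hM, oscShift_apply, oscShift_apply,
    inner_add_right, inner_add_left, inner_smul_left, inner_smul_right, Complex.conj_ofReal,
    inner_polyH_comm]

theorem landauLevel_tendsto (hB : 0 < B) : Tendsto (landauLevel B) atTop atTop := by
  unfold landauLevel
  refine Tendsto.const_mul_atTop hB ?_
  exact tendsto_atTop_add_const_right _ _ (tendsto_natCast_atTop_atTop.const_mul_atTop two_pos)

end Operators

/-- A symmetric operator which is diagonal in a Hilbert basis with eigenvalues tending to zero is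
compact. -/
theorem isCompactOperator_of_diagonal {E : Type*} [NormedAddCommGroup E] [InnerProductSpace ℂ E]
    [CompleteSpace E] {K : E →L[ℂ] E} {b : HilbertBasis ℕ ℂ E} {μ : ℕ → ℝ}
    (hb : ∀ n, K (b n) = (μ n : ℂ) • b n) (hs : ∀ x y, ⟪K x, y⟫ = ⟪x, K y⟫)
    (hμ : Antitone μ) (h0 : Tendsto μ atTop (𝓝 0)) : IsCompactOperator K := by
  -- Finite rank truncations; by Parseval and monotonicity the remainder has norm at most `μ N`.
  set T : ℕ → E →L[ℂ] E := fun N =>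
    ∑ n ∈ Finset.range N, (μ n : ℂ) • InnerProductSpace.rankOne ℂ (b n) (b n) with hT
  have hμ0 : ∀ n, 0 ≤ μ n := fun n => hμ.le_of_tendsto h0 n
  have hTx : ∀ N x n, ⟪b n, (K - T N) x⟫ = if n < N then 0 else μ n * ⟪b n, x⟫ := by
    intro N x n
    have e1 : ⟪b n, K x⟫ = μ n * ⟪b n, x⟫ := by
      rw [← hs, hb, inner_smul_left, Complex.conj_ofReal]
    have e2 : ⟪b n, T N x⟫ = if n < N then μ n * ⟪b n, x⟫ else 0 := by
      simp only [hT, sum_apply, smul_apply, InnerProductSpace.rankOne_apply,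
        inner_sum, inner_smul_right, orthonormal_iff_ite.1 b.orthonormal]
      simp only [mul_ite, mul_one, mul_zero, Finset.sum_ite_eq, Finset.mem_range]
    rw [sub_apply, inner_sub_right, e1, e2]
    split_ifs <;> simp
  have hbound : ∀ N, ‖K - T N‖ ≤ μ N := by
    intro N
    refine ContinuousLinearMap.opNorm_le_bound _ (hμ0 N) fun x => ?_
    refine le_of_sq_le_sq ?_ (by have := hμ0 N; positivity)
    have h1 := Complex.hasSum_re (b.hasSum_inner_mul_inner ((K - T N) x) ((K - T N) x))
    have h2 := (Complex.hasSum_re (b.hasSum_inner_mul_inner x x)).mul_left ((μ N) ^ 2)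
    have e3 : ∀ x : E, (⟪x, x⟫).re = ‖x‖ ^ 2 := fun x => by
      rw [inner_self_eq_norm_sq_to_K]; norm_cast
    rw [e3] at h1 h2
    rw [mul_pow]
    refine hasSum_le (fun n => ?_) h1 h2
    have e2 : ∀ y : E, ⟪y, b n⟫ * ⟪b n, y⟫ = ((‖⟪b n, y⟫‖ ^ 2 : ℝ) : ℂ) := fun y => by
      rw [← inner_conj_symm y (b n), Complex.conj_mul']; norm_cast
    rw [e2, e2, Complex.ofReal_re, Complex.ofReal_re, hTx]
    split_ifs with h
    · rw [norm_zero, zero_pow two_ne_zero]; positivity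
    · rw [norm_mul, mul_pow, Complex.norm_real, Real.norm_eq_abs, sq_abs]
      have := hμ (not_lt.1 h)
      have := hμ0 n
      gcongr
  refine isCompactOperator_of_tendsto (l := atTop) (F := T) ?_ (Eventually.of_forall fun N => ?_)
  · rw [tendsto_iff_norm_sub_tendsto_zero]
    refine squeeze_zero (fun _ => norm_nonneg _) (fun N => ?_) h0
    rw [norm_sub_rev]
    exact hbound N
  · have : ∀ s : Finset ℕ, IsCompactOperator
        (∑ n ∈ s, (μ n : ℂ) • InnerProductSpace.rankOne ℂ (b n) (b n) : E →L[ℂ] E) := by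
      intro s
      induction s using Finset.induction_on with
      | empty => simpa using isCompactOperator_zero
      | insert a s ha ih =>
        rw [Finset.sum_insert ha]
        refine IsCompactOperator.add (IsCompactOperator.smul ?_ _) ih
        exact (isCompactOperator_of_locallyCompactSpace_dom (innerSL ℂ (b a))).clm_comp
          (ContinuousLinearMap.toSpanSingleton ℂ (b a))
    exact this _

theorem isCompactOperator_oscInv (hB : 0 < B) {M : ℝ} (hM : 1 ≤ M) :
    IsCompactOperator (oscInv hB M) := by
  refine isCompactOperator_of_diagonal (oscInv_hermBasis hB hM) (oscInv_inner_comm hB hM) ?_ ?_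
  · intro m n h
    exact inv_anti₀ (add_pos (landauLevel_pos hB m) (by linarith))
      (by simpa using (landauLevel_strictMono hB).monotone h)
  · exact (tendsto_atTop_add_const_right _ _ (landauLevel_tendsto hB)).inv_tendsto_atTop

end

section

local notation "⟪" x ", " y "⟫" => inner ℂ x y

/-! ### Cutoffs -/

/-- Dominated convergence in `L²` for uniformly bounded multipliers that converge pointwise to a
constant. -/
theorem tendsto_eLpNorm_mul_sub {α : Type*} [MeasurableSpace α] {μ : Measure α} {c : ℕ → α → ℂ}
    {c₀ : ℂ} {C : ℝ} (hm : ∀ k, AEStronglyMeasurable (c k) μ) (hC : ∀ k x, ‖c k x‖ ≤ C)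
    (ht : ∀ x, Tendsto (fun k => c k x) atTop (𝓝 c₀)) {G : α → ℂ} (hG : MemLp G 2 μ) :
    Tendsto (fun k => eLpNorm (fun x => c k x * G x - c₀ * G x) 2 μ) atTop (𝓝 0) := by
  have h2 : (2 : ENNReal).toReal = 2 := rfl
  simp_rw [eLpNorm_eq_lintegral_rpow_enorm_toReal (two_ne_zero : (2 : ENNReal) ≠ 0)
    ENNReal.ofNat_ne_top, h2]
  have key : Tendsto (fun k => ∫⁻ x, ‖c k x * G x - c₀ * G x‖ₑ ^ (2 : ℝ) ∂μ) atTop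
      (𝓝 (∫⁻ _, 0 ∂μ)) := by
    refine tendsto_lintegral_of_dominated_convergence'
      (fun x => ENNReal.ofReal (C + ‖c₀‖) ^ (2 : ℝ) * ‖G x‖ₑ ^ (2 : ℝ)) (fun k => ?_) (fun k => ?_) ?_ ?_
    · exact ((((hm k).mul hG.1).sub (hG.1.const_mul _)).enorm).pow_const _
    · refine Eventually.of_forall fun x => ?_
      simp only
      rw [← ENNReal.mul_rpow_of_nonneg _ _ (by norm_num : (0 : ℝ) ≤ 2)]
      refine ENNReal.rpow_le_rpow ?_ (by norm_num)
      rw [← sub_mul, enorm_mul]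
      gcongr
      rw [← ofReal_norm]
      refine ENNReal.ofReal_le_ofReal ((norm_sub_le _ _).trans ?_)
      linarith [hC k x]
    · rw [lintegral_const_mul'' _ (hG.1.enorm.pow_const _)]
      refine ENNReal.mul_ne_top (by simp) ?_
      have := lintegral_rpow_enorm_lt_top_of_eLpNorm_lt_top (two_ne_zero : (2 : ENNReal) ≠ 0)
        ENNReal.ofNat_ne_top hG.2
      exact this.ne
    · refine Eventually.of_forall fun x => ?_
      have h3 : Tendsto (fun k => c k x * G x - c₀ * G x) atTop (𝓝 0) := by
        simpa using ((ht x).mul_const (G x)).sub_const (c₀ * G x)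
      have h4 := ((continuous_enorm.tendsto _).comp h3).ennrpow_const 2
      simpa using h4
  rw [lintegral_zero] at key
  simpa using key.ennrpow_const (1 / 2)

theorem tendsto_eLpNorm_add {α : Type*} [MeasurableSpace α] {μ : Measure α} {f g : ℕ → α → ℂ}
    (hf : ∀ k, AEStronglyMeasurable (f k) μ) (hg : ∀ k, AEStronglyMeasurable (g k) μ)
    (h1 : Tendsto (fun k => eLpNorm (f k) 2 μ) atTop (𝓝 0))
    (h2 : Tendsto (fun k => eLpNorm (g k) 2 μ) atTop (𝓝 0)) :
    Tendsto (fun k => eLpNorm (fun x => f k x + g k x) 2 μ) atTop (𝓝 0) := by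
  refine tendsto_of_tendsto_of_tendsto_of_le_of_le tendsto_const_nhds
    (by simpa using h1.add h2) (fun _ => zero_le) fun k => ?_
  exact eLpNorm_add_le (hf k) (hg k) (by norm_num)

/-- Multiply by `η(x / (k + 1))`; each derivative that falls on the cutoff costs a factor `1 / (k +
1)`. One sequence serves all multipliers `q` with `q u ∈ L²`, so that it handles the potential and
the factor `x` simultaneously. -/
theorem exists_cutoff {u u' u'' : ℝ → ℂ} (hu : ContDiff ℝ ∞ u) (hd : ∀ x, HasDerivAt u (u' x) x)
    (hd' : ∀ x, HasDerivAt u' (u'' x) x) (h0 : MemLp u 2 volume) (h1 : MemLp u' 2 volume)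
    (h2 : MemLp u'' 2 volume) :
    ∃ φ : ℕ → ℝ → ℂ, (∀ k, ContDiff ℝ ∞ (φ k) ∧ HasCompactSupport (φ k)) ∧
      Tendsto (fun k => eLpNorm (fun x => deriv (φ k) x - u' x) 2 volume) atTop (𝓝 0) ∧
      Tendsto (fun k => eLpNorm (fun x => deriv (deriv (φ k)) x - u'' x) 2 volume) atTop (𝓝 0) ∧
      ∀ q : ℝ → ℂ, MemLp (fun x => q x * u x) 2 volume →
        Tendsto (fun k => eLpNorm (fun x => q x * φ k x - q x * u x) 2 volume) atTop (𝓝 0) := by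
  let χ : ContDiffBump (0 : ℝ) := ⟨1, 2, one_pos, one_lt_two⟩
  let η : ℝ → ℂ := fun x => (χ x : ℂ)
  have hη : ContDiff ℝ ∞ η := Complex.ofRealCLM.contDiff.comp χ.contDiff
  have hηc : HasCompactSupport η := χ.hasCompactSupport.comp_left (g := fun r : ℝ => (r : ℂ)) rfl
  have hη0 : η 0 = 1 := by
    have : χ 0 = 1 := χ.one_of_mem_closedBall (by simp [χ])
    simp [η, this]
  have hη1 : ContDiff ℝ ∞ (deriv η) := hη.deriv'
  have hη2 : ContDiff ℝ ∞ (deriv (deriv η)) := hη1.deriv'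
  obtain ⟨C0, hC0⟩ := hηc.exists_bound_of_continuous hη.continuous
  obtain ⟨C1, hC1⟩ := hηc.deriv.exists_bound_of_continuous hη1.continuous
  obtain ⟨C2, hC2⟩ := hηc.deriv.deriv.exists_bound_of_continuous hη2.continuous
  let r : ℕ → ℝ := fun k => 1 / ((k : ℝ) + 1)
  have hr : Tendsto r atTop (𝓝 0) := tendsto_one_div_add_atTop_nhds_zero_nat
  have hr0 : ∀ k, 0 < r k := fun k => by positivity
  have hr1 : ∀ k, r k ≤ 1 := fun k => by
    simp only [r]; rw [div_le_one (by positivity)]; linarith [(Nat.cast_nonneg k : (0 : ℝ) ≤ k)]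
  have hrn : ∀ k, ‖(r k : ℂ)‖ ≤ 1 := fun k => by
    rw [Complex.norm_real, Real.norm_of_nonneg (hr0 k).le]; exact hr1 k
  have hrC : Tendsto (fun k => (r k : ℂ)) atTop (𝓝 0) := by
    simpa using! (Complex.continuous_ofReal.tendsto 0).comp hr
  let φ : ℕ → ℝ → ℂ := fun k x => η (r k * x) * u x
  have hcs : ∀ k, Continuous fun x : ℝ => r k * x := fun k => by fun_prop
  have hsc : ∀ k x, HasDerivAt (fun x : ℝ => r k * x) (r k) x := fun k x => by
    simpa using (hasDerivAt_id x).const_mul (r k)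
  have hdη : ∀ (θ : ℝ → ℂ), Differentiable ℝ θ → ∀ k x,
      HasDerivAt (fun x => θ (r k * x)) ((r k : ℂ) * deriv θ (r k * x)) x := by
    intro θ hθ k x
    have := (hθ (r k * x)).hasDerivAt.scomp x (hsc k x)
    simpa using! this
  have e1 : ∀ k, deriv (φ k) = fun x => r k * deriv η (r k * x) * u x + η (r k * x) * u' x :=
    fun k => funext fun x => ((hdη η (hη.differentiable (by simp)) k x).mul (hd x)).deriv
  have e2 : ∀ k, deriv (deriv (φ k)) = fun x => (r k * (r k * deriv (deriv η) (r k * x))) * u x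
      + 2 * (r k * deriv η (r k * x)) * u' x + η (r k * x) * u'' x := by
    intro k
    funext x
    rw [e1]
    have h3 := (((hdη (deriv η) (hη1.differentiable (by simp)) k x).const_mul (r k : ℂ)).mul
      (hd x)).add ((hdη η (hη.differentiable (by simp)) k x).mul (hd' x))
    refine (h3.deriv).trans ?_
    ring
  have hlim : ∀ (θ : ℝ → ℂ), Continuous θ → ∀ x, Tendsto (fun k => θ (r k * x)) atTop (𝓝 (θ 0)) := by
    intro θ hθ x
    refine (hθ.tendsto 0).comp ?_
    simpa using hr.mul_const x
  have m0 : ∀ k, AEStronglyMeasurable (fun x => η (r k * x)) volume := fun k =>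
    (hη.continuous.comp (hcs k)).aestronglyMeasurable
  have m1 : ∀ k, AEStronglyMeasurable (fun x => r k * deriv η (r k * x)) volume := fun k =>
    (continuous_const.mul (hη1.continuous.comp (hcs k))).aestronglyMeasurable
  have m2 : ∀ k, AEStronglyMeasurable (fun x => r k * (r k * deriv (deriv η) (r k * x))) volume :=
    fun k => (continuous_const.mul (continuous_const.mul
      (hη2.continuous.comp (hcs k)))).aestronglyMeasurable
  have C1' : 0 ≤ C1 := (norm_nonneg _).trans (hC1 0)
  have C2' : 0 ≤ C2 := (norm_nonneg _).trans (hC2 0)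
  have b1 : ∀ k x, ‖(r k : ℂ) * deriv η (r k * x)‖ ≤ C1 := fun k x => by
    rw [norm_mul]
    exact (mul_le_of_le_one_left (norm_nonneg _) (hrn k)).trans (hC1 _)
  have b2 : ∀ k x, ‖(r k : ℂ) * ((r k : ℂ) * deriv (deriv η) (r k * x))‖ ≤ C2 := fun k x => by
    rw [norm_mul, norm_mul]
    refine (mul_le_of_le_one_left (by positivity) (hrn k)).trans ?_
    exact (mul_le_of_le_one_left (norm_nonneg _) (hrn k)).trans (hC2 _)
  have l0 : ∀ {G : ℝ → ℂ}, MemLp G 2 volume →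
      Tendsto (fun k => eLpNorm (fun x => η (r k * x) * G x - 1 * G x) 2 volume) atTop (𝓝 0) := by
    intro G hG
    exact tendsto_eLpNorm_mul_sub m0 (fun k x => hC0 _)
      (fun x => by simpa [hη0] using hlim η hη.continuous x) hG
  have l1 := tendsto_eLpNorm_mul_sub (c₀ := 0) m1 b1
    (fun x => by simpa using hrC.mul (hlim _ hη1.continuous x)) h0
  have l1' := tendsto_eLpNorm_mul_sub (c₀ := 0) (c := fun k x => 2 * (r k * deriv η (r k * x)))
    (C := 2 * C1) (fun k => (m1 k).const_mul 2)
    (fun k x => by rw [norm_mul]; simpa using b1 k x)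
    (fun x => by simpa using (hrC.mul (hlim _ hη1.continuous x)).const_mul 2) h1
  have l2 := tendsto_eLpNorm_mul_sub (c₀ := 0) m2 b2
    (fun x => by simpa using hrC.mul (hrC.mul (hlim _ hη2.continuous x))) h0
  simp only [zero_mul, sub_zero] at l1 l1' l2
  refine ⟨φ, fun k => ⟨(hη.comp (contDiff_const.mul contDiff_id)).mul hu, ?_⟩, ?_, ?_, ?_⟩
  · have h3 : HasCompactSupport fun x : ℝ => η (r k * x) :=
      hηc.comp_homeomorph (Homeomorph.mulLeft₀ (r k) (hr0 k).ne')
    exact h3.mul_right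
  · have h4 := tendsto_eLpNorm_add (fun k => (m1 k).mul h0.1)
      (fun k => ((m0 k).mul h1.1).sub (h1.1.const_mul 1)) l1 (l0 h1)
    refine h4.congr fun k => ?_
    congr 1
    funext x
    rw [e1]
    simp only [Pi.mul_apply, Pi.sub_apply]
    ring
  · have h4 := tendsto_eLpNorm_add (fun k => (m2 k).mul h0.1)
      (fun k => ((m1 k).const_mul 2).mul h1.1) l2 l1'
    have h5 := tendsto_eLpNorm_add
      (fun k => ((m2 k).mul h0.1).add (((m1 k).const_mul 2).mul h1.1))
      (fun k => ((m0 k).mul h2.1).sub (h2.1.const_mul 1)) h4 (l0 h2)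
    refine h5.congr fun k => ?_
    congr 1
    funext x
    rw [e2]
    simp only [Pi.add_apply, Pi.mul_apply, Pi.sub_apply]
    ring
  · intro q hq
    refine (l0 hq).congr fun k => ?_
    congr 1
    funext x
    simp only [φ]; ring

/-! ### The fiber operators -/

section Fiber

variable {B : ℝ} {v : ℝ → ℝ} {p : ℝ}

theorem integral_fderiv_eq_zero {E : Type*} [NormedAddCommGroup E] [NormedSpace ℝ E]
    [FiniteDimensional ℝ E] [MeasurableSpace E] [BorelSpace E] {μ : Measure E} [μ.IsAddHaarMeasure]
    {F : E → ℂ} (hF : ContDiff ℝ 1 F) (hc : HasCompactSupport F) (w : E) :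
    ∫ x, fderiv ℝ F x w ∂μ = 0 := by
  have h1 : Integrable (fun x => fderiv ℝ F x w) μ :=
    ((hF.continuous_fderiv one_ne_zero).clm_apply continuous_const).integrable_of_hasCompactSupport
      (hc.fderiv_apply ℝ w)
  have h := integral_mul_fderiv_eq_neg_fderiv_mul_of_integrable (μ := μ) (v := w)
    (f := fun _ : E => (1 : ℂ)) (g := F) (by simp) (by simpa using h1)
    (by simpa using hF.continuous.integrable_of_hasCompactSupport hc)
    (fun x _ => differentiableAt_const _) (fun x _ => hF.differentiable one_ne_zero x)
  simpa using h

theorem hasCompactSupport_star {α : Type*} [TopologicalSpace α] {φ : α → ℂ}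
    (h : HasCompactSupport φ) : HasCompactSupport fun x => (starRingEnd ℂ) (φ x) :=
  h.comp_left (g := starRingEnd ℂ) (map_zero _)

theorem contDiff_star {E : Type*} [NormedAddCommGroup E] [NormedSpace ℝ E] {n : ℕ∞ω} {φ : E → ℂ}
    (h : ContDiff ℝ n φ) : ContDiff ℝ n fun x => (starRingEnd ℂ) (φ x) :=
  Complex.conjCLE.contDiff.comp h

/-- Real potentials cancel pointwise, and the remainder is the derivative of the compactly supported
Wronskian of `φ̄` and `χ`. -/
theorem symmGraph_fiberCoreGraph (B : ℝ) (v : ℝ → ℝ) (p : ℝ) : SymmGraph (fiberCoreGraph B v p) := by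
  rintro ⟨a, b⟩ ⟨φ, hφ, hφc, ha, hb⟩ ⟨a', b'⟩ ⟨χ, hχ, hχc, ha', hb'⟩
  rw [← sub_eq_zero]
  simp only [L2.inner_def]
  rw [← integral_sub (L2.integrable_inner _ _) (L2.integrable_inner _ _)]
  have hφ1 : ContDiff ℝ ∞ (deriv φ) := hφ.deriv'
  have hχ1 : ContDiff ℝ ∞ (deriv χ) := hχ.deriv'
  let F : ℝ → ℂ := fun x => (starRingEnd ℂ) (deriv φ x) * χ x - (starRingEnd ℂ) (φ x) * deriv χ x
  have hF : ContDiff ℝ ∞ F :=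
    ((contDiff_star hφ1).mul hχ).sub ((contDiff_star hφ).mul hχ1)
  have hFc : HasCompactSupport F := (hχc.mul_left).sub (hχc.deriv.mul_left)
  have hstar : ∀ {θ : ℝ → ℂ} {θ' : ℂ} {x : ℝ}, HasDerivAt θ θ' x →
      HasDerivAt (fun x => (starRingEnd ℂ) (θ x)) ((starRingEnd ℂ) θ') x := by
    intro θ θ' x h
    exact Complex.conjCLE.toContinuousLinearMap.hasFDerivAt.comp_hasDerivAt x h
  have hFd : ∀ x, HasDerivAt F ((starRingEnd ℂ) (deriv (deriv φ) x) * χ x -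
      (starRingEnd ℂ) (φ x) * deriv (deriv χ) x) x := by
    intro x
    have d1 := (hφ.differentiable (by simp) x).hasDerivAt
    have d2 := (hφ1.differentiable (by simp) x).hasDerivAt
    have d3 := (hχ.differentiable (by simp) x).hasDerivAt
    have d4 := (hχ1.differentiable (by simp) x).hasDerivAt
    refine (((hstar d2).mul d3).sub ((hstar d1).mul d4)).congr_deriv ?_
    ring
  rw [← integral_fderiv_eq_zero (μ := volume) (hF.of_le (by simp)) hFc 1]
  refine integral_congr_ae ?_
  filter_upwards [ha, hb, ha', hb'] with x h1 h2 h3 h4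
  rw [h1, h2, h3, h4, fderiv_eq_smul_deriv, one_smul, (hFd x).deriv]
  simp only [fiberExpr, RCLike.inner_apply, map_add, map_neg, map_mul, Complex.conj_ofReal]
  ring

theorem tendsto_toLp {F : ℕ → ℝ → ℂ} {G : ℝ → ℂ} (hF : ∀ k, MemLp (F k) 2 volume)
    (hG : MemLp G 2 volume)
    (h : Tendsto (fun k => eLpNorm (fun x => F k x - G x) 2 volume) atTop (𝓝 0)) {x : L2R}
    (hx : x =ᵐ[volume] G) : Tendsto (fun k => (hF k).toLp (F k)) atTop (𝓝 x) := by
  have hx' : x = hG.toLp G := Lp.ext (hx.trans hG.coeFn_toLp.symm)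
  rw [hx', Lp.tendsto_Lp_iff_tendsto_eLpNorm'']
  exact h

/-- Approximation in the graph norm by smooth functions with compact support. -/
theorem exists_core_approx {u u' u'' : ℝ → ℂ} {m : ℝ → ℂ} (hu : ContDiff ℝ ∞ u)
    (hd : ∀ x, HasDerivAt u (u' x) x) (hd' : ∀ x, HasDerivAt u' (u'' x) x)
    (h0 : MemLp u 2 volume) (h1 : MemLp u' 2 volume) (h2 : MemLp u'' 2 volume)
    (hv : ∀ φ : ℝ → ℂ, ContDiff ℝ ∞ φ → HasCompactSupport φ →
      MemLp (fun x => (v x : ℂ) * φ x) 2 volume)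
    (hq : MemLp (fun x => ((((p + B * x) ^ 2 : ℝ) : ℂ) + v x) * u x) 2 volume)
    (hm : Continuous m) (hmu : MemLp (fun x => m x * u x) 2 volume) {x y w : L2R}
    (hx : x =ᵐ[volume] u)
    (hy : y =ᵐ[volume] fun x => -u'' x + ((((p + B * x) ^ 2 : ℝ) : ℂ) + v x) * u x)
    (hw : w =ᵐ[volume] fun x => m x * u x) :
    ∃ (φ : ℕ → ℝ → ℂ) (a a' a'' : ℕ → L2R),
      (∀ k, ContDiff ℝ ∞ (φ k) ∧ HasCompactSupport (φ k) ∧ a k =ᵐ[volume] φ k ∧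
        a' k =ᵐ[volume] fiberExpr B v p (φ k) ∧ a'' k =ᵐ[volume] fun x => m x * φ k x) ∧
      Tendsto a atTop (𝓝 x) ∧ Tendsto a' atTop (𝓝 y) ∧ Tendsto a'' atTop (𝓝 w) := by
  obtain ⟨φ, hφ, -, t2, tq⟩ := exists_cutoff hu hd hd' h0 h1 h2
  have mφ : ∀ k, MemLp (φ k) 2 volume := fun k =>
    (hφ k).1.continuous.memLp_of_hasCompactSupport (hφ k).2
  have mm : ∀ k, MemLp (fun x => m x * φ k x) 2 volume := fun k =>
    (hm.mul (hφ k).1.continuous).memLp_of_hasCompactSupport (hφ k).2.mul_left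
  have mφ2 : ∀ k, MemLp (deriv (deriv (φ k))) 2 volume := fun k =>
    (((hφ k).1.deriv' (n := ∞)).deriv' (n := ∞)).continuous.memLp_of_hasCompactSupport
      (hφ k).2.deriv.deriv
  have mq : ∀ k, MemLp (fun x => ((((p + B * x) ^ 2 : ℝ) : ℂ) + v x) * φ k x) 2 volume := by
    intro k
    simp_rw [add_mul]
    refine MemLp.add ?_ (hv _ (hφ k).1 (hφ k).2)
    refine Continuous.memLp_of_hasCompactSupport ?_ (hφ k).2.mul_left
    have := (hφ k).1.continuous
    fun_prop
  have eL : ∀ k, fiberExpr B v p (φ k) = fun x => -deriv (deriv (φ k)) x +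
      ((((p + B * x) ^ 2 : ℝ) : ℂ) + v x) * φ k x := by
    intro k; funext x; simp only [fiberExpr]; ring
  have mL : ∀ k, MemLp (fiberExpr B v p (φ k)) 2 volume := by
    intro k; rw [eL]; exact (mφ2 k).neg.add (mq k)
  refine ⟨φ, fun k => (mφ k).toLp _, fun k => (mL k).toLp _, fun k => (mm k).toLp _,
    fun k => ⟨(hφ k).1, (hφ k).2, (mφ k).coeFn_toLp, (mL k).coeFn_toLp, (mm k).coeFn_toLp⟩,
    tendsto_toLp mφ h0 (by simpa using tq (fun _ => 1) (by simpa using h0)) hx,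
    tendsto_toLp mL (h2.neg.add hq) ?_ hy, tendsto_toLp mm hmu (tq _ hmu) hw⟩
  have t3 : Tendsto (fun k => eLpNorm (fun x => -(deriv (deriv (φ k)) x - u'' x)) 2 volume) atTop
      (𝓝 0) := t2.congr fun k => (eLpNorm_neg _ _ _).symm
  refine (tendsto_eLpNorm_add (fun k => ((mφ2 k).sub h2).neg.1)
    (fun k => ((mq k).sub hq).1) t3 (tq _ hq)).congr fun k => ?_
  congr 1
  funext x
  rw [eL]
  simp only [Pi.sub_apply, Pi.neg_apply, Pi.add_apply]
  ring

theorem dense_fst_fiberCoreGraph (hv : ∀ φ : ℝ → ℂ, ContDiff ℝ ∞ φ → HasCompactSupport φ →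
      MemLp (fun x => (v x : ℂ) * φ x) 2 volume) :
    Dense (Prod.fst '' (fiberCoreGraph B v p : Set (L2R × L2R))) := by
  refine (Lp.dense_hasCompactSupport_contDiff (μ := (volume : Measure ℝ)) (F := ℂ)
    (p := 2) ENNReal.ofNat_ne_top).mono ?_
  intro a ha
  obtain ⟨φ, h1, h2, h3⟩ := ha
  have m1 : MemLp (fun x => -deriv (deriv φ) x + (((p + B * x) ^ 2 : ℝ) : ℂ) * φ x) 2 volume := by
    refine Continuous.memLp_of_hasCompactSupport ?_ (h2.deriv.deriv.neg.add h2.mul_left)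
    have := h3.continuous
    have := ((h3.deriv' (n := ∞)).deriv' (n := ∞)).continuous
    fun_prop
  have m2 : MemLp (fiberExpr B v p φ) 2 volume := m1.add (hv φ h3 h2)
  exact ⟨(a, m2.toLp _), ⟨φ, h3, h2, h1, m2.coeFn_toLp⟩, rfl⟩

end Fiber

end

section

local notation "⟪" x ", " y "⟫" => inner ℂ x y

open Polynomial

/-! ### Resolvents of the fiber operators -/

section Resolvent

variable {B : ℝ} {v f : ℝ → ℝ} {c : ℝ}

theorem SquareBounded.memLp_mul_of_hasCompactSupport (h : SquareBounded v f c) {φ : ℝ → ℂ}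
    (hφ : ContDiff ℝ ∞ φ) (hc : HasCompactSupport φ) :
    MemLp (fun x => (v x : ℂ) * φ x) 2 volume := by
  obtain ⟨S, hS⟩ := hc.exists_bound_of_continuous hφ.continuous
  exact h.memLp_mul (hφ.continuous.memLp_of_hasCompactSupport hc) hS

theorem SquareBounded.fiberOp_graph (h : SquareBounded v f c) (p : ℝ) :
    (fiberOp B v p).graph = (fiberCoreGraph B v p).topologicalClosure :=
  SymmGraph.closure_graph (symmGraph_fiberCoreGraph B v p) (fiberCoreGraph_fst_eq_zero B v p)
    (dense_fst_fiberCoreGraph fun _ => h.memLp_mul_of_hasCompactSupport)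

theorem SquareBounded.symmGraph_fiberOp (h : SquareBounded v f c) (p : ℝ) :
    SymmGraph (fiberOp B v p).graph := by
  rw [h.fiberOp_graph]
  exact (symmGraph_fiberCoreGraph B v p).closure

theorem SquareBounded.dense_domain_fiberOp (h : SquareBounded v f c) (p : ℝ) :
    Dense ((fiberOp B v p).domain : Set L2R) :=
  dense_domain_of_graph_eq (h.fiberOp_graph p)
    (dense_fst_fiberCoreGraph fun _ => h.memLp_mul_of_hasCompactSupport)

/-- The fiber operator on polynomials times the Gaussian. -/
noncomputable def fiberPoly (hB : 0 < B) (h : SquareBounded v f c) (p : ℂ) (P : ℂ[X]) : L2R :=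
  polyToL2 hB (polyH B P) + (polyPot hB h P + (2 * p * B) • polyToL2 hB (X * P) +
    p ^ 2 • polyToL2 hB P)

theorem coeFn_fiberPoly (hB : 0 < B) (h : SquareBounded v f c) (p : ℝ) (P : ℂ[X]) :
    fiberPoly hB h p P =ᵐ[volume] fun x => -polyGauss B (polyD B (polyD B P)) x +
      ((((p + B * x) ^ 2 : ℝ) : ℂ) + v x) * polyGauss B P x := by
  unfold fiberPoly
  filter_upwards [Lp.coeFn_add (polyToL2 hB (polyH B P)) (polyPot hB h P +
      (2 * (p : ℂ) * B) • polyToL2 hB (X * P) + (p : ℂ) ^ 2 • polyToL2 hB P),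
    Lp.coeFn_add (polyPot hB h P + (2 * (p : ℂ) * B) • polyToL2 hB (X * P))
      ((p : ℂ) ^ 2 • polyToL2 hB P),
    Lp.coeFn_add (polyPot hB h P) ((2 * (p : ℂ) * B) • polyToL2 hB (X * P)),
    Lp.coeFn_smul (2 * (p : ℂ) * B) (polyToL2 hB (X * P)),
    Lp.coeFn_smul ((p : ℂ) ^ 2) (polyToL2 hB P), coeFn_polyToL2 hB (polyH B P),
    coeFn_polyToL2 hB (X * P), coeFn_polyToL2 hB P, coeFn_polyPot hB h P]
    with x h1 h2 h3 h4 h5 h6 h7 h8 h9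
  rw [h1, Pi.add_apply, h2, Pi.add_apply, h3, Pi.add_apply, h4, Pi.smul_apply, h5, Pi.smul_apply,
    h6, h7, h8, h9]
  simp only [polyGauss, polyH, eval_add, eval_neg, eval_mul, eval_C, eval_X, smul_eq_mul]
  push_cast
  ring

theorem exists_core_approx_polyGauss (hB : 0 < B) (h : SquareBounded v f c) (p : ℝ) (P : ℂ[X]) :
    ∃ (φ : ℕ → ℝ → ℂ) (a a' a'' : ℕ → L2R),
      (∀ k, ContDiff ℝ ∞ (φ k) ∧ HasCompactSupport (φ k) ∧ a k =ᵐ[volume] φ k ∧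
        a' k =ᵐ[volume] fiberExpr B v p (φ k) ∧ a'' k =ᵐ[volume] fun x => (x : ℂ) * φ k x) ∧
      Tendsto a atTop (𝓝 (polyToL2 hB P)) ∧ Tendsto a' atTop (𝓝 (fiberPoly hB h p P)) ∧
      Tendsto a'' atTop (𝓝 (polyToL2 hB (X * P))) := by
  have hX : polyToL2 hB (X * P) =ᵐ[volume] fun x => (x : ℂ) * polyGauss B P x :=
    (coeFn_polyToL2 hB (X * P)).trans (Eventually.of_forall fun x => polyGauss_X_mul P x)
  refine exists_core_approx (contDiff_polyGauss P) (hasDerivAt_polyGauss P)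
    (hasDerivAt_polyGauss (polyD B P)) (memLp_polyGauss hB _) (memLp_polyGauss hB _)
    (memLp_polyGauss hB _) (fun _ => h.memLp_mul_of_hasCompactSupport) ?_
    Complex.continuous_ofReal ((memLp_congr_ae hX).1 (Lp.memLp _)) (coeFn_polyToL2 hB P)
    (coeFn_fiberPoly hB h p P) hX
  refine ((memLp_polyGauss hB (C ((p : ℂ) ^ 2) * P + C (2 * (p : ℂ) * B) * (X * P) +
    C ((B : ℂ) ^ 2) * (X * (X * P)))).add (h.memLp_polyGauss hB P)).ae_eq
    (Eventually.of_forall fun x => ?_)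
  simp only [polyGauss, Pi.add_apply, eval_add, eval_mul, eval_C, eval_X]
  push_cast
  ring

/-- These functions lack compact support and enter the closure only through cutoffs; the closed
operator acts on them by the differential expression. -/
theorem fiberPoly_mem (hB : 0 < B) (h : SquareBounded v f c) (p : ℝ) (P : ℂ[X]) :
    (polyToL2 hB P, fiberPoly hB h p P) ∈ (fiberOp B v p).graph := by
  obtain ⟨φ, a, a', a'', hφ, ta, ta', -⟩ := exists_core_approx_polyGauss hB h p P
  rw [h.fiberOp_graph, ← SetLike.mem_coe, Submodule.topologicalClosure_coe]
  exact mem_closure_of_tendsto (ta.prodMk_nhds ta') (Eventually.of_forall fun k =>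
    ⟨φ k, (hφ k).1, (hφ k).2.1, (hφ k).2.2.1, (hφ k).2.2.2.1⟩)

/-- `((p + B x)² + v - B² x²) (-∂² + B² x² + M)⁻¹`. -/
noncomputable def fiberPert (hB : 0 < B) (h : SquareBounded v f c) (M : ℝ) (p : ℂ) :
    L2R →L[ℂ] L2R :=
  potInv hB h M + (2 * p * B) • posInv hB M + p ^ 2 • oscInv hB M

/-- `(h_v(p) + M)⁻¹`, for large `M`. -/
noncomputable def fiberRes (hB : 0 < B) (h : SquareBounded v f c) (M : ℝ) (p : ℂ) :
    L2R →L[ℂ] L2R :=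
  oscInv hB M * Ring.inverse (1 + fiberPert hB h M p)

theorem norm_fiberPert_le (hB : 0 < B) (h : SquareBounded v f c) {M : ℝ} (hM : 1 ≤ M) (p : ℂ) :
    ‖fiberPert hB h M p‖ ≤
      (2 * (eLpNorm f 2 volume).toReal + c + 2 * ‖p‖ + ‖p‖ ^ 2) * (√M)⁻¹ := by
  have h1 := norm_potInv_le hB h hM
  have h2 : ‖(2 * p * B) • posInv hB M‖ ≤ 2 * ‖p‖ * (√M)⁻¹ := by
    rw [norm_smul, norm_mul, norm_mul, Complex.norm_two, Complex.norm_real,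
      Real.norm_of_nonneg hB.le]
    refine (mul_le_mul_of_nonneg_left (norm_posInv_le hB hM) (by positivity)).trans (le_of_eq ?_)
    field_simp
  have h3 : ‖p ^ 2 • oscInv hB M‖ ≤ ‖p‖ ^ 2 * (√M)⁻¹ := by
    rw [norm_smul, norm_pow]
    exact mul_le_mul_of_nonneg_left (norm_oscInv_le hB hM) (by positivity)
  refine (norm_add₃_le).trans ?_
  linarith

/-- A spectral shift for which the perturbation is small. -/
noncomputable def shiftBound (f : ℝ → ℝ) (c L : ℝ) : ℝ :=
  1 + (2 * (2 * (eLpNorm f 2 volume).toReal + c + 2 * L + L ^ 2)) ^ 2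

theorem one_le_shiftBound (f : ℝ → ℝ) (c L : ℝ) : 1 ≤ shiftBound f c L := by
  unfold shiftBound; nlinarith [sq_nonneg (2 * (2 * (eLpNorm f 2 volume).toReal + c + 2 * L + L ^ 2))]

theorem norm_fiberPert_le_half (hB : 0 < B) (h : SquareBounded v f c) {M L : ℝ}
    (hM : shiftBound f c L ≤ M) {p : ℂ} (hp : ‖p‖ ≤ L) : ‖fiberPert hB h M p‖ ≤ 1 / 2 := by
  have h1 : 1 ≤ M := (one_le_shiftBound f c L).trans hM
  refine (norm_fiberPert_le hB h h1 p).trans ?_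
  have hc := h.nonneg
  have hf : 0 ≤ (eLpNorm f 2 volume).toReal := ENNReal.toReal_nonneg
  have hL : 0 ≤ L := (norm_nonneg _).trans hp
  -- `shiftBound f c L - 1` is the square of this left side, which is twice the factor in
  -- `norm_fiberPert_le` at `‖p‖ = L`.
  have h2 : 2 * (2 * (eLpNorm f 2 volume).toReal + c + 2 * L + L ^ 2) ≤ √M := by
    refine Real.le_sqrt_of_sq_le ?_
    unfold shiftBound at hM
    linarith
  have h3 : 0 < √M := Real.sqrt_pos.2 (by linarith)
  have h4 : ‖p‖ ^ 2 ≤ L ^ 2 := by gcongr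
  rw [← div_eq_mul_inv, div_le_iff₀ h3]
  linarith

theorem isUnit_one_add_fiberPert (hB : 0 < B) (h : SquareBounded v f c) {M L : ℝ}
    (hM : shiftBound f c L ≤ M) {p : ℂ} (hp : ‖p‖ ≤ L) : IsUnit (1 + fiberPert hB h M p) := by
  have h1 := norm_fiberPert_le_half hB h hM hp
  have h2 := isUnit_one_sub_of_norm_lt_one (x := -fiberPert hB h M p) (by rw [norm_neg]; linarith)
  rwa [sub_neg_eq_add] at h2

theorem fiberPert_oscShift (hB : 0 < B) (h : SquareBounded v f c) {M : ℝ} (hM : 1 ≤ M) (p : ℂ)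
    (P : ℂ[X]) : oscShift hB M P + fiberPert hB h M p (oscShift hB M P) =
      fiberPoly hB h p P + (M : ℂ) • polyToL2 hB P := by
  simp only [fiberPert, add_apply, smul_apply, oscInv_oscShift hB hM, posInv_oscShift hB hM,
    potInv_oscShift hB h hM, fiberPoly]
  rw [oscShift_apply]
  abel

/-- On the dense range of `oscShift` this is `fiberPoly_mem`; the graph is closed, so it extends. It
says that `(h_v(p) + M) (H + M)⁻¹ = 1 + fiberPert` for the oscillator `H`. -/
theorem oscInv_mem_graph (hB : 0 < B) (h : SquareBounded v f c) {M : ℝ} (hM : 1 ≤ M) (p : ℝ)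
    (g : L2R) :
    (oscInv hB M g, g + fiberPert hB h M p g - (M : ℂ) • oscInv hB M g) ∈ (fiberOp B v p).graph := by
  have hcl : IsClosed ((fiberOp B v p).graph : Set (L2R × L2R)) := by
    rw [h.fiberOp_graph]; exact Submodule.isClosed_topologicalClosure _
  have hc : IsClosed {g : L2R | (oscInv hB M g, g + fiberPert hB h M p g - (M : ℂ) • oscInv hB M g) ∈
      ((fiberOp B v p).graph : Set (L2R × L2R))} := hcl.preimage (by fun_prop)
  refine (denseRange_oscShift hB (M := M) (by linarith)).induction_on
    (p := fun g => (oscInv hB M g, g + fiberPert hB h M p g - (M : ℂ) • oscInv hB M g) ∈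
      ((fiberOp B v p).graph : Set (L2R × L2R))) g hc fun P => ?_
  rw [fiberPert_oscShift hB h hM, oscInv_oscShift hB hM, add_sub_cancel_right]
  exact fiberPoly_mem hB h p P

/-- Neumann series: `1 + fiberPert` is invertible, and composing its inverse with the oscillator
resolvent gives a right inverse of `h_v(p) + M`. Symmetry makes it two-sided. -/
theorem isInverseOf_fiberRes (hB : 0 < B) (h : SquareBounded v f c) {M L : ℝ}
    (hM : shiftBound f c L ≤ M) {p : ℝ} (hp : |p| ≤ L) :
    IsInverseOf (fiberRes hB h M p) (fiberOp B v p) M := by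
  have hu := isUnit_one_add_fiberPert hB h hM (p := p) (by simpa using hp)
  have h1 : 1 ≤ M := (one_le_shiftBound f c L).trans hM
  refine isInverseOf_of_mem (h.symmGraph_fiberOp p) fun g => ?_
  have h2 := oscInv_mem_graph hB h h1 p (Ring.inverse (1 + fiberPert hB h M p) g)
  have h3 := congrArg (fun T : L2R →L[ℂ] L2R => T g) (Ring.mul_inverse_cancel _ hu)
  simp only [mul_apply_eq_comp, add_apply, one_apply_eq_self] at h3
  rw [h3] at h2
  exact h2

theorem isCompactOperator_fiberRes (hB : 0 < B) (h : SquareBounded v f c) {M : ℝ} (hM : 1 ≤ M)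
    (p : ℂ) : IsCompactOperator (fiberRes hB h M p) :=
  (isCompactOperator_oscInv hB hM).comp_clm _

/-- The perturbation is a polynomial in `p`, and inversion is analytic on units. -/
theorem analyticAt_fiberRes (hB : 0 < B) (h : SquareBounded v f c) {M L : ℝ}
    (hM : shiftBound f c L ≤ M) {p : ℂ} (hp : ‖p‖ ≤ L) : AnalyticAt ℂ (fiberRes hB h M) p := by
  have h1 : AnalyticAt ℂ (fun p => 1 + fiberPert hB h M p) p := by
    unfold fiberPert; fun_prop
  obtain ⟨u, hu⟩ := isUnit_one_add_fiberPert hB h hM hp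
  have h2 : AnalyticAt ℂ (Ring.inverse (M₀ := L2R →L[ℂ] L2R)) (1 + fiberPert hB h M p) := by
    rw [← hu]; exact analyticAt_inverse u
  exact analyticAt_const.mul (h2.fun_comp_of_eq h1 rfl)

theorem SquareBounded.isSelfAdjoint_fiberOp (hB : 0 < B) (h : SquareBounded v f c) (p : ℝ) :
    IsSelfAdjoint (fiberOp B v p) :=
  (isInverseOf_fiberRes hB h le_rfl le_rfl).isSelfAdjoint (h.symmGraph_fiberOp p)
    (h.dense_domain_fiberOp p)

theorem neg_shiftBound_lt (hB : 0 < B) (h : SquareBounded v f c) {p L t : ℝ} (hp : |p| ≤ L)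
    {x : L2R} (hx : (x, (t : ℂ) • x) ∈ (fiberOp B v p).graph) (hx0 : x ≠ 0) :
    -shiftBound f c L < t := by
  by_contra! ht
  -- An eigenvalue `t` below the bound would make `h_v(p) + M` with `M = -t` both invertible and
  -- singular.
  have h1 := (isInverseOf_fiberRes hB h (M := -t) (by linarith) hp x _).1 hx
  rw [← add_smul] at h1
  simp at h1
  exact hx0 h1.symm

end Resolvent

/-! ### Uniqueness for second order equations with locally integrable coefficients -/

/-- The coefficient is only locally integrable, so the equation is used in integrated form. The set
where `u` and `u'` both vanish is closed, and it is open by a contraction estimate on short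
intervals. -/
theorem eq_zero_of_norm_sub_le_integral {u u' : ℝ → ℂ} {m : ℝ → ℝ} (hm : LocallyIntegrable m)
    (hm0 : ∀ x, 0 ≤ m x) (hu' : Continuous u') (hd : ∀ x, HasDerivAt u (u' x) x)
    (hi : ∀ a b, ‖u' b - u' a‖ ≤ ∫ s in uIoc a b, m s * ‖u s‖) {a₀ : ℝ} (h0 : u a₀ = 0)
    (h0' : u' a₀ = 0) (x : ℝ) : u x = 0 := by
  have hu : Continuous u := continuous_iff_continuousAt.2 fun x => (hd x).continuousAt
  set S : Set ℝ := {a | u a = 0 ∧ u' a = 0} with hS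
  have hcl : IsClosed S := (isClosed_eq hu continuous_const).inter (isClosed_eq hu' continuous_const)
  have hop : IsOpen S := by
    rw [isOpen_iff_mem_nhds]
    rintro a ⟨ha, ha'⟩
    have hm1 : LocallyIntegrable (fun x => m x + 1) := hm.add (locallyIntegrable_const 1)
    have hii : ∀ a b, IntervalIntegrable (fun x => m x + 1) volume a b := fun a b =>
      intervalIntegrable_iff.2 ((hm1.integrableOn_isCompact isCompact_uIcc).mono_set uIoc_subset_uIcc)
    have hcont : Continuous fun b => ∫ s in a..b, (m s + 1) :=
      intervalIntegral.continuous_primitive hii a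
    have hlim : Tendsto (fun δ => (∫ s in a..(a + δ), (m s + 1)) - ∫ s in a..(a - δ), (m s + 1)) (𝓝 0)
        (𝓝 0) := by
      have h1 : Continuous fun δ => (∫ s in a..(a + δ), (m s + 1)) - ∫ s in a..(a - δ), (m s + 1) :=
        (hcont.comp (continuous_const.add continuous_id)).sub
          (hcont.comp (continuous_const.sub continuous_id))
      simpa using h1.tendsto 0
    -- Choose `δ` so that `m + 1` has integral below `1/2` over `[a - δ, a + δ]`; the maximum `N` of
    -- `|u|` and `|u'|` there then satisfies `N ≤ N / 2`.
    obtain ⟨δ, hδ, hδ0⟩ := ((hlim.mono_left nhdsWithin_le_nhds).eventually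
      (gt_mem_nhds (by norm_num : (0 : ℝ) < 1 / 2)) |>.and (self_mem_nhdsWithin :
        Ioi (0 : ℝ) ∈ 𝓝[>] (0 : ℝ))).exists
    rw [← intervalIntegral.integral_add_adjacent_intervals (hii a a) (hii a (a - δ)),
      intervalIntegral.integral_same, zero_add,
      intervalIntegral.integral_interval_sub_left (hii a _) (hii a _)] at hδ
    rw [intervalIntegral.integral_of_le (by linarith)] at hδ
    set I := Icc (a - δ) (a + δ) with hI
    have hmI : IntegrableOn (fun x => m x + 1) I := hm1.integrableOn_isCompact isCompact_Icc
    rw [← integral_Icc_eq_integral_Ioc] at hδ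
    obtain ⟨s₀, hs₀, hmax⟩ := isCompact_Icc.exists_isMaxOn (s := I)
      (nonempty_Icc.2 (by linarith)) (f := fun s => max ‖u s‖ ‖u' s‖)
      ((hu.norm.max hu'.norm).continuousOn)
    set N := max ‖u s₀‖ ‖u' s₀‖ with hN
    have hN0 : 0 ≤ N := (norm_nonneg _).trans (le_max_left _ _)
    have hle : ∀ s ∈ I, ‖u s‖ ≤ N ∧ ‖u' s‖ ≤ N := fun s hs =>
      ⟨(le_max_left _ _).trans (hmax hs), (le_max_right _ _).trans (hmax hs)⟩
    have hsub : uIoc a s₀ ⊆ I := by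
      intro s hs
      rw [mem_uIoc] at hs
      rw [hI, mem_Icc] at hs₀ ⊢
      rcases hs with hs | hs <;> constructor <;> linarith
    have hint : ∀ g : ℝ → ℝ, IntegrableOn g I → (∀ s ∈ I, 0 ≤ g s ∧ g s ≤ (m s + 1) * N) →
        ∫ s in uIoc a s₀, g s ≤ N / 2 := by
      intro g hg hgb
      calc ∫ s in uIoc a s₀, g s ≤ ∫ s in I, g s := by
            refine setIntegral_mono_set hg ?_ hsub.eventuallyLE
            exact (ae_restrict_iff' measurableSet_Icc).2
              (Eventually.of_forall fun s hs => (hgb s hs).1)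
        _ ≤ ∫ s in I, (m s + 1) * N :=
            setIntegral_mono_on hg (hmI.mul_const N) measurableSet_Icc fun s hs => (hgb s hs).2
        _ = (∫ s in I, (m s + 1)) * N := integral_mul_const _ _
        _ ≤ N / 2 := by nlinarith
    have hb1 : ‖u s₀‖ ≤ N / 2 := by
      have h1 : u s₀ - u a = ∫ s in a..s₀, u' s :=
        (intervalIntegral.integral_eq_sub_of_hasDerivAt (fun s _ => hd s)
          (hu'.intervalIntegrable _ _)).symm
      rw [ha, sub_zero] at h1
      rw [h1]
      refine intervalIntegral.norm_integral_le_integral_norm_uIoc.trans (hint _ ?_ fun s hs => ?_)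
      · exact hu'.norm.continuousOn.integrableOn_compact isCompact_Icc
      · exact ⟨norm_nonneg _, (hle s hs).2.trans (by nlinarith [hm0 s])⟩
    have hb2 : ‖u' s₀‖ ≤ N / 2 := by
      have h1 := hi a s₀
      rw [ha', sub_zero] at h1
      refine h1.trans (hint _ ?_ fun s hs => ?_)
      · exact (hm.integrableOn_isCompact isCompact_Icc).mul_continuousOn hu.norm.continuousOn
          isCompact_Icc
      · have h2 := (hle s hs).1
        have h3 := hm0 s
        exact ⟨mul_nonneg h3 (norm_nonneg _), by nlinarith [norm_nonneg (u s)]⟩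
    have hN2 : N ≤ N / 2 := max_le hb1 hb2
    filter_upwards [Icc_mem_nhds (by linarith : a - δ < a) (by linarith : a < a + δ)] with s hs
    have h3 := hle s hs
    exact ⟨norm_le_zero_iff.1 (by linarith), norm_le_zero_iff.1 (by linarith)⟩
  have huniv : S = univ := IsClopen.eq_univ ⟨hcl, hop⟩ ⟨a₀, h0, h0'⟩
  have : x ∈ S := by rw [huniv]; trivial
  exact this.1

end

/-! ### Regularity of the graph elements and simplicity of the eigenvalues -/

section

local notation "⟪" x ", " y "⟫" => inner ℂ x y

open Polynomial

variable {B : ℝ} {v f : ℝ → ℝ} {c : ℝ}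

/-- Polynomials times the Gaussian as bounded continuous functions. -/
noncomputable def polyBdd (hB : 0 < B) : ℂ[X] →ₗ[ℂ] BoundedContinuousFunction ℝ ℂ where
  toFun P := BoundedContinuousFunction.ofNormedAddCommGroup (polyGauss B P)
    (contDiff_polyGauss (n := 0) P).continuous _ (exists_polyGauss_bound hB P).choose_spec
  map_add' P Q := by ext x; simp [polyGauss_add]
  map_smul' a P := by ext x; simp [polyGauss_smul]

theorem polyBdd_apply (hB : 0 < B) (P : ℂ[X]) (x : ℝ) : polyBdd hB P x = polyGauss B P x := rfl

/-- `polyD` as a linear map. -/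
noncomputable def polyDLinear (B : ℝ) : ℂ[X] →ₗ[ℂ] ℂ[X] where
  toFun := polyD B
  map_add' := polyD_add
  map_smul' := polyD_smul

theorem norm_polyBdd_le (hB : 0 < B) {M : ℝ} (hM : 1 ≤ M) (P : ℂ[X]) :
    ‖polyBdd hB P‖ ≤ 2 * (√M)⁻¹ * ‖oscShift hB M P‖ :=
  (BoundedContinuousFunction.norm_le (by positivity)).2 (polyGauss_norm_le hB hM P)

/-- Separation controls `u''` in `L²`, and the Sobolev inequality applied to `u'` then controls its
supremum. -/
theorem norm_polyBdd_polyD_le (hB : 0 < B) {M : ℝ} (hM : 1 ≤ M) (P : ℂ[X]) :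
    ‖polyBdd hB (polyD B P)‖ ≤ (4 + 2 * B ^ 2) * ‖oscShift hB M P‖ := by
  set e := ‖oscShift hB M P‖ with he
  have he0 : 0 ≤ e := norm_nonneg _
  have h0 := norm_polyToL2_le' hB (by linarith : 0 < M) P
  have h0' : ‖polyToL2 hB P‖ ≤ e := h0.trans
    (mul_le_of_le_one_left he0 (inv_le_one_of_one_le₀ hM))
  have hMP : M * ‖polyToL2 hB P‖ ≤ e := by
    rw [inv_mul_eq_div, le_div_iff₀ (by linarith)] at h0; linarith
  have hH : ‖polyToL2 hB (polyH B P)‖ ≤ 2 * e := by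
    have h1 : polyToL2 hB (polyH B P) = oscShift hB M P - (M : ℂ) • polyToL2 hB P := by
      rw [oscShift_apply, add_sub_cancel_right]
    rw [h1]
    refine (norm_sub_le _ _).trans ?_
    rw [norm_smul, Complex.norm_real, Real.norm_of_nonneg (by linarith)]
    linarith
  have h1 : ‖polyToL2 hB (polyD B P)‖ ≤ e := (norm_polyD_le hB hM P).trans
    (mul_le_of_le_one_left he0 (inv_le_one_of_one_le₀ (Real.one_le_sqrt.2 hM)))
  have h2 : ‖polyToL2 hB (polyD B (polyD B P))‖ ≤ (2 + B ^ 2) * e := by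
    refine le_of_sq_le_sq ?_ (by positivity)
    have h3 := norm_polyD_polyD_sq_le hB P
    have h4 : ‖polyToL2 hB (polyH B P)‖ ^ 2 ≤ (2 * e) ^ 2 := by gcongr
    have h5 : ‖polyToL2 hB P‖ ^ 2 ≤ e ^ 2 := by gcongr
    have h6 := mul_le_mul_of_nonneg_left h5 (by positivity : 0 ≤ 2 * B ^ 2)
    nlinarith [sq_nonneg (B ^ 2 * e), sq_nonneg (B * e)]
  refine (BoundedContinuousFunction.norm_le (by positivity)).2 fun x => ?_
  rw [polyBdd_apply]
  refine le_of_sq_le_sq ((polyGauss_norm_sq_le hB (polyD B P) x).trans ?_) (by positivity)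
  have h7 := mul_le_mul h1 h2 (norm_nonneg _) he0
  nlinarith [sq_nonneg e, mul_nonneg (sq_nonneg B) (sq_nonneg e),
    mul_nonneg (sq_nonneg (B ^ 2)) (sq_nonneg e)]

/-- Approximation of an element `(x, y)` of the graph of the fiber operator, with a continuously
differentiable representative `u` of `x`. -/
structure FiberApprox (hB : 0 < B) (h : SquareBounded v f c) (p : ℝ) (x y : L2R) (u u' : ℝ → ℂ)
    (P : ℕ → ℂ[X]) : Prop where
  tendsto : Tendsto (fun k => polyToL2 hB (P k)) atTop (𝓝 x)
  tendsto_fiber : Tendsto (fun k => fiberPoly hB h p (P k)) atTop (𝓝 y)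
  unif : TendstoUniformly (fun k => polyGauss B (P k)) u atTop
  unif' : TendstoUniformly (fun k => polyGauss B (polyD B (P k))) u' atTop

/-- Write `x = (H + M)⁻¹ g` for the oscillator `H` and approximate `g` by `oscShift hB M (P k)`. All
four convergences are continuity at `g` of a bounded operator, two of them with values in the
bounded continuous functions. -/
theorem exists_fiberApprox (hB : 0 < B) (h : SquareBounded v f c) {p : ℝ} {x y : L2R}
    (hxy : (x, y) ∈ (fiberOp B v p).graph) : ∃ u u' P, FiberApprox hB h p x y u u' P := by
  set M := shiftBound f c |p|
  have hM : 1 ≤ M := one_le_shiftBound _ _ _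
  have hd := denseRange_oscShift hB (M := M) (by linarith)
  have hinv := (isInverseOf_fiberRes hB h (M := M) le_rfl le_rfl x y).1 hxy
  set g := Ring.inverse (1 + fiberPert hB h M p) (y + (M : ℂ) • x) with hg
  have hx : oscInv hB M g = x := hinv
  have hgy : g + fiberPert hB h M p g = y + (M : ℂ) • x := by
    have hu := isUnit_one_add_fiberPert hB h (M := M) le_rfl (p := p)
      (by simp : ‖(p : ℂ)‖ ≤ |p|)
    have h3 := congrArg (fun T : L2R →L[ℂ] L2R => T (y + (M : ℂ) • x)) (Ring.mul_inverse_cancel _ hu)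
    simpa only [mul_apply_eq_comp, add_apply, one_apply_eq_self] using h3
  obtain ⟨s, hs, hsg⟩ := mem_closure_iff_seq_limit.1 (hd g)
  choose P hP using hs
  have hPg : Tendsto (fun k => oscShift hB M (P k)) atTop (𝓝 g) := by simpa only [hP] using hsg
  have b1 := norm_polyBdd_le hB hM
  have b2 : ∀ P, ‖(polyBdd hB ∘ₗ polyDLinear B) P‖ ≤ (4 + 2 * B ^ 2) * ‖oscShift hB M P‖ :=
    norm_polyBdd_polyD_le hB hM
  set S := (polyBdd hB).extendOfNorm (oscShift hB M)
  set S' := (polyBdd hB ∘ₗ polyDLinear B).extendOfNorm (oscShift hB M)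
  have t1 := (S.continuous.tendsto g).comp hPg
  have t2 := (S'.continuous.tendsto g).comp hPg
  have t3 := ((oscInv hB M).continuous.tendsto g).comp hPg
  have t4 := ((1 + fiberPert hB h M p - (M : ℂ) • oscInv hB M).continuous.tendsto g).comp hPg
  refine ⟨S g, S' g, P, ⟨?_, ?_, ?_, ?_⟩⟩
  · rw [← hx]
    exact t3.congr fun k => oscInv_oscShift hB hM _
  · have e1 : (1 + fiberPert hB h M p - (M : ℂ) • oscInv hB M) g = y := by
      rw [sub_apply, add_apply, one_apply_eq_self, hgy, smul_apply, hx, add_sub_cancel_right]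
    rw [e1] at t4
    refine t4.congr fun k => ?_
    rw [Function.comp_apply, sub_apply, add_apply, one_apply_eq_self, fiberPert_oscShift hB h hM,
      smul_apply, oscInv_oscShift hB hM, add_sub_cancel_right]
  · rw [BoundedContinuousFunction.tendsto_iff_tendstoUniformly] at t1
    convert! t1 using 2 with k
    exact congrArg DFunLike.coe (LinearMap.extendOfNorm_eq hd ⟨_, b1⟩ (P k)).symm
  · rw [BoundedContinuousFunction.tendsto_iff_tendstoUniformly] at t2
    convert! t2 using 2 with k
    exact congrArg DFunLike.coe (LinearMap.extendOfNorm_eq hd ⟨_, b2⟩ (P k)).symm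

/-- A subsequence of an `L²` convergent sequence converges almost everywhere, which identifies the
two limits. -/
theorem coeFn_eq_of_tendsto (hB : 0 < B) {P : ℕ → ℂ[X]} {x : L2R} {u : ℝ → ℂ}
    (h : Tendsto (fun k => polyToL2 hB (P k)) atTop (𝓝 x))
    (hu : ∀ s, Tendsto (fun k => polyGauss B (P k) s) atTop (𝓝 (u s))) : x =ᵐ[volume] u := by
  obtain ⟨ns, hns, hae⟩ := (tendstoInMeasure_of_tendsto_Lp h).exists_seq_tendsto_ae
  have h1 : ∀ᵐ s, ∀ k, polyToL2 hB (P k) s = polyGauss B (P k) s :=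
    ae_all_iff.2 fun k => coeFn_polyToL2 hB (P k)
  filter_upwards [hae, h1] with s hs h1s
  simp only [h1s] at hs
  exact tendsto_nhds_unique hs ((hu s).comp hns.tendsto_atTop)

theorem tendsto_intervalIntegral_of_tendsto {g : ℕ → L2R} {y : L2R}
    (h : Tendsto g atTop (𝓝 y)) (a b : ℝ) :
    Tendsto (fun k => ∫ s in a..b, g k s) atTop (𝓝 (∫ s in a..b, y s)) := by
  have key : ∀ a b : ℝ, Tendsto (fun k => ∫ s in Ioc a b, g k s) atTop (𝓝 (∫ s in Ioc a b, y s)) := by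
    intro a b
    have h1 : ∀ z : L2R, ∫ s in Ioc a b, z s =
        ⟪indicatorConstLp 2 measurableSet_Ioc (measure_Ioc_lt_top (a := a) (b := b)).ne (1 : ℂ), z⟫ :=
      fun z => (L2.inner_indicatorConstLp_one measurableSet_Ioc measure_Ioc_lt_top.ne z).symm
    simp only [h1]
    exact tendsto_const_nhds.inner h
  exact (key a b).sub (key b a)

theorem SquareBounded.locallyIntegrable (h : SquareBounded v f c) : LocallyIntegrable v := by
  have h1 : LocallyIntegrable (fun x => |f x| + c) :=
    (h.memLp.abs.locallyIntegrable (by norm_num)).add (locallyIntegrable_const c)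
  refine h1.mono h.meas ?_
  filter_upwards [h.bound] with x hx
  rw [Real.norm_eq_abs]
  exact hx.trans (le_abs_self _)

namespace FiberApprox

variable {p : ℝ} {hB : 0 < B} {h : SquareBounded v f c} {x y x₂ y₂ : L2R} {u u' u₂ u₂' : ℝ → ℂ}
  {P P₂ : ℕ → ℂ[X]}

theorem coeFn (H : FiberApprox hB h p x y u u' P) : x =ᵐ[volume] u :=
  coeFn_eq_of_tendsto hB H.tendsto fun s => H.unif.tendsto_at s

theorem continuous' (H : FiberApprox hB h p x y u u' P) : Continuous u' :=
  H.unif'.continuous (Frequently.of_forall fun _ => (contDiff_polyGauss (n := 0) _).continuous)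

theorem hasDerivAt (H : FiberApprox hB h p x y u u' P) (s : ℝ) : HasDerivAt u (u' s) s :=
  hasDerivAt_of_tendstoUniformly H.unif' (Eventually.of_forall fun k => hasDerivAt_polyGauss (P k))
    (fun s => H.unif.tendsto_at s) s

theorem sub_smul (H : FiberApprox hB h p x y u u' P) (H₂ : FiberApprox hB h p x₂ y₂ u₂ u₂' P₂)
    (a : ℂ) : FiberApprox hB h p (x₂ - a • x) (y₂ - a • y) (u₂ - a • u) (u₂' - a • u')
      (fun k => P₂ k - a • P k) := by
  have e1 : ∀ P Q : ℂ[X], polyGauss B (Q - a • P) = polyGauss B Q - a • polyGauss B P := by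
    intro P Q; funext s; simp [polyGauss, sub_mul, mul_assoc]
  have hs : UniformContinuous fun z : ℂ => a • z := uniformContinuous_const_smul a
  refine ⟨?_, ?_, ?_, ?_⟩
  · refine (H₂.tendsto.sub (H.tendsto.const_smul a)).congr fun k => ?_
    rw [map_sub, map_smul]
  · refine (H₂.tendsto_fiber.sub (H.tendsto_fiber.const_smul a)).congr fun k => ?_
    have e2 : ∀ P Q : ℂ[X], polyH B (Q - a • P) = polyH B Q - a • polyH B P := by
      intro P Q
      rw [sub_eq_add_neg, ← neg_smul, polyH_add, polyH_smul, neg_smul, ← sub_eq_add_neg]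
    simp only [fiberPoly, e2, mul_sub, mul_smul_comm, map_sub, map_smul]
    module
  · simp only [e1]
    exact H₂.unif.sub (hs.comp_tendstoUniformly H.unif)
  · have e2 : ∀ P Q : ℂ[X], polyD B (Q - a • P) = polyD B Q - a • polyD B P := by
      intro P Q
      rw [sub_eq_add_neg, ← neg_smul, polyD_add, polyD_smul, neg_smul, ← sub_eq_add_neg]
    simp only [e2, e1]
    exact H₂.unif'.sub (hs.comp_tendstoUniformly H.unif')

/-- The equation `u'' = ((p + B s)² + v) u - y` in integrated form, obtained as a limit from
polynomials times the Gaussian. -/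
theorem sub_eq_integral (H : FiberApprox hB h p x y u u' P) (a b : ℝ) :
    u' b - u' a = ∫ s in a..b, (((((p + B * s) ^ 2 + v s : ℝ) : ℂ)) * u s - y s) := by
  set q : ℝ → ℝ := fun s => (p + B * s) ^ 2 + v s with hq
  have hqi : LocallyIntegrable q := by
    refine LocallyIntegrable.add (Continuous.locallyIntegrable ?_) h.locallyIntegrable
    fun_prop
  have hqI : IntervalIntegrable q volume a b :=
    intervalIntegrable_iff.2 ((hqi.integrableOn_isCompact isCompact_uIcc).mono_set uIoc_subset_uIcc)
  have hu : Continuous u := continuous_iff_continuousAt.2 fun x => (H.hasDerivAt x).continuousAt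
  have hyI : ∀ z : L2R, IntervalIntegrable z volume a b := fun z =>
    intervalIntegrable_iff.2 ((((Lp.memLp z).locallyIntegrable (by norm_num)).integrableOn_isCompact
      isCompact_uIcc).mono_set uIoc_subset_uIcc)
  have hquI : ∀ w : ℝ → ℂ, Continuous w → IntervalIntegrable (fun s => (q s : ℂ) * w s) volume a b :=
    fun w hw => IntervalIntegrable.mul_continuousOn
      ⟨hqI.1.ofReal, hqI.2.ofReal⟩ hw.continuousOn
  have hk : ∀ k, polyGauss B (polyD B (P k)) b - polyGauss B (polyD B (P k)) a =
      (∫ s in a..b, (q s : ℂ) * polyGauss B (P k) s) - ∫ s in a..b, fiberPoly hB h p (P k) s := by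
    intro k
    rw [← intervalIntegral.integral_eq_sub_of_hasDerivAt
      (fun s _ => hasDerivAt_polyGauss (polyD B (P k)) s)
      ((contDiff_polyGauss (n := 0) _).continuous.intervalIntegrable _ _),
      ← intervalIntegral.integral_sub (hquI _ (contDiff_polyGauss (n := 0) _).continuous) (hyI _)]
    refine intervalIntegral.integral_congr_ae ?_
    filter_upwards [coeFn_fiberPoly hB h p (P k)] with s hs _
    rw [hs, hq]
    push_cast
    ring
  rw [intervalIntegral.integral_sub (hquI u hu) (hyI y)]
  refine tendsto_nhds_unique ((H.unif'.tendsto_at b).sub (H.unif'.tendsto_at a)) ?_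
  simp only [hk]
  refine Tendsto.sub ?_ (tendsto_intervalIntegral_of_tendsto H.tendsto_fiber a b)
  refine intervalIntegral.tendsto_integral_filter_of_dominated_convergence
    (fun s => ‖q s‖ * (1 + ‖u s‖)) ?_ ?_ ?_ ?_
  · exact Eventually.of_forall fun k =>
      (intervalIntegrable_iff.1 (hquI _ (contDiff_polyGauss (n := 0) _).continuous)).aestronglyMeasurable
  · filter_upwards [Metric.tendstoUniformly_iff.1 H.unif 1 one_pos] with k hk
    refine Eventually.of_forall fun s _ => ?_
    rw [norm_mul, Complex.norm_real]
    refine mul_le_mul_of_nonneg_left ?_ (norm_nonneg _)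
    have h1 := hk s
    rw [dist_comm, dist_eq_norm] at h1
    have h2 := norm_le_norm_add_norm_sub' (polyGauss B (P k) s) (u s)
    linarith
  · exact hqI.norm.mul_continuousOn (continuous_const.add hu.norm).continuousOn
  · exact Eventually.of_forall fun s _ => (H.unif.tendsto_at s).const_mul _

theorem eq_zero {t : ℝ} (H : FiberApprox hB h p x ((t : ℂ) • x) u u' P) {a : ℝ} (h0 : u a = 0)
    (h0' : u' a = 0) : x = 0 := by
  have hm : LocallyIntegrable fun s => |(p + B * s) ^ 2 + v s - t| := by
    have h1 : LocallyIntegrable fun s => (p + B * s) ^ 2 + v s - t := by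
      refine LocallyIntegrable.sub (LocallyIntegrable.add (Continuous.locallyIntegrable ?_)
        h.locallyIntegrable) (locallyIntegrable_const t)
      fun_prop
    exact h1.mono h1.aestronglyMeasurable.norm (Eventually.of_forall fun s => by simp)
  have hz : ∀ s, u s = 0 := by
    refine eq_zero_of_norm_sub_le_integral hm (fun _ => abs_nonneg _) H.continuous' H.hasDerivAt
      (fun a b => ?_) h0 h0'
    rw [H.sub_eq_integral a b]
    refine intervalIntegral.norm_integral_le_integral_norm_uIoc.trans (le_of_eq ?_)
    refine integral_congr_ae (ae_restrict_of_ae ?_)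
    filter_upwards [Lp.coeFn_smul (t : ℂ) x, H.coeFn] with s h1 h2
    rw [h1, Pi.smul_apply, h2, smul_eq_mul, ← sub_mul, norm_mul, ← Complex.ofReal_sub,
      Complex.norm_real, Real.norm_eq_abs]
  refine (Lp.eq_zero_iff_ae_eq_zero).2 ?_
  filter_upwards [H.coeFn] with s hs
  rw [hs, hz s]; rfl

/-- The Wronskian of the approximants vanishes at `-∞` and has derivative `Q · dR - dQ · R`, where
`d = t - h_v(p)`. It is thus bounded by `‖Q‖ ‖dR‖ + ‖dQ‖ ‖R‖`, and `d` tends to zero along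
approximations of eigenvectors. -/
theorem wronskian_eq_zero {t : ℝ} (H : FiberApprox hB h p x ((t : ℂ) • x) u u' P)
    (H₂ : FiberApprox hB h p x₂ ((t : ℂ) • x₂) u₂ u₂' P₂) (s : ℝ) :
    u s * u₂' s - u' s * u₂ s = 0 := by
  set d : ℂ[X] → L2R := fun Q => (t : ℂ) • polyToL2 hB Q - fiberPoly hB h p Q with hd
  have hdae : ∀ Q, d Q =ᵐ[volume] fun s => t * polyGauss B Q s - (-polyGauss B (polyD B (polyD B Q)) s
      + ((((p + B * s) ^ 2 : ℝ) : ℂ) + v s) * polyGauss B Q s) := by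
    intro Q
    filter_upwards [Lp.coeFn_sub ((t : ℂ) • polyToL2 hB Q) (fiberPoly hB h p Q),
      Lp.coeFn_smul (t : ℂ) (polyToL2 hB Q), coeFn_polyToL2 hB Q, coeFn_fiberPoly hB h p Q]
      with s h1 h2 h3 h4
    rw [hd, h1, Pi.sub_apply, h2, Pi.smul_apply, h3, h4, smul_eq_mul]
  have hb : ∀ Q R, ‖polyGauss B Q s * polyGauss B (polyD B R) s -
      polyGauss B (polyD B Q) s * polyGauss B R s‖ ≤
      ‖polyToL2 hB Q‖ * ‖d R‖ + ‖d Q‖ * ‖polyToL2 hB R‖ := by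
    intro Q R
    have hF : ∀ s, HasDerivAt (fun s => polyGauss B Q s * polyGauss B (polyD B R) s -
        polyGauss B (polyD B Q) s * polyGauss B R s)
        (polyGauss B Q s * polyGauss B (polyD B (polyD B R)) s -
          polyGauss B (polyD B (polyD B Q)) s * polyGauss B R s) s := by
      intro s
      refine (((hasDerivAt_polyGauss Q s).mul (hasDerivAt_polyGauss (polyD B R) s)).sub
        ((hasDerivAt_polyGauss (polyD B Q) s).mul (hasDerivAt_polyGauss R s))).congr_deriv ?_
      ring
    refine (norm_le_integral_norm_deriv hF ((integrable_polyGauss_mul hB _ _).sub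
      (integrable_polyGauss_mul hB _ _)) ((integrable_polyGauss_mul hB _ _).sub
      (integrable_polyGauss_mul hB _ _)) s).trans ?_
    have i1 := integral_norm_mul_norm_le (Lp.memLp (polyToL2 hB Q)) (Lp.memLp (d R))
    have i2 := integral_norm_mul_norm_le (Lp.memLp (d Q)) (Lp.memLp (polyToL2 hB R))
    simp only [Lp.toLp_coeFn] at i1 i2
    have j1 : Integrable fun s => ‖polyToL2 hB Q s‖ * ‖d R s‖ :=
      (Lp.memLp (polyToL2 hB Q)).norm.integrable_mul (Lp.memLp (d R)).norm
    have j2 : Integrable fun s => ‖d Q s‖ * ‖polyToL2 hB R s‖ :=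
      (Lp.memLp (d Q)).norm.integrable_mul (Lp.memLp (polyToL2 hB R)).norm
    refine le_trans ?_ (add_le_add i1 i2)
    rw [← integral_add j1 j2]
    refine integral_mono_ae ((integrable_polyGauss_mul hB _ _).sub
      (integrable_polyGauss_mul hB _ _)).norm (j1.add j2) ?_
    filter_upwards [hdae Q, hdae R, coeFn_polyToL2 hB Q, coeFn_polyToL2 hB R] with s h1 h2 h3 h4
    rw [h1, h2, h3, h4, ← norm_mul, ← norm_mul]
    refine le_trans (le_of_eq ?_) (norm_sub_le _ _)
    congr 1
    ring
  have ht1 : Tendsto (fun k => d (P k)) atTop (𝓝 0) := by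
    simpa using! (H.tendsto.const_smul (t : ℂ)).sub H.tendsto_fiber
  have ht2 : Tendsto (fun k => d (P₂ k)) atTop (𝓝 0) := by
    simpa using! (H₂.tendsto.const_smul (t : ℂ)).sub H₂.tendsto_fiber
  have hlim0 : Tendsto (fun k => ‖polyToL2 hB (P k)‖ * ‖d (P₂ k)‖ +
      ‖d (P k)‖ * ‖polyToL2 hB (P₂ k)‖) atTop (𝓝 0) := by
    simpa using (H.tendsto.norm.mul ht2.norm).add (ht1.norm.mul H₂.tendsto.norm)
  have hl1 := ((H.unif.tendsto_at s).mul (H₂.unif'.tendsto_at s)).sub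
    ((H.unif'.tendsto_at s).mul (H₂.unif.tendsto_at s))
  exact tendsto_nhds_unique hl1 (squeeze_zero_norm (fun k => hb _ _) hlim0)

end FiberApprox

/-- Since the Wronskian vanishes, some `y - a x` has zero Cauchy data at the point `0`, and
uniqueness for the equation makes it zero. -/
theorem exists_eq_smul_of_eigen (hB : 0 < B) (h : SquareBounded v f c) {p t : ℝ} {x y : L2R}
    (hx : (x, (t : ℂ) • x) ∈ (fiberOp B v p).graph) (hy : (y, (t : ℂ) • y) ∈ (fiberOp B v p).graph)
    (hx0 : x ≠ 0) : ∃ a : ℂ, y = a • x := by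
  obtain ⟨u, u', P, H⟩ := exists_fiberApprox hB h hx
  obtain ⟨w, w', Q, H₂⟩ := exists_fiberApprox hB h hy
  have hW := H.wronskian_eq_zero H₂ 0
  have key : ∀ a : ℂ, w 0 = a * u 0 → w' 0 = a * u' 0 → ∃ a : ℂ, y = a • x := by
    intro a h1 h2
    have H₃ := H.sub_smul H₂ a
    rw [smul_comm, ← smul_sub] at H₃
    refine ⟨a, sub_eq_zero.1 (H₃.eq_zero (a := 0) ?_ ?_)⟩
    · simp [h1]
    · simp [h2]
  by_cases h0 : u 0 = 0
  · have h0' : u' 0 ≠ 0 := fun h0' => hx0 (H.eq_zero h0 h0')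
    refine key (w' 0 / u' 0) ?_ (by field_simp)
    rw [h0] at hW ⊢
    simp [h0'] at hW
    simp [hW]
  · refine key (w 0 / u 0) (by field_simp) ?_
    field_simp
    linear_combination hW

/-- The fiber operators have a Hilbert basis of eigenvectors with simple eigenvalues. -/
theorem exists_eigenSystem_fiberOp (hB : 0 < B) (h : SquareBounded v f c) (p : ℝ) :
    ∃ ε b, EigenSystem (fiberOp B v p) ε b :=
  exists_eigenSystem (h.symmGraph_fiberOp p) (isInverseOf_fiberRes hB h le_rfl le_rfl)
    (isCompactOperator_fiberRes hB h (one_le_shiftBound _ _ _) p) not_finiteDimensional_L2R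
    (fun _ _ hx hx0 => (neg_shiftBound_lt hB h le_rfl hx hx0).le)
    fun _ _ _ hx hy hx0 => exists_eq_smul_of_eigen hB h hx hy hx0

end

section

local notation "⟪" x ", " y "⟫" => inner ℂ x y

open Polynomial

variable {B : ℝ} {v f : ℝ → ℝ} {c : ℝ}

/-! ### Translations -/

/-- Translation by `a` on `L²(ℝ)`. -/
noncomputable def translation (a : ℝ) : L2R →ₗᵢ[ℂ] L2R :=
  Lp.compMeasurePreservingₗᵢ ℂ (fun s => s - a) (measurePreserving_sub_right volume a)

theorem coeFn_translation (a : ℝ) (x : L2R) : translation a x =ᵐ[volume] fun s => x (s - a) :=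
  Lp.coeFn_compMeasurePreserving x (measurePreserving_sub_right volume a)

theorem translation_neg (a : ℝ) (x : L2R) : translation a (translation (-a) x) = x := by
  refine Lp.ext ?_
  have h1 := (measurePreserving_sub_right volume a).quasiMeasurePreserving.ae
    (coeFn_translation (-a) x)
  filter_upwards [coeFn_translation a (translation (-a) x), h1] with s h2 h3
  rw [h2, h3]
  simp

/-- Translation as a unitary operator. -/
noncomputable def translationEquiv (a : ℝ) : L2R ≃ₗᵢ[ℂ] L2R :=
  LinearIsometryEquiv.ofSurjective (translation a) fun x => ⟨_, translation_neg a x⟩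

theorem translationEquiv_apply (a : ℝ) (x : L2R) : translationEquiv a x = translation a x := rfl

theorem SquareBounded.translate (h : SquareBounded v f c) (a : ℝ) :
    SquareBounded (fun x => v (x - a)) (fun x => f (x - a)) c where
  meas := h.meas.comp_measurePreserving (measurePreserving_sub_right volume a)
  memLp := h.memLp.comp_measurePreserving (measurePreserving_sub_right volume a)
  bound := (measurePreserving_sub_right volume a).quasiMeasurePreserving.ae h.bound
  nonneg := h.nonneg

theorem eLpNorm_translate (hf : AEStronglyMeasurable f volume) (a : ℝ) :
    eLpNorm (fun x => f (x - a)) 2 volume = eLpNorm f 2 volume :=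
  eLpNorm_comp_measurePreserving hf (measurePreserving_sub_right volume a)

theorem deriv_comp_sub (φ : ℝ → ℂ) (a : ℝ) :
    deriv (fun s => φ (s - a)) = fun s => deriv φ (s - a) :=
  funext fun s => _root_.deriv_comp_sub_const φ a s

/-- As `p + B (s - p / B) = B s`, the shift centres the well at the origin and moves the dependence
on `p` into the potential. -/
theorem translation_mem_graph (hB : 0 < B) (h : SquareBounded v f c) {p : ℝ} {x y : L2R}
    (hxy : (x, y) ∈ (fiberOp B v p).graph) :
    (translation (p / B) x, translation (p / B) y) ∈
      (fiberOp B (fun s => v (s - p / B)) 0).graph := by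
  rw [h.fiberOp_graph] at hxy
  rw [(h.translate (p / B)).fiberOp_graph]
  rw [← SetLike.mem_coe, Submodule.topologicalClosure_coe] at hxy ⊢
  refine map_mem_closure (f := fun q : L2R × L2R => (translation (p / B) q.1, translation (p / B) q.2))
    (by fun_prop) hxy ?_
  intro q hq
  obtain ⟨φ, hφ, hφc, h1, h2⟩ := hq
  have hm := measurePreserving_sub_right (volume : Measure ℝ) (p / B)
  refine ⟨fun s => φ (s - p / B), hφ.comp (contDiff_id.sub contDiff_const),
    hφc.comp_homeomorph (Homeomorph.subRight (p / B)), ?_, ?_⟩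
  · exact (coeFn_translation _ _).trans (hm.quasiMeasurePreserving.ae_eq h1)
  · refine (coeFn_translation _ _).trans ((hm.quasiMeasurePreserving.ae_eq h2).trans ?_)
    refine Eventually.of_forall fun s => ?_
    simp only [Function.comp_apply, fiberExpr, deriv_comp_sub]
    have : p + B * (s - p / B) = 0 + B * s := by field_simp; ring
    rw [this]

/-- The image of a Hilbert basis under a unitary operator. -/
noncomputable def mapBasis {E : Type*} [NormedAddCommGroup E] [InnerProductSpace ℂ E]
    (b : HilbertBasis ℕ ℂ E) (U : E ≃ₗᵢ[ℂ] E) : HilbertBasis ℕ ℂ E :=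
  HilbertBasis.ofRepr (U.symm.trans b.repr)

theorem mapBasis_apply {E : Type*} [NormedAddCommGroup E] [InnerProductSpace ℂ E]
    (b : HilbertBasis ℕ ℂ E) (U : E ≃ₗᵢ[ℂ] E) (n : ℕ) : mapBasis b U n = U (b n) := by
  rw [← (mapBasis b U).repr_symm_single, ← b.repr_symm_single]
  rfl

theorem EigenSystem.translate (hB : 0 < B) (h : SquareBounded v f c) {p : ℝ} {ε : ℕ → ℝ}
    {b : HilbertBasis ℕ ℂ L2R} (hE : EigenSystem (fiberOp B v p) ε b) :
    EigenSystem (fiberOp B (fun s => v (s - p / B)) 0) ε (mapBasis b (translationEquiv (p / B))) where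
  strictMono := hE.strictMono
  tendsto := hE.tendsto
  mem n := by
    rw [mapBasis_apply, translationEquiv_apply]
    have h1 := translation_mem_graph hB h (hE.mem n)
    rwa [map_smul] at h1

/-! ### Comparison with the oscillator -/

/-- A potential that is small on `|x| < T` is small relative to the oscillator, although it need not
be small elsewhere: for `|x| ≥ T` the functions themselves are small. The square integrable part
meets the decay of `|u|`, the bounded part meets `T |u| ≤ |x u|`. -/
theorem norm_polyPot_le_of_local (hB : 0 < B) (h : SquareBounded v f c) {M δ T : ℝ} (hM : 1 ≤ M)
    (hδ : 0 ≤ δ) (hT : 0 < T) (hloc : ∀ᵐ x, |x| < T → |v x| ≤ δ) (P : ℂ[X]) :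
    ‖polyPot hB h P‖ ≤ (δ + (eLpNorm f 2 volume).toReal * √((1 + 2 / B) / T) + c / (B * T)) *
      ‖oscShift hB M P‖ := by
  set e := ‖oscShift hB M P‖ with he
  have he0 : 0 ≤ e := norm_nonneg _
  have hs : (√M)⁻¹ ≤ 1 := inv_le_one_of_one_le₀ (Real.one_le_sqrt.2 hM)
  have n0 : ‖polyToL2 hB P‖ ≤ e :=
    (norm_polyToL2_le hB hM P).trans (mul_le_of_le_one_left he0 hs)
  have n1 : ‖polyToL2 hB (polyD B P)‖ ≤ e :=
    (norm_polyD_le hB hM P).trans (mul_le_of_le_one_left he0 hs)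
  have n2 : ‖polyToL2 hB (X * P)‖ ≤ B⁻¹ * e := by
    refine (norm_X_mul_le hB hM P).trans ?_
    rw [mul_assoc]
    exact mul_le_mul_of_nonneg_left (mul_le_of_le_one_left he0 hs) (by positivity)
  set S := √((1 + 2 / B) / T) * e with hS
  have hS0 : 0 ≤ S := by positivity
  have hsup : ∀ x, T ≤ |x| → ‖polyGauss B P x‖ ≤ S := by
    intro x hx
    refine le_of_sq_le_sq ?_ hS0
    rw [hS, mul_pow, Real.sq_sqrt (by positivity), div_mul_eq_mul_div, le_div_iff₀ hT]
    have h1 := abs_mul_polyGauss_norm_sq_le hB P x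
    have h2 : ‖polyToL2 hB P‖ ^ 2 ≤ e ^ 2 := by gcongr
    have h3 := mul_le_mul n2 n1 (norm_nonneg _) (by positivity)
    have h4 : ‖polyGauss B P x‖ ^ 2 * T ≤ |x| * ‖polyGauss B P x‖ ^ 2 := by
      rw [mul_comm]; gcongr
    calc _ ≤ _ := h4
      _ ≤ _ := h1
      _ ≤ e ^ 2 + 2 * (B⁻¹ * e * e) := by linarith
      _ = _ := by rw [div_eq_mul_inv]; ring
  have hf0 : MemLp (fun x => |f x| * S) 2 volume := h.memLp.abs.mul_const S
  have hb : ∀ᵐ x, ‖(v x : ℂ) * polyGauss B P x‖ ≤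
      δ * ‖polyGauss B P x‖ + |f x| * S + c / T * ‖polyGauss B (X * P) x‖ := by
    filter_upwards [hloc, h.bound] with x h1 h2
    rw [norm_mul, Complex.norm_real, Real.norm_eq_abs]
    have hn := norm_nonneg (polyGauss B P x)
    have hc := h.nonneg
    rcases lt_or_ge |x| T with hx | hx
    · have := mul_le_mul_of_nonneg_right (h1 hx) hn
      have h5 : 0 ≤ |f x| * S := by positivity
      have h6 : 0 ≤ c / T * ‖polyGauss B (X * P) x‖ := by positivity
      linarith
    · have h3 := mul_le_mul_of_nonneg_right h2 hn
      have h4 := mul_le_mul_of_nonneg_left (hsup x hx) (abs_nonneg (f x))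
      have h5 : c * ‖polyGauss B P x‖ ≤ c / T * ‖polyGauss B (X * P) x‖ := by
        rw [polyGauss_X_mul, norm_mul, Complex.norm_real, Real.norm_eq_abs]
        calc c * ‖polyGauss B P x‖ = c / T * (T * ‖polyGauss B P x‖) := by field_simp
          _ ≤ _ := by gcongr
      have h6 : 0 ≤ δ * ‖polyGauss B P x‖ := by positivity
      linarith
  have m1 : MemLp (fun x => δ * ‖polyGauss B P x‖) 2 volume :=
    (memLp_polyGauss hB P).norm.const_mul δ
  have m3 : MemLp (fun x => c / T * ‖polyGauss B (X * P) x‖) 2 volume :=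
    (memLp_polyGauss hB (X * P)).norm.const_mul (c / T)
  have nrm : ∀ (a : ℝ), 0 ≤ a → ∀ (Q : ℂ[X]) (hm : MemLp (fun x => a * ‖polyGauss B Q x‖) 2 volume),
      ‖hm.toLp _‖ = a * ‖polyToL2 hB Q‖ := by
    intro a ha Q hm
    rw [Lp.norm_toLp, show ‖polyToL2 hB Q‖ = (eLpNorm (polyGauss B Q) 2 volume).toReal from
      Lp.norm_toLp _ (memLp_polyGauss hB Q)]
    have h1 := eLpNorm_const_smul a (fun x => ‖polyGauss B Q x‖) 2 (volume : Measure ℝ)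
    rw [eLpNorm_norm] at h1
    rw [show (fun x => a * ‖polyGauss B Q x‖) = a • fun x => ‖polyGauss B Q x‖ from rfl, h1,
      ENNReal.toReal_mul]
    simp [abs_of_nonneg ha]
  have nf : ‖hf0.toLp _‖ = (eLpNorm f 2 volume).toReal * S := by
    rw [Lp.norm_toLp]
    have h1 := eLpNorm_const_smul S (fun x => ‖f x‖) 2 (volume : Measure ℝ)
    rw [eLpNorm_norm] at h1
    rw [show (fun x => |f x| * S) = S • fun x => ‖f x‖ from by
      funext x; simp [mul_comm], h1, ENNReal.toReal_mul, mul_comm]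
    simp [abs_of_nonneg hS0]
  have key : ‖polyPot hB h P‖ ≤ ‖((m1.add hf0).add m3).toLp _‖ := by
    refine Lp.norm_le_norm_of_ae_le ?_
    filter_upwards [hb, coeFn_polyPot hB h P, ((m1.add hf0).add m3).coeFn_toLp] with x h1 h2 h3
    rw [h2, h3]
    exact h1.trans (le_abs_self _)
  rw [MemLp.toLp_add (m1.add hf0) m3, MemLp.toLp_add m1 hf0] at key
  refine key.trans (norm_add₃_le.trans ?_)
  rw [nrm δ hδ P m1, nrm (c / T) (div_nonneg h.nonneg hT.le) (X * P) m3, nf]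
  have h7 := mul_le_mul_of_nonneg_left n2 (div_nonneg h.nonneg hT.le)
  have h8 := mul_le_mul_of_nonneg_left n0 hδ
  have h9 : c / T * (B⁻¹ * e) = c / (B * T) * e := by field_simp
  rw [h9] at h7
  rw [hS]
  linarith

theorem norm_potInv_le_of_local (hB : 0 < B) (h : SquareBounded v f c) {M δ T : ℝ} (hM : 1 ≤ M)
    (hδ : 0 ≤ δ) (hT : 0 < T) (hloc : ∀ᵐ x, |x| < T → |v x| ≤ δ) :
    ‖potInv hB h M‖ ≤ δ + (eLpNorm f 2 volume).toReal * √((1 + 2 / B) / T) + c / (B * T) :=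
  LinearMap.opNorm_extendOfNorm_le (denseRange_oscShift hB (by linarith))
    (by have := h.nonneg; positivity) (norm_polyPot_le_of_local hB h hM hδ hT hloc)

theorem SquareBounded.sub_const (h : SquareBounded v f c) (a : ℝ) :
    SquareBounded (fun x => v x - a) f (c + |a|) where
  meas := h.meas.sub aestronglyMeasurable_const
  memLp := h.memLp
  bound := by
    filter_upwards [h.bound] with x hx
    have := abs_sub (v x) a
    linarith
  nonneg := add_nonneg h.nonneg (abs_nonneg a)

/-- `‖fiberPert‖ ≤ 1/2` bounds the Neumann series by `2`, and the oscillator resolvent has norm at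
most `1`. -/
theorem norm_fiberRes_le (hB : 0 < B) (h : SquareBounded v f c) {M L : ℝ}
    (hM : shiftBound f c L ≤ M) {p : ℂ} (hp : ‖p‖ ≤ L) : ‖fiberRes hB h M p‖ ≤ 2 := by
  have hu := isUnit_one_add_fiberPert hB h hM hp
  have h1 : 1 ≤ M := (one_le_shiftBound f c L).trans hM
  refine ContinuousLinearMap.opNorm_le_bound _ zero_le_two fun g => ?_
  set g' := Ring.inverse (1 + fiberPert hB h M p) g with hg'
  have h3 := congrArg (fun T : L2R →L[ℂ] L2R => T g) (Ring.mul_inverse_cancel _ hu)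
  simp only [mul_apply_eq_comp, add_apply, one_apply_eq_self] at h3
  have h4 : ‖g'‖ ≤ ‖g‖ + ‖fiberPert hB h M p g'‖ := by
    have : g' = g - fiberPert hB h M p g' := by rw [← h3, add_sub_cancel_right]
    calc ‖g'‖ = ‖g - fiberPert hB h M p g'‖ := by rw [← this]
      _ ≤ _ := norm_sub_le _ _
  have h5 := (fiberPert hB h M p).le_of_opNorm_le (norm_fiberPert_le_half hB h hM hp) g'
  have h6 := (oscInv hB M).le_of_opNorm_le ((norm_oscInv_le hB h1).trans
    (inv_le_one_of_one_le₀ (Real.one_le_sqrt.2 h1))) g'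
  change ‖oscInv hB M g'‖ ≤ _
  linarith

/-- Second resolvent identity for `h_v(0) + M = (H + (M + a)) + (v - a)` with `H` the oscillator:
the asymptotic value `a` of the potential goes into the shift. -/
theorem fiberRes_sub_oscInv (hB : 0 < B) (h : SquareBounded v f c) {M a : ℝ}
    (hM : shiftBound f c 0 ≤ M) (ha : 1 ≤ M + a) :
    oscInv hB (M + a) - fiberRes hB h M 0 =
      fiberRes hB h M 0 * potInv hB (h.sub_const a) (M + a) := by
  have hinv := isInverseOf_fiberRes hB h hM (p := 0) (by simp)
  have hcl : IsClosed ((fiberOp B v 0).graph : Set (L2R × L2R)) := by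
    rw [h.fiberOp_graph]; exact Submodule.isClosed_topologicalClosure _
  have hmem : ∀ g, (oscInv hB (M + a) g, g + potInv hB (h.sub_const a) (M + a) g -
      (M : ℂ) • oscInv hB (M + a) g) ∈ (fiberOp B v 0).graph := by
    intro g
    have hc : IsClosed {g : L2R | (oscInv hB (M + a) g, g + potInv hB (h.sub_const a) (M + a) g -
      (M : ℂ) • oscInv hB (M + a) g) ∈ ((fiberOp B v 0).graph : Set (L2R × L2R))} :=
      hcl.preimage (by fun_prop)
    refine (denseRange_oscShift hB (M := M + a) (by linarith)).induction_on
      (p := fun g => (oscInv hB (M + a) g, g + potInv hB (h.sub_const a) (M + a) g -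
      (M : ℂ) • oscInv hB (M + a) g) ∈ ((fiberOp B v 0).graph : Set (L2R × L2R))) g hc fun P => ?_
    rw [oscInv_oscShift hB ha, potInv_oscShift hB _ ha]
    have h1 := fiberPoly_mem hB h 0 P
    have h2 : polyPot hB (h.sub_const a) P = polyPot hB h P - (a : ℂ) • polyToL2 hB P := by
      refine Lp.ext ?_
      filter_upwards [coeFn_polyPot hB (h.sub_const a) P, coeFn_polyPot hB h P,
        coeFn_polyToL2 hB P, Lp.coeFn_sub (polyPot hB h P) ((a : ℂ) • polyToL2 hB P),
        Lp.coeFn_smul (a : ℂ) (polyToL2 hB P)] with x e1 e2 e3 e4 e5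
      rw [e1, e4, Pi.sub_apply, e2, e5, Pi.smul_apply, e3, smul_eq_mul]
      push_cast; ring
    have h3 : oscShift hB (M + a) P + polyPot hB (h.sub_const a) P - (M : ℂ) • polyToL2 hB P =
        fiberPoly hB h (0 : ℝ) P := by
      rw [h2, oscShift_apply, fiberPoly]
      push_cast
      module
    rw [h3]
    exact h1
  ext1 g
  have h1 := (hinv _ _).1 (hmem g)
  rw [sub_add_cancel, map_add, Complex.ofReal_zero] at h1
  rw [sub_apply, mul_apply_eq_comp, ← h1, add_sub_cancel_left]

/-- The eigenvalues of the fiber operators converge to the shifted Landau levels. -/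
theorem tendsto_eigenvalue (hB : 0 < B) (h : SquareBounded v f c) {ε : ℝ → ℕ → ℝ}
    {b : ℝ → HilbertBasis ℕ ℂ L2R} (hE : ∀ p, EigenSystem (fiberOp B v p) (ε p) (b p))
    {l : Filter ℝ} {a : ℝ} (hl : ∀ δ > 0, ∀ T, ∀ᶠ p in l, ∀ x, |x| < T → |v (x - p / B) - a| ≤ δ)
    (n : ℕ) : Tendsto (fun p => ε p n) l (𝓝 (a + landauLevel B n)) := by
  -- The second entry guarantees `M + a ≥ 1`, as the oscillator estimates require.
  set M := max (shiftBound f c 0) (1 + |a|) with hMdef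
  have hM : shiftBound f c 0 ≤ M := le_max_left _ _
  have hMa : 1 ≤ M + a := by
    have := le_max_right (shiftBound f c 0) (1 + |a|)
    have := neg_abs_le a
    linarith
  -- The shift depends on `f` only through its norm, which is translation invariant; a single `M`
  -- therefore serves all `p`.
  have hsb : ∀ p, shiftBound (fun x => f (x - p / B)) c 0 = shiftBound f c 0 := fun p => by
    simp only [shiftBound, eLpNorm_translate h.memLp.1]
  have hMp : ∀ p, shiftBound (fun x => f (x - p / B)) c 0 ≤ M := fun p => by rw [hsb]; exact hM
  have hw : ∀ p, SquareBounded _ _ c := fun p => h.translate (p / B)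
  set K : ℝ → L2R →L[ℂ] L2R := fun p => fiberRes hB (hw p) M 0 with hK
  have hpos : ∀ p n, 0 < ε p n + M := by
    intro p n
    have h1 := (hE p).translate hB h
    have h2 := neg_shiftBound_lt hB (hw p) (L := 0) (by simp) (h1.mem n)
      ((mapBasis (b p) _).orthonormal.ne_zero n)
    have := hMp p
    linarith
  have hmain : ∀ p n, |(ε p n + M)⁻¹ - (landauLevel B n + (M + a))⁻¹| ≤
      2 * ‖potInv hB ((hw p).sub_const a) (M + a)‖ := by
    intro p n
    have hEp := (hE p).translate hB h
    have hs := (hw p).symmGraph_fiberOp (B := B) 0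
    have hinv := isInverseOf_fiberRes hB (hw p) (hMp p) (p := 0) (by simp)
    have hbK : ∀ n, K p (mapBasis (b p) (translationEquiv (p / B)) n) =
        (((ε p n + M)⁻¹ : ℝ) : ℂ) • mapBasis (b p) (translationEquiv (p / B)) n := by
      intro n
      have h1 := (hinv.eigen_iff _ _).1 (hEp.mem n)
      have h2 : (ε p n : ℂ) + M ≠ 0 := by exact_mod_cast (hpos p n).ne'
      conv_rhs => rw [← h1]
      rw [smul_smul]
      push_cast
      rw [inv_mul_cancel₀ h2, one_smul]
    refine (abs_eigenvalue_sub_le (fun x y => hinv.inner_comm hs x y) (oscInv_inner_comm hB hMa)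
      (μ := fun n => (ε p n + M)⁻¹) (ν := fun n => (landauLevel B n + (M + a))⁻¹) ?_ ?_
      hbK (oscInv_hermBasis hB hMa) n).trans ?_
    · intro i j hij
      exact inv_anti₀ (hpos p i) (by simpa using (hE p).strictMono.monotone hij)
    · intro i j hij
      exact inv_anti₀ (by have := landauLevel_pos hB i; linarith)
        (by simpa using (landauLevel_strictMono hB).monotone hij)
    · rw [norm_sub_rev, Complex.ofReal_zero, fiberRes_sub_oscInv hB (hw p) (hMp p) hMa]
      refine (norm_mul_le _ _).trans ?_
      exact mul_le_mul_of_nonneg_right (norm_fiberRes_le hB (hw p) (hMp p) (by simp)) (norm_nonneg _)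
  have hpot : Tendsto (fun p => ‖potInv hB ((hw p).sub_const a) (M + a)‖) l (𝓝 0) := by
    rw [Metric.tendsto_nhds]
    intro r hr
    -- The bound of `norm_potInv_le_of_local` with `δ = r / 2` tends to `r / 2 < r` as `T → ∞`; such
    -- a `T` is fixed before `p` goes to its limit.
    have hT : Tendsto (fun T : ℝ => r / 2 + (eLpNorm f 2 volume).toReal * √((1 + 2 / B) / T) +
        (c + |a|) / (B * T)) atTop (𝓝 (r / 2 + (eLpNorm f 2 volume).toReal * √0 + 0)) := by
      refine ((tendsto_const_nhds.add (Tendsto.const_mul _ ((Real.continuous_sqrt.tendsto 0).comp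
        (tendsto_const_nhds.div_atTop tendsto_id)))).add
        (tendsto_const_nhds.div_atTop (tendsto_id.const_mul_atTop hB)))
    rw [Real.sqrt_zero, mul_zero, add_zero, add_zero] at hT
    obtain ⟨T, hTr, hT0⟩ := ((hT.eventually (gt_mem_nhds (half_lt_self hr))).and
      (eventually_gt_atTop 0)).exists
    filter_upwards [hl (r / 2) (half_pos hr) T] with p hp
    rw [dist_zero_right, norm_norm]
    refine (norm_potInv_le_of_local hB ((hw p).sub_const a) hMa (half_pos hr).le hT0
      (Eventually.of_forall hp)).trans_lt ?_
    rw [eLpNorm_translate h.memLp.1]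
    exact hTr
  have hinvlim : Tendsto (fun p => (ε p n + M)⁻¹) l (𝓝 (landauLevel B n + (M + a))⁻¹) := by
    rw [tendsto_iff_norm_sub_tendsto_zero]
    exact squeeze_zero (fun _ => norm_nonneg _) (fun p => hmain p n)
      (by simpa using hpot.const_mul 2)
  have hne : (landauLevel B n + (M + a))⁻¹ ≠ 0 :=
    inv_ne_zero (by have := landauLevel_pos hB n; linarith)
  have h2 := (hinvlim.inv₀ hne).sub_const M
  simp only [inv_inv] at h2
  convert h2 using 2
  · ring
  · ring

/-- The eigenvalues and the eigenprojections of the fiber operators are analytic, resp. continuous. -/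
theorem analyticAt_eigenvalue (hB : 0 < B) (h : SquareBounded v f c) {ε : ℝ → ℕ → ℝ}
    {b : ℝ → HilbertBasis ℕ ℂ L2R} (hE : ∀ p, EigenSystem (fiberOp B v p) (ε p) (b p)) (p₀ : ℝ)
    (n : ℕ) : AnalyticAt ℝ (fun p => ε p n) p₀ ∧
      ContinuousAt (fun p => InnerProductSpace.rankOne ℂ (b p n) (b p n)) p₀ := by
  have hev : ∀ᶠ p in 𝓝 p₀, |p| ≤ |p₀| + 1 := by
    have h1 : Tendsto (fun p : ℝ => |p|) (𝓝 p₀) (𝓝 |p₀|) := continuous_abs.tendsto p₀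
    filter_upwards [h1.eventually (gt_mem_nhds (lt_add_one _))] with p hp using hp.le
  refine EigenSystem.analyticAt (M := shiftBound f c (|p₀| + 1))
    (K := fiberRes hB h (shiftBound f c (|p₀| + 1)))
    (fun p => h.symmGraph_fiberOp p) hE (analyticAt_fiberRes hB h le_rfl (by simp))
    (isCompactOperator_fiberRes hB h (one_le_shiftBound _ _ _) _) ?_ ?_ n
  · filter_upwards [hev] with p hp using isInverseOf_fiberRes hB h le_rfl hp
  · filter_upwards [hev] with p hp n
    have := neg_shiftBound_lt hB h hp ((hE p).mem n) ((b p).orthonormal.ne_zero n)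
    linarith

/-! ### The class of potentials -/

/-- Outside a large interval `v` is within `1` of its limits, hence bounded; inside it is square
integrable. Take for `f` the restriction of `v` to that interval. -/
theorem CondV1.exists_squareBounded (hv : CondV1 v) {vplus vminus : ℝ}
    (hplus : Tendsto v atTop (𝓝 vplus)) (hminus : Tendsto v atBot (𝓝 vminus)) :
    ∃ f c, SquareBounded v f c := by
  obtain ⟨h1, F, G, hF, hG, hFG⟩ := hv
  have hdec : ∀ x, v x = max (v x) 0 - max (-v x) 0 := by
    intro x
    rcases le_total (v x) 0 with h | h
    · rw [max_eq_right h, max_eq_left (by linarith)]; ring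
    · rw [max_eq_left h, max_eq_right (by linarith)]; ring
  have hloc : ∀ R : ℝ, MemLp v 2 (volume.restrict (Icc (-R) R)) := by
    intro R
    have h2 : MemLp (fun x => F x + G x) 2 (volume.restrict (Icc (-R) R)) :=
      (hF.restrict _).add ((hG.restrict _).mono_exponent le_top)
    have h3 : MemLp (fun x => max (-v x) 0) 2 (volume.restrict (Icc (-R) R)) :=
      h2.ae_eq (ae_restrict_of_ae (hFG.mono fun x hx => hx.symm))
    exact ((h1 _ isCompact_Icc).sub h3).ae_eq (Eventually.of_forall fun x => (hdec x).symm)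
  have hmeas : AEStronglyMeasurable v volume := by
    have hU : (⋃ n : ℕ, Icc (-(n : ℝ)) n) = univ := by
      refine eq_univ_of_forall fun x => mem_iUnion.2 ?_
      obtain ⟨n, hn⟩ := exists_nat_ge |x|
      exact ⟨n, abs_le.1 hn⟩
    rw [← Measure.restrict_univ (μ := (volume : Measure ℝ)), ← hU]
    exact aestronglyMeasurable_iUnion_iff.2 fun n => (hloc n).1
  obtain ⟨R₁, hR₁⟩ := eventually_atTop.1 (hplus.eventually (Metric.ball_mem_nhds vplus one_pos))
  obtain ⟨R₂, hR₂⟩ := eventually_atBot.1 (hminus.eventually (Metric.ball_mem_nhds vminus one_pos))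
  set R := max R₁ (-R₂) with hR
  set c := max (|vplus| + 1) (|vminus| + 1) with hc
  have hc0 : 0 ≤ c := le_trans (by positivity) (le_max_left _ _)
  refine ⟨(Icc (-R) R).indicator v, c, hmeas, (memLp_indicator_iff_restrict measurableSet_Icc).2
    (hloc R), Eventually.of_forall fun x => ?_, hc0⟩
  by_cases hx : x ∈ Icc (-R) R
  · rw [indicator_of_mem hx]; linarith
  · rw [indicator_of_notMem hx, abs_zero, zero_add]
    rw [mem_Icc, not_and_or, not_le, not_le] at hx
    rcases hx with hx | hx
    · have h2 : dist (v x) vminus < 1 := hR₂ x (by linarith [le_max_right R₁ (-R₂)])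
      rw [Real.dist_eq] at h2
      have h3 := abs_sub_abs_le_abs_sub (v x) vminus
      exact le_trans (by linarith) (le_max_right _ _)
    · have h2 : dist (v x) vplus < 1 := hR₁ x (by linarith [le_max_left R₁ (-R₂)])
      rw [Real.dist_eq] at h2
      have h3 := abs_sub_abs_le_abs_sub (v x) vplus
      exact le_trans (by linarith) (le_max_left _ _)

/-- For bounded `x`, `x - p / B → +∞` as `p → -∞`, so the limit at `+∞` belongs to `p → -∞`. -/
theorem eventually_atBot_translate (hB : 0 < B) {a : ℝ} (hv : Tendsto v atTop (𝓝 a)) :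
    ∀ δ > 0, ∀ T, ∀ᶠ p in atBot, ∀ x, |x| < T → |v (x - p / B) - a| ≤ δ := by
  intro δ hδ T
  obtain ⟨R, hR⟩ := eventually_atTop.1 (hv.eventually (Metric.ball_mem_nhds a hδ))
  filter_upwards [eventually_le_atBot (-(B * (R + T)))] with p hp x hx
  have h1 : p / B ≤ -(R + T) := by rw [div_le_iff₀ hB]; linarith
  have h2 : dist (v (x - p / B)) a < δ := hR _ (by linarith [(abs_lt.1 hx).1])
  rw [Real.dist_eq] at h2
  exact h2.le

theorem eventually_atTop_translate (hB : 0 < B) {a : ℝ} (hv : Tendsto v atBot (𝓝 a)) :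
    ∀ δ > 0, ∀ T, ∀ᶠ p in atTop, ∀ x, |x| < T → |v (x - p / B) - a| ≤ δ := by
  intro δ hδ T
  obtain ⟨R, hR⟩ := eventually_atBot.1 (hv.eventually (Metric.ball_mem_nhds a hδ))
  filter_upwards [eventually_ge_atTop (B * (T - R))] with p hp x hx
  have h1 : T - R ≤ p / B := by rw [le_div_iff₀ hB]; linarith
  have h2 : dist (v (x - p / B)) a < δ := hR _ (by linarith [(abs_lt.1 hx).2])
  rw [Real.dist_eq] at h2
  exact h2.le

end

section

local notation "⟪" x ", " y "⟫" => inner ℂ x y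

/-- `L²(ℝ²)`. -/
noncomputable abbrev L2P := Lp ℂ 2 (volume : Measure (ℝ × ℝ))

/-- `L²(ℝ; L²(ℝ))`. -/
noncomputable abbrev L2V := Lp L2R 2 (volume : Measure ℝ)

/-! ### Tensor products -/

theorem memLp_tensor {f g : ℝ → ℂ} (hf : MemLp f 2 volume) (hg : MemLp g 2 volume) :
    MemLp (fun q : ℝ × ℝ => f q.1 * g q.2) 2 volume := by
  have hm : AEStronglyMeasurable (fun q : ℝ × ℝ => f q.1 * g q.2) volume := by
    rw [Measure.volume_eq_prod]
    exact hf.1.comp_fst.mul hg.1.comp_snd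
  rw [memLp_two_iff_integrable_sq_norm hm]
  have h1 := (memLp_two_iff_integrable_sq_norm hf.1).1 hf
  have h2 := (memLp_two_iff_integrable_sq_norm hg.1).1 hg
  have h3 := h1.mul_prod h2
  rw [← Measure.volume_eq_prod] at h3
  refine h3.congr (Eventually.of_forall fun q => ?_)
  simp only [norm_mul, mul_pow]

/-- The function `f(x) g(y)`. -/
noncomputable def tensorFun (f g : L2R) : L2P := (memLp_tensor (Lp.memLp f) (Lp.memLp g)).toLp _

theorem coeFn_tensorFun (f g : L2R) : tensorFun f g =ᵐ[volume] fun q => f q.1 * g q.2 :=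
  (memLp_tensor (Lp.memLp f) (Lp.memLp g)).coeFn_toLp

theorem ae_comp_fst {P : ℝ → Prop} (h : ∀ᵐ x, P x) : ∀ᵐ q : ℝ × ℝ, P q.1 := by
  rw [Measure.volume_eq_prod]; exact Measure.quasiMeasurePreserving_fst.ae h

theorem ae_comp_snd {P : ℝ → Prop} (h : ∀ᵐ x, P x) : ∀ᵐ q : ℝ × ℝ, P q.2 := by
  rw [Measure.volume_eq_prod]; exact Measure.quasiMeasurePreserving_snd.ae h

theorem tensorFun_eq {f g : L2R} {φ γ : ℝ → ℂ} {ψ : ℝ × ℝ → ℂ} (hf : f =ᵐ[volume] φ)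
    (hg : g =ᵐ[volume] γ) (hψ : ∀ q, ψ q = φ q.1 * γ q.2) : tensorFun f g =ᵐ[volume] ψ := by
  filter_upwards [coeFn_tensorFun f g, ae_comp_fst hf, ae_comp_snd hg] with q h1 h2 h3
  rw [h1, h2, h3, hψ]

theorem inner_tensorFun (f g f' g' : L2R) :
    ⟪tensorFun f g, tensorFun f' g'⟫ = ⟪f, f'⟫ * ⟪g, g'⟫ := by
  refine (inner_toLp _ _).trans ?_
  rw [L2.inner_def, L2.inner_def, Measure.volume_eq_prod, ← integral_prod_mul]
  refine integral_congr_ae (Eventually.of_forall fun q => ?_)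
  simp only [map_mul, RCLike.inner_apply]
  ring

theorem norm_tensorFun (f g : L2R) : ‖tensorFun f g‖ = ‖f‖ * ‖g‖ := by
  have h := inner_tensorFun f g f g
  rw [inner_self_eq_norm_sq_to_K, inner_self_eq_norm_sq_to_K, inner_self_eq_norm_sq_to_K,
    ← mul_pow] at h
  have h1 : ‖tensorFun f g‖ ^ 2 = (‖f‖ * ‖g‖) ^ 2 := by exact_mod_cast h
  exact (pow_left_inj₀ (norm_nonneg _) (by positivity) two_ne_zero).1 h1

/-- `(f, g) ↦ f(x) g(y)` as a continuous bilinear map. -/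
noncomputable def tensor : L2R →L[ℂ] L2R →L[ℂ] L2P :=
  LinearMap.mkContinuous₂ (LinearMap.mk₂ ℂ tensorFun
    (fun f f' g => by
      refine Lp.ext ?_
      filter_upwards [coeFn_tensorFun (f + f') g, coeFn_tensorFun f g, coeFn_tensorFun f' g,
        Lp.coeFn_add (tensorFun f g) (tensorFun f' g), ae_comp_fst (Lp.coeFn_add f f')]
        with q h1 h2 h3 h4 h5
      rw [h1, h4, Pi.add_apply, h2, h3, h5, Pi.add_apply, add_mul])
    (fun a f g => by
      refine Lp.ext ?_
      filter_upwards [coeFn_tensorFun (a • f) g, coeFn_tensorFun f g,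
        Lp.coeFn_smul a (tensorFun f g), ae_comp_fst (Lp.coeFn_smul a f)] with q h1 h2 h4 h5
      rw [h1, h4, Pi.smul_apply, h2, h5, Pi.smul_apply, smul_mul_assoc])
    (fun f g g' => by
      refine Lp.ext ?_
      filter_upwards [coeFn_tensorFun f (g + g'), coeFn_tensorFun f g, coeFn_tensorFun f g',
        Lp.coeFn_add (tensorFun f g) (tensorFun f g'), ae_comp_snd (Lp.coeFn_add g g')]
        with q h1 h2 h3 h4 h5
      rw [h1, h4, Pi.add_apply, h2, h3, h5, Pi.add_apply, mul_add])
    (fun a f g => by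
      refine Lp.ext ?_
      filter_upwards [coeFn_tensorFun f (a • g), coeFn_tensorFun f g,
        Lp.coeFn_smul a (tensorFun f g), ae_comp_snd (Lp.coeFn_smul a g)] with q h1 h2 h4 h5
      rw [h1, h4, Pi.smul_apply, h2, h5, Pi.smul_apply, mul_smul_comm]))
    1 fun f g => by rw [one_mul]; exact (norm_tensorFun f g).le

theorem tensor_apply (f g : L2R) : tensor f g = tensorFun f g := rfl

/-- A locally integrable function whose integrals over rectangles vanish is zero. -/
theorem ae_eq_zero_of_integral_rectangle {ψ : ℝ × ℝ → ℂ} (hψ : LocallyIntegrable ψ)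
    (h : ∀ (R : ℝ) (s t : Set ℝ), MeasurableSet s → MeasurableSet t → s ⊆ Icc (-R) R →
      t ⊆ Icc (-R) R → ∫ q in s ×ˢ t, ψ q = 0) : ψ =ᵐ[volume] 0 := by
  have hbox : ∀ R : ℝ, ψ =ᵐ[volume.restrict (Icc (-R) R ×ˢ Icc (-R) R)] 0 := by
    intro R
    set Q := Icc (-R) R ×ˢ Icc (-R) R with hQ
    have hQm : MeasurableSet Q := measurableSet_Icc.prod measurableSet_Icc
    have hi : IntegrableOn ψ Q := hψ.integrableOn_isCompact (isCompact_Icc.prod isCompact_Icc)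
    -- Rectangles form a π-system generating the product σ-algebra, and the sets with vanishing
    -- integral over the box form a λ-system.
    have key : ∀ S : Set (ℝ × ℝ), MeasurableSet S → ∫ q in S ∩ Q, ψ q = 0 := by
      intro S hS
      induction S, hS using MeasurableSpace.induction_on_inter generateFrom_prod.symm isPiSystem_prod with
      | empty => simp
      | basic S hS =>
        obtain ⟨s, hs, t, ht, rfl⟩ := hS
        rw [prod_inter_prod]
        exact h R _ _ (MeasurableSet.inter hs measurableSet_Icc)
          (MeasurableSet.inter ht measurableSet_Icc) inter_subset_right inter_subset_right
      | compl S hS ih =>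
        have h1 : Q \ (S ∩ Q) = Sᶜ ∩ Q := by ext q; simp; tauto
        rw [← h1, setIntegral_sdiff (hS.inter hQm) hi inter_subset_right, ih, sub_zero]
        exact h R _ _ measurableSet_Icc measurableSet_Icc subset_rfl subset_rfl
      | iUnion F hd hF ih =>
        rw [iUnion_inter]
        refine (integral_iUnion (fun i => (hF i).inter hQm) ?_ (hi.mono_set ?_)).trans ?_
        · exact fun i j hij => (hd hij).mono inter_subset_left inter_subset_left
        · exact iUnion_subset fun i => inter_subset_right
        · simp [ih]
    refine Integrable.ae_eq_zero_of_forall_setIntegral_eq_zero hi fun S hS _ => ?_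
    rw [Measure.restrict_restrict hS]
    exact key S hS
  have hU : (⋃ n : ℕ, Icc (-(n : ℝ)) n ×ˢ Icc (-(n : ℝ)) n) = (univ : Set (ℝ × ℝ)) := by
    refine eq_univ_of_forall fun q => mem_iUnion.2 ?_
    obtain ⟨n, hn⟩ := exists_nat_ge (max |q.1| |q.2|)
    exact ⟨n, abs_le.1 ((le_max_left _ _).trans hn), abs_le.1 ((le_max_right _ _).trans hn)⟩
  rw [← Measure.restrict_univ (μ := (volume : Measure (ℝ × ℝ))), ← hU]
  exact ae_restrict_iUnion_iff _ _ |>.2 fun n => hbox n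

/-- Products of indicators of bounded sets are tensors, so all integrals over rectangles vanish. -/
theorem eq_zero_of_inner_tensor {ψ : L2P} (h : ∀ f g : L2R, ⟪tensor f g, ψ⟫ = 0) : ψ = 0 := by
  rw [Lp.eq_zero_iff_ae_eq_zero]
  refine ae_eq_zero_of_integral_rectangle ((Lp.memLp ψ).locallyIntegrable (by norm_num)) ?_
  intro R s t hs ht hsR htR
  have fs : volume s ≠ ⊤ := ((measure_mono hsR).trans_lt measure_Icc_lt_top).ne
  have ft : volume t ≠ ⊤ := ((measure_mono htR).trans_lt measure_Icc_lt_top).ne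
  rw [← h (indicatorConstLp 2 hs fs 1) (indicatorConstLp 2 ht ft 1), L2.inner_def,
    ← integral_indicator (hs.prod ht)]
  refine integral_congr_ae ?_
  filter_upwards [tensorFun_eq (f := indicatorConstLp 2 hs fs (1 : ℂ))
    (g := indicatorConstLp 2 ht ft (1 : ℂ)) indicatorConstLp_coeFn indicatorConstLp_coeFn
    (ψ := (s ×ˢ t).indicator fun _ => 1) (fun q => by
      by_cases h1 : q.1 ∈ s <;> by_cases h2 : q.2 ∈ t <;> simp [indicator, h1, h2])] with q hq
  rw [tensor_apply, hq]
  by_cases hqs : q ∈ s ×ˢ t <;> simp [hqs]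

theorem continuousLinearMap_ext_hilbertBasis {E F ι : Type*} [NormedAddCommGroup E]
    [InnerProductSpace ℂ E] [NormedAddCommGroup F] [NormedSpace ℂ F] (b : HilbertBasis ι ℂ E)
    {S T : E →L[ℂ] F} (h : ∀ n, S (b n) = T (b n)) : S = T := by
  refine ContinuousLinearMap.ext_on (s := range b) ?_ ?_
  · rw [Submodule.dense_iff_topologicalClosure_eq_top]; exact b.dense_span
  · rintro _ ⟨n, rfl⟩; exact h n

/-- The products of the elements of a Hilbert basis of `L²(ℝ)`. -/
noncomputable def tensorBasis (b : HilbertBasis ℕ ℂ L2R) : HilbertBasis (ℕ × ℕ) ℂ L2P :=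
  HilbertBasis.mkOfOrthogonalEqBot (v := fun i : ℕ × ℕ => tensor (b i.1) (b i.2))
    (by
      rw [orthonormal_iff_ite]
      rintro ⟨i, j⟩ ⟨k, l⟩
      rw [tensor_apply, tensor_apply, inner_tensorFun, orthonormal_iff_ite.1 b.orthonormal,
        orthonormal_iff_ite.1 b.orthonormal]
      by_cases h1 : i = k <;> by_cases h2 : j = l <;> simp [h1, h2])
    (by
      rw [Submodule.eq_bot_iff]
      intro ψ hψ
      have h0 : ∀ i j, ⟪ψ, tensor (b i) (b j)⟫ = 0 := fun i j =>
        (Submodule.mem_orthogonal' _ _).1 hψ _ (Submodule.subset_span ⟨(i, j), rfl⟩)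
      have h1 : ∀ j f, ⟪ψ, tensor f (b j)⟫ = 0 := by
        intro j f
        have h2 : (innerSL ℂ ψ).comp (tensor.flip (b j)) = 0 :=
          continuousLinearMap_ext_hilbertBasis b fun i => h0 i j
        exact congrArg (fun T : L2R →L[ℂ] ℂ => T f) h2
      refine eq_zero_of_inner_tensor fun f g => ?_
      have h3 : (innerSL ℂ ψ).comp (tensor f) = 0 :=
        continuousLinearMap_ext_hilbertBasis b fun j => h1 j f
      have h4 : ⟪ψ, tensor f g⟫ = 0 := congrArg (fun T : L2R →L[ℂ] ℂ => T g) h3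
      rw [← inner_conj_symm, h4, map_zero])

theorem tensorBasis_apply (b : HilbertBasis ℕ ℂ L2R) (i : ℕ × ℕ) :
    tensorBasis b i = tensor (b i.1) (b i.2) := by
  simp [tensorBasis]

/-! ### The partial Fourier transform -/

/-- The function `ξ ↦ g(ξ) f`. -/
noncomputable def smulFun (f g : L2R) : L2V := (ContinuousLinearMap.toSpanSingleton ℂ f).compLp g

theorem coeFn_smulFun (f g : L2R) : smulFun f g =ᵐ[volume] fun ξ => g ξ • f := by
  filter_upwards [(ContinuousLinearMap.toSpanSingleton ℂ f).coeFn_compLp g] with ξ h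
  rw [smulFun, h, ContinuousLinearMap.toSpanSingleton_apply]

theorem inner_smulFun_right (Φ : L2V) (f g : L2R) : ⟪Φ, smulFun f g⟫ = ∫ ξ, g ξ * ⟪Φ ξ, f⟫ := by
  rw [L2.inner_def]
  refine integral_congr_ae ?_
  filter_upwards [coeFn_smulFun f g] with ξ h
  rw [h, inner_smul_right]

theorem inner_smulFun (f g f' g' : L2R) : ⟪smulFun f g, smulFun f' g'⟫ = ⟪f, f'⟫ * ⟪g, g'⟫ := by
  rw [inner_smulFun_right, L2.inner_def g g', ← integral_const_mul]
  refine integral_congr_ae ?_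
  filter_upwards [coeFn_smulFun f g] with ξ h
  rw [h, inner_smul_left, RCLike.inner_apply]
  ring

/-- `(f, g) ↦ (ξ ↦ g(ξ) f)` as a continuous bilinear map. -/
noncomputable def smulL2 : L2R →L[ℂ] L2R →L[ℂ] L2V :=
  LinearMap.mkContinuous₂ (LinearMap.mk₂ ℂ smulFun
    (fun f f' g => by
      rw [smulFun, ContinuousLinearMap.toSpanSingleton_add, ContinuousLinearMap.add_compLp]; rfl)
    (fun a f g => by
      rw [smulFun, ContinuousLinearMap.toSpanSingleton_smul, ContinuousLinearMap.smul_compLp]; rfl)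
    (fun f g g' => ((ContinuousLinearMap.toSpanSingleton ℂ f).compLpₗ 2 volume).map_add g g')
    (fun a f g => ((ContinuousLinearMap.toSpanSingleton ℂ f).compLpₗ 2 volume).map_smul a g))
    1 fun f g => by
      rw [one_mul]
      refine (ContinuousLinearMap.norm_compLp_le _ _).trans ?_
      rw [ContinuousLinearMap.norm_toSpanSingleton]

/-- The Fourier transform on `L²(ℝ)`. -/
noncomputable abbrev fourierL2 : L2R ≃ₗᵢ[ℂ] L2R := Lp.fourierTransformₗᵢ ℝ ℂ

/-- An orthonormal family indexed like a basis of `L²(ℝ²)` is enough for an isometric embedding; the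
decomposition below relies on isometry alone. -/
theorem orthonormal_smulFun (b : HilbertBasis ℕ ℂ L2R) :
    Orthonormal ℂ fun i : ℕ × ℕ => smulFun (b i.1) (fourierL2 (b i.2)) := by
  rw [orthonormal_iff_ite]
  rintro ⟨i, j⟩ ⟨k, l⟩
  rw [inner_smulFun, LinearIsometryEquiv.inner_map_map, orthonormal_iff_ite.1 b.orthonormal,
    orthonormal_iff_ite.1 b.orthonormal]
  by_cases h1 : i = k <;> by_cases h2 : j = l <;> simp [h1, h2]

/-- The Fourier transform in the second variable, as a map from `L²(ℝ²)` to `L²(ℝ; L²(ℝ))`. -/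
noncomputable def partialFourier : L2P →ₗᵢ[ℂ] L2V :=
  (orthonormal_smulFun (hermBasis one_pos)).orthogonalFamily.linearIsometry.comp
    (tensorBasis (hermBasis one_pos)).repr.toLinearIsometry

/-- True on Hermite products by construction; both sides are continuous and linear in each factor
separately. -/
theorem partialFourier_tensor (f g : L2R) :
    partialFourier (tensor f g) = smulFun f (fourierL2 g) := by
  set b := hermBasis one_pos
  have h0 : ∀ i j, partialFourier (tensor (b i) (b j)) = smulFun (b i) (fourierL2 (b j)) := by
    intro i j
    rw [← tensorBasis_apply b (i, j)]
    simp only [partialFourier, LinearIsometry.coe_comp, Function.comp_apply,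
      LinearIsometryEquiv.coe_toLinearIsometry]
    rw [HilbertBasis.repr_self, OrthogonalFamily.linearIsometry_apply_single]
    simp [LinearIsometry.toSpanSingleton_apply, b]
  have h1 : ∀ j f, partialFourier (tensor f (b j)) = smulFun f (fourierL2 (b j)) := by
    intro j f
    have h2 : partialFourier.toContinuousLinearMap.comp (tensor.flip (b j)) =
        smulL2.flip (fourierL2 (b j)) :=
      continuousLinearMap_ext_hilbertBasis b fun i => h0 i j
    exact congrArg (fun T : L2R →L[ℂ] L2V => T f) h2
  have h3 : partialFourier.toContinuousLinearMap.comp (tensor f) =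
      (smulL2 f).comp (fourierL2 : L2R →L[ℂ] L2R) :=
    continuousLinearMap_ext_hilbertBasis b fun j => h1 j f
  exact congrArg (fun T : L2R →L[ℂ] L2V => T g) h3

/-- This is how functions on the plane are tested fiber by fiber. -/
theorem inner_tensor_right (ψ : L2P) (f g : L2R) :
    ⟪ψ, tensor f g⟫ = ∫ ξ, fourierL2 g ξ * ⟪partialFourier ψ ξ, f⟫ := by
  rw [← partialFourier.inner_map_map, partialFourier_tensor, inner_smulFun_right]

end

section

local notation "⟪" x ", " y "⟫" => inner ℂ x y

open Polynomial

variable {B : ℝ} {v : ℝ → ℝ}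

/-! ### Symmetry of the Landau operator -/

theorem fderiv_star_mul {φ χ : ℝ × ℝ → ℂ} (hφ : ContDiff ℝ ∞ φ) (hχ : ContDiff ℝ ∞ χ)
    (q w : ℝ × ℝ) : fderiv ℝ (fun q => (starRingEnd ℂ) (φ q) * χ q) q w =
      (starRingEnd ℂ) (fderiv ℝ φ q w) * χ q + (starRingEnd ℂ) (φ q) * fderiv ℝ χ q w := by
  have h1 : HasFDerivAt (fun q => (starRingEnd ℂ) (φ q))
      (Complex.conjCLE.toContinuousLinearMap.comp (fderiv ℝ φ q)) q :=
    Complex.conjCLE.toContinuousLinearMap.hasFDerivAt.comp q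
      (hφ.differentiable (by simp) q).hasFDerivAt
  have h2 := h1.mul (hχ.differentiable (by simp) q).hasFDerivAt
  rw [show (fun q => (starRingEnd ℂ) (φ q) * χ q) = (fun q => (starRingEnd ℂ) (φ q)) * χ from rfl,
    h2.fderiv]
  simp
  ring

theorem fderiv_one_zero {φ : ℝ × ℝ → ℂ} (hφ : ContDiff ℝ ∞ φ) (q : ℝ × ℝ) :
    fderiv ℝ φ q (1, 0) = Complex.I * momentumX φ q := by
  rw [momentumX_eq hφ, ← mul_assoc, mul_neg, Complex.I_mul_I, neg_neg, one_mul]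

theorem fderiv_zero_one (B : ℝ) {φ : ℝ × ℝ → ℂ} (hφ : ContDiff ℝ ∞ φ) (q : ℝ × ℝ) :
    fderiv ℝ φ q (0, 1) = Complex.I * (momentumY B φ q - ((B * q.1 : ℝ) : ℂ) * φ q) := by
  rw [momentumY_eq B hφ, add_sub_cancel_right, ← mul_assoc, mul_neg, Complex.I_mul_I, neg_neg,
    one_mul]

theorem hasCompactSupport_momentumX {φ : ℝ × ℝ → ℂ} (hφ : ContDiff ℝ ∞ φ)
    (hc : HasCompactSupport φ) : HasCompactSupport (momentumX φ) := by
  rw [momentumX_eq hφ]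
  exact (hc.fderiv_apply ℝ (1, 0)).mul_left

theorem hasCompactSupport_momentumY (B : ℝ) {φ : ℝ × ℝ → ℂ} (hφ : ContDiff ℝ ∞ φ)
    (hc : HasCompactSupport φ) : HasCompactSupport (momentumY B φ) := by
  rw [momentumY_eq B hφ]
  exact ((hc.fderiv_apply ℝ (0, 1)).mul_left).add hc.mul_left

/-- The difference of the two pairings is a sum of four total derivatives of compactly supported
functions; the real terms `B x` and `v` cancel. -/
theorem symmGraph_landauCoreGraph (B : ℝ) (v : ℝ → ℝ) : SymmGraph (landauCoreGraph B v) := by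
  rintro ⟨a, b⟩ ⟨φ, hφ, hφc, ha, hb⟩ ⟨a', b'⟩ ⟨χ, hχ, hχc, ha', hb'⟩
  rw [← sub_eq_zero]
  simp only [L2.inner_def]
  rw [← integral_sub (L2.integrable_inner _ _) (L2.integrable_inner _ _)]
  have key : ∀ {φ χ : ℝ × ℝ → ℂ}, ContDiff ℝ ∞ φ → ContDiff ℝ ∞ χ → HasCompactSupport φ → ∀ w,
      Integrable (fun q => fderiv ℝ (fun q => (starRingEnd ℂ) (φ q) * χ q) q w) ∧
      ∫ q, fderiv ℝ (fun q => (starRingEnd ℂ) (φ q) * χ q) q w = 0 := by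
    intro φ χ hφ hχ hφc w
    have h1 : ContDiff ℝ ∞ fun q => (starRingEnd ℂ) (φ q) * χ q := (contDiff_star hφ).mul hχ
    have h2 : HasCompactSupport fun q => (starRingEnd ℂ) (φ q) * χ q :=
      (hasCompactSupport_star hφc).mul_right
    refine ⟨?_, integral_fderiv_eq_zero (h1.of_le (by simp)) h2 w⟩
    exact ((h1.continuous_fderiv (by simp)).clm_apply continuous_const).integrable_of_hasCompactSupport
      (h2.fderiv_apply ℝ w)
  have k1 := key hφ (contDiff_momentumX hχ) hφc (1, 0)
  have k2 := key (contDiff_momentumX hφ) hχ (hasCompactSupport_momentumX hφ hφc) (1, 0)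
  have k3 := key hφ (contDiff_momentumY B hχ) hφc (0, 1)
  have k4 := key (contDiff_momentumY B hφ) hχ (hasCompactSupport_momentumY B hφ hφc) (0, 1)
  have e0 := integral_add (k1.1.add k2.1) (k3.1.add k4.1)
  simp only [Pi.add_apply] at e0
  rw [integral_add k1.1 k2.1, integral_add k3.1 k4.1, k1.2, k2.2, k3.2, k4.2, add_zero,
    add_zero] at e0
  have e1 := congrArg (fun z => -Complex.I * z) e0
  simp only [mul_zero] at e1
  rw [← integral_const_mul] at e1
  rw [← e1]
  refine integral_congr_ae ?_
  filter_upwards [ha, hb, ha', hb'] with q h1 h2 h3 h4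
  rw [h1, h2, h3, h4, fderiv_star_mul hφ (contDiff_momentumX hχ),
    fderiv_star_mul (contDiff_momentumX hφ) hχ, fderiv_star_mul hφ (contDiff_momentumY B hχ),
    fderiv_star_mul (contDiff_momentumY B hφ) hχ, fderiv_one_zero hφ, fderiv_one_zero hχ,
    fderiv_one_zero (contDiff_momentumX hφ), fderiv_one_zero (contDiff_momentumX hχ),
    fderiv_zero_one B hφ, fderiv_zero_one B hχ, fderiv_zero_one B (contDiff_momentumY B hφ),
    fderiv_zero_one B (contDiff_momentumY B hχ)]
  simp only [landauExpr, RCLike.inner_apply, map_add, map_mul, map_sub, Complex.conj_ofReal,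
    Complex.conj_I]
  linear_combination (momentumX (momentumX χ) q * (starRingEnd ℂ) (φ q) +
    momentumY B (momentumY B χ) q * (starRingEnd ℂ) (φ q) -
    (starRingEnd ℂ) (momentumX (momentumX φ) q) * χ q -
    (starRingEnd ℂ) (momentumY B (momentumY B φ) q) * χ q) * Complex.I_mul_I

/-! ### Product functions -/

/-- Sorting by derivatives of `γ` shows the fiber structure: with `-i ∂_y` replaced by `p`, the
three terms assemble to `h_v(p) φ`. -/
theorem landauExpr_mul (B : ℝ) (v : ℝ → ℝ) {φ γ : ℝ → ℂ} (hγ : ContDiff ℝ ∞ γ) :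
    landauExpr B v (fun q => φ q.1 * γ q.2) = fun q => fiberExpr B v 0 φ q.1 * γ q.2 +
      (q.1 * φ q.1) * (-(2 * B * Complex.I) * deriv γ q.2) + φ q.1 * -deriv (deriv γ) q.2 := by
  have hX : ∀ φ : ℝ → ℂ, momentumX (fun q => φ q.1 * γ q.2) =
      fun q => (-Complex.I * deriv φ q.1) * γ q.2 := by
    intro φ; funext q
    simp only [momentumX, deriv_mul_const_field, mul_assoc]
  have hY : momentumY B (fun q => φ q.1 * γ q.2) =
      fun q => φ q.1 * (-Complex.I * deriv γ q.2 + ((B * q.1 : ℝ) : ℂ) * γ q.2) := by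
    funext q
    simp only [momentumY, deriv_const_mul_field]
    ring
  have hYY : momentumY B (fun q => φ q.1 * (-Complex.I * deriv γ q.2 + ((B * q.1 : ℝ) : ℂ) * γ q.2)) =
      fun q => φ q.1 * (-deriv (deriv γ) q.2 - 2 * Complex.I * ((B * q.1 : ℝ) : ℂ) * deriv γ q.2 +
        ((B * q.1 : ℝ) : ℂ) ^ 2 * γ q.2) := by
    funext q
    have d1 := (hγ.differentiable (by simp) q.2).hasDerivAt
    have d2 := ((hγ.deriv' (n := ∞)).differentiable (by simp) q.2).hasDerivAt
    have d3 := ((d2.const_mul (-Complex.I)).add (d1.const_mul ((B * q.1 : ℝ) : ℂ))).deriv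
    simp only [momentumY, deriv_const_mul_field]
    rw [show (fun s => -Complex.I * deriv γ s + ((B * q.1 : ℝ) : ℂ) * γ s) =
      (fun s => -Complex.I * deriv γ s) + fun s => ((B * q.1 : ℝ) : ℂ) * γ s from rfl, d3]
    linear_combination (φ q.1 * deriv (deriv γ) q.2) * Complex.I_mul_I
  have hXX : momentumX (fun q => (-Complex.I * deriv φ q.1) * γ q.2) =
      fun q => -deriv (deriv φ) q.1 * γ q.2 := by
    rw [hX fun x => -Complex.I * deriv φ x]
    funext q
    simp only [deriv_const_mul_field]
    linear_combination (deriv (deriv φ) q.1 * γ q.2) * Complex.I_mul_I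
  funext q
  simp only [landauExpr, hX, hXX, hY, hYY, fiberExpr]
  push_cast
  ring

theorem tensor_mem_landauCoreGraph {φ γ : ℝ → ℂ} (hφ : ContDiff ℝ ∞ φ) (hφc : HasCompactSupport φ)
    (hγ : ContDiff ℝ ∞ γ) (hγc : HasCompactSupport γ) {a a' a'' g g' g'' : L2R}
    (ha : a =ᵐ[volume] φ) (ha' : a' =ᵐ[volume] fiberExpr B v 0 φ)
    (ha'' : a'' =ᵐ[volume] fun x => (x : ℂ) * φ x) (hg : g =ᵐ[volume] γ)
    (hg' : g' =ᵐ[volume] deriv γ) (hg'' : g'' =ᵐ[volume] deriv (deriv γ)) :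
    (tensor a g, tensor a' g - (2 * B * Complex.I) • tensor a'' g' - tensor a g'') ∈
      landauCoreGraph B v := by
  refine ⟨fun q => φ q.1 * γ q.2, (hφ.comp contDiff_fst).mul (hγ.comp contDiff_snd), ?_,
    tensorFun_eq ha hg fun _ => rfl, ?_⟩
  · refine HasCompactSupport.intro (hφc.prod hγc) fun q hq => ?_
    rw [mem_prod, not_and_or] at hq
    rcases hq with hq | hq
    · rw [image_eq_zero_of_notMem_tsupport hq, zero_mul]
    · rw [image_eq_zero_of_notMem_tsupport hq, mul_zero]
  · rw [landauExpr_mul B v hγ]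
    filter_upwards [tensorFun_eq ha' hg fun _ => rfl, tensorFun_eq ha'' hg' fun _ => rfl,
      tensorFun_eq ha hg'' fun _ => rfl,
      Lp.coeFn_sub (tensor a' g - (2 * B * Complex.I) • tensor a'' g') (tensor a g''),
      Lp.coeFn_sub (tensor a' g) ((2 * B * Complex.I) • tensor a'' g'),
      Lp.coeFn_smul (2 * B * Complex.I) (tensor a'' g')] with q h1 h2 h3 h4 h5 h6
    rw [h4, Pi.sub_apply, h5, Pi.sub_apply, h6, Pi.smul_apply, tensor_apply, tensor_apply,
      tensor_apply, h1, h2, h3, smul_eq_mul]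
    ring

theorem tensor_mem_topologicalClosure {G : Submodule ℂ (L2P × L2P)} (s : ℂ)
    {a a' a'' g g' g'' : ℕ → L2R} {a₀ a₀' a₀'' g₀ g₀' g₀'' : L2R} (ha : Tendsto a atTop (𝓝 a₀))
    (ha' : Tendsto a' atTop (𝓝 a₀')) (ha'' : Tendsto a'' atTop (𝓝 a₀''))
    (hg : Tendsto g atTop (𝓝 g₀)) (hg' : Tendsto g' atTop (𝓝 g₀'))
    (hg'' : Tendsto g'' atTop (𝓝 g₀''))
    (h : ∀ k, (tensor (a k) (g k), tensor (a' k) (g k) - s • tensor (a'' k) (g' k) -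
      tensor (a k) (g'' k)) ∈ G) :
    (tensor a₀ g₀, tensor a₀' g₀ - s • tensor a₀'' g₀' - tensor a₀ g₀'') ∈
      G.topologicalClosure := by
  have ht : ∀ {x y : ℕ → L2R} {x₀ y₀ : L2R}, Tendsto x atTop (𝓝 x₀) → Tendsto y atTop (𝓝 y₀) →
      Tendsto (fun k => tensor (x k) (y k)) atTop (𝓝 (tensor x₀ y₀)) := by
    intro x y x₀ y₀ hx hy
    have h1 : Tendsto (fun k => tensor (x k)) atTop (𝓝 (tensor x₀)) :=
      (tensor.continuous.tendsto x₀).comp hx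
    have h2 : Continuous fun q : (L2R →L[ℂ] L2P) × L2R => q.1 q.2 :=
      isBoundedBilinearMap_apply.continuous
    exact (h2.tendsto (tensor x₀, y₀)).comp (h1.prodMk_nhds hy)
  have h1 := (ht ha hg).prodMk_nhds
    (((ht ha' hg).sub ((ht ha'' hg').const_smul s)).sub (ht ha hg''))
  exact mem_closure_of_tendsto h1 (Eventually.of_forall h)

/-- Neither factor need have compact support; both are cut off at once. -/
theorem tensor_mem_closure_landauCoreGraph (hB : 0 < B) {f : ℝ → ℝ} {c : ℝ}
    (h : SquareBounded v f c) (P : ℂ[X]) {γ γ' γ'' : ℝ → ℂ} (hγ : ContDiff ℝ ∞ γ)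
    (hd : ∀ y, HasDerivAt γ (γ' y) y) (hd' : ∀ y, HasDerivAt γ' (γ'' y) y) {g g' g'' : L2R}
    (hg : g =ᵐ[volume] γ) (hg' : g' =ᵐ[volume] γ') (hg'' : g'' =ᵐ[volume] γ'') :
    (tensor (polyToL2 hB P) g, tensor (fiberPoly hB h (0 : ℝ) P) g -
      (2 * B * Complex.I) • tensor (polyToL2 hB (X * P)) g' - tensor (polyToL2 hB P) g'') ∈
      (landauCoreGraph B v).topologicalClosure := by
  obtain ⟨φ, a, a', a'', hφ, ta, ta', ta''⟩ := exists_core_approx_polyGauss hB h 0 P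
  have m0 : MemLp γ 2 volume := (memLp_congr_ae hg).1 (Lp.memLp g)
  have m1 : MemLp γ' 2 volume := (memLp_congr_ae hg').1 (Lp.memLp g')
  have m2 : MemLp γ'' 2 volume := (memLp_congr_ae hg'').1 (Lp.memLp g'')
  obtain ⟨η, hη, t1, t2, tq⟩ := exists_cutoff hγ hd hd' m0 m1 m2
  have n0 : ∀ k, MemLp (η k) 2 volume := fun k =>
    (hη k).1.continuous.memLp_of_hasCompactSupport (hη k).2
  have n1 : ∀ k, MemLp (deriv (η k)) 2 volume := fun k =>
    ((hη k).1.deriv' (n := ∞)).continuous.memLp_of_hasCompactSupport (hη k).2.deriv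
  have n2 : ∀ k, MemLp (deriv (deriv (η k))) 2 volume := fun k =>
    (((hη k).1.deriv' (n := ∞)).deriv' (n := ∞)).continuous.memLp_of_hasCompactSupport
      (hη k).2.deriv.deriv
  have s0 := tendsto_toLp n0 m0 (by simpa using tq (fun _ => 1) (by simpa using m0)) hg
  have s1 := tendsto_toLp n1 m1 t1 hg'
  have s2 := tendsto_toLp n2 m2 t2 hg''
  refine tensor_mem_topologicalClosure (2 * B * Complex.I) ta ta' ta'' s0 s1 s2 fun k => ?_
  exact tensor_mem_landauCoreGraph (hφ k).1 (hφ k).2.1 (hη k).1 (hη k).2 (hφ k).2.2.1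
    (hφ k).2.2.2.1 (hφ k).2.2.2.2 (n0 k).coeFn_toLp (n1 k).coeFn_toLp (n2 k).coeFn_toLp

/-- The inverse Fourier transform of a test function, with its first two derivatives. -/
theorem exists_fourier_test {χ : ℝ → ℝ} (hχ : ContDiff ℝ ∞ χ) (hχc : HasCompactSupport χ) :
    ∃ (g g₁ g₂ : L2R) (γ γ₁ γ₂ : ℝ → ℂ), ContDiff ℝ ∞ γ ∧
      (∀ y, HasDerivAt γ ((2 * Real.pi * Complex.I) * γ₁ y) y) ∧
      (∀ y, HasDerivAt γ₁ ((2 * Real.pi * Complex.I) * γ₂ y) y) ∧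
      g =ᵐ[volume] γ ∧ g₁ =ᵐ[volume] γ₁ ∧ g₂ =ᵐ[volume] γ₂ ∧
      fourierL2 g =ᵐ[volume] (fun ξ => (χ ξ : ℂ)) ∧
      fourierL2 g₁ =ᵐ[volume] (fun ξ => (ξ : ℂ) * χ ξ) ∧
      fourierL2 g₂ =ᵐ[volume] fun ξ => (ξ : ℂ) ^ 2 * χ ξ := by
  have hc : HasCompactSupport fun ξ => (χ ξ : ℂ) := hχc.comp_left (g := fun r : ℝ => (r : ℂ)) rfl
  let T : SchwartzMap ℝ ℂ := hc.toSchwartzMap (Complex.ofRealCLM.contDiff.comp hχ)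
  let m : SchwartzMap ℝ ℂ → SchwartzMap ℝ ℂ := fun f =>
    SchwartzMap.smulLeftCLM ℂ (fun x : ℝ => inner ℝ x (1 : ℝ)) f
  have hm : ∀ f x, m f x = (x : ℂ) * f x := by
    intro f x
    have h1 := SchwartzMap.smulLeftCLM_apply_apply (F := ℂ) (g := fun x : ℝ => inner ℝ x (1 : ℝ))
      (by fun_prop) f x
    refine h1.trans ?_
    simp
  have hder : ∀ (f : SchwartzMap ℝ ℂ) (y : ℝ), HasDerivAt (FourierTransformInv.fourierInv f)
      ((2 * Real.pi * Complex.I) * (FourierTransformInv.fourierInv (m f)) y) y := by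
    intro f y
    have h1 := SchwartzMap.lineDerivOp_fourierInv_eq f (1 : ℝ)
    have h2 := congrArg (fun F : SchwartzMap ℝ ℂ => F y) h1
    have h3 : HasDerivAt (FourierTransformInv.fourierInv f)
        (fderiv ℝ (FourierTransformInv.fourierInv f) y 1) y :=
      ((FourierTransformInv.fourierInv f).differentiableAt (x := y)).hasFDerivAt.hasDerivAt
    refine h3.congr_deriv ?_
    rw [← SchwartzMap.lineDerivOp_apply_eq_fderiv, h2]
    rw [FourierTransform.fourierInv_smul]
    rfl
  have hF : ∀ f : SchwartzMap ℝ ℂ,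
      fourierL2 ((FourierTransformInv.fourierInv f).toLp 2) =ᵐ[volume] f := by
    intro f
    have h1 : fourierL2 ((FourierTransformInv.fourierInv f).toLp 2) = f.toLp 2 := by
      refine (SchwartzMap.toLp_fourier_eq (FourierTransformInv.fourierInv f)).trans ?_
      simp
    rw [h1]
    exact SchwartzMap.coeFn_toLp _ _ _
  refine ⟨(FourierTransformInv.fourierInv T).toLp 2, (FourierTransformInv.fourierInv (m T)).toLp 2,
    (FourierTransformInv.fourierInv (m (m T))).toLp 2, FourierTransformInv.fourierInv T,
    FourierTransformInv.fourierInv (m T), FourierTransformInv.fourierInv (m (m T)),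
    (FourierTransformInv.fourierInv T).smooth _, hder T, hder (m T),
    SchwartzMap.coeFn_toLp _ _ _, SchwartzMap.coeFn_toLp _ _ _, SchwartzMap.coeFn_toLp _ _ _,
    hF T, ?_, ?_⟩
  · refine (hF (m T)).trans (Eventually.of_forall fun ξ => ?_)
    rw [hm]; rfl
  · refine (hF (m (m T))).trans (Eventually.of_forall fun ξ => ?_)
    rw [hm, hm, ← mul_assoc, ← pow_two]; rfl

/-- Profiles in `y` whose Fourier transform is a test function `χ`. On the Fourier side the pair
becomes `χ(ξ)` times an element of the graph of `h_v(2πξ)`; the constants are `2 · 2π · B` and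
`(2π)²`. -/
theorem exists_landau_core (hB : 0 < B) {f : ℝ → ℝ} {c : ℝ} (h : SquareBounded v f c) {χ : ℝ → ℝ}
    (hχ : ContDiff ℝ ∞ χ) (hχc : HasCompactSupport χ) :
    ∃ g g₁ g₂ : L2R, fourierL2 g =ᵐ[volume] (fun ξ => (χ ξ : ℂ)) ∧
      fourierL2 g₁ =ᵐ[volume] (fun ξ => (ξ : ℂ) * χ ξ) ∧
      fourierL2 g₂ =ᵐ[volume] (fun ξ => (ξ : ℂ) ^ 2 * χ ξ) ∧
      ∀ P : ℂ[X], (tensor (polyToL2 hB P) g, tensor (fiberPoly hB h (0 : ℝ) P) g +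
        ((4 * Real.pi * B : ℝ) : ℂ) • tensor (polyToL2 hB (X * P)) g₁ +
        ((4 * Real.pi ^ 2 : ℝ) : ℂ) • tensor (polyToL2 hB P) g₂) ∈
          (landauCoreGraph B v).topologicalClosure := by
  obtain ⟨g, g₁, g₂, γ, γ₁, γ₂, hγ, hd, hd', hg, hg₁, hg₂, e0, e1, e2⟩ := exists_fourier_test hχ hχc
  refine ⟨g, g₁, g₂, e0, e1, e2, fun P => ?_⟩
  set k : ℂ := 2 * Real.pi * Complex.I with hk
  have hk2 : k * k = -(4 * Real.pi ^ 2) := by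
    rw [hk]; linear_combination (4 * (Real.pi : ℂ) ^ 2) * Complex.I_mul_I
  have hsm : ∀ {z : L2R} {ζ : ℝ → ℂ} (s : ℂ), z =ᵐ[volume] ζ →
      (s • z : L2R) =ᵐ[volume] fun y => s * ζ y := by
    intro z ζ s hz
    filter_upwards [Lp.coeFn_smul s z, hz] with y h1 h2
    rw [h1, Pi.smul_apply, h2, smul_eq_mul]
  have hd'' : ∀ y, HasDerivAt (fun y => k * γ₁ y) ((k * k) * γ₂ y) y := fun y => by
    rw [mul_assoc]; exact (hd' y).const_mul k
  have h1 := tensor_mem_closure_landauCoreGraph hB h P hγ hd hd'' hg (hsm k hg₁) (hsm (k * k) hg₂)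
  convert h1 using 2
  rw [map_smul, map_smul, smul_smul, hk2]
  have h3 : 2 * (B : ℂ) * Complex.I * k = -(4 * Real.pi * B) := by
    rw [hk]; linear_combination (4 * (Real.pi : ℂ) * B) * Complex.I_mul_I
  rw [h3]
  push_cast
  module

theorem dense_fst_landauCoreGraph {f : ℝ → ℝ} {c : ℝ} (h : SquareBounded v f c) :
    Dense (Prod.fst '' (landauCoreGraph B v : Set (L2P × L2P))) := by
  set S : Submodule ℂ L2P := (landauCoreGraph B v).map (LinearMap.fst ℂ L2P L2P) with hS
  have hSe : (S : Set L2P) = Prod.fst '' (landauCoreGraph B v : Set (L2P × L2P)) := rfl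
  rw [← hSe, Submodule.dense_iff_topologicalClosure_eq_top, Submodule.topologicalClosure_eq_top_iff,
    Submodule.eq_bot_iff]
  intro ψ hψ
  -- Zero potential in the second factor merely reuses the density of test functions in `L²(ℝ)`.
  have hcore : ∀ a ∈ Prod.fst '' (fiberCoreGraph B v 0 : Set (L2R × L2R)),
      ∀ g ∈ Prod.fst '' (fiberCoreGraph B (fun _ => 0) 0 : Set (L2R × L2R)), ⟪tensor a g, ψ⟫ = 0 := by
    rintro _ ⟨⟨a, a'⟩, ⟨φ, hφ, hφc, ha, ha'⟩, rfl⟩ _ ⟨⟨g, g₀⟩, ⟨γ, hγ, hγc, hg, -⟩, rfl⟩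
    have mx : MemLp (fun x : ℝ => (x : ℂ) * φ x) 2 volume :=
      (Complex.continuous_ofReal.mul hφ.continuous).memLp_of_hasCompactSupport hφc.mul_left
    have n1 : MemLp (deriv γ) 2 volume :=
      (hγ.deriv' (n := ∞)).continuous.memLp_of_hasCompactSupport hγc.deriv
    have n2 : MemLp (deriv (deriv γ)) 2 volume :=
      ((hγ.deriv' (n := ∞)).deriv' (n := ∞)).continuous.memLp_of_hasCompactSupport hγc.deriv.deriv
    exact (Submodule.mem_orthogonal _ _).1 hψ _ ⟨_, tensor_mem_landauCoreGraph hφ hφc hγ hγc ha ha'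
      mx.coeFn_toLp hg n1.coeFn_toLp n2.coeFn_toLp, rfl⟩
  have hd1 := dense_fst_fiberCoreGraph (B := B) (p := 0)
    fun _ => h.memLp_mul_of_hasCompactSupport
  have hd2 := dense_fst_fiberCoreGraph (B := B) (v := fun _ => 0) (p := 0)
    fun φ _ _ => by simp
  refine eq_zero_of_inner_tensor fun a g => ?_
  have hc1 : ∀ g, IsClosed {a : L2R | ⟪tensor a g, ψ⟫ = 0} := fun g =>
    isClosed_eq ((tensor.flip g).continuous.inner continuous_const) continuous_const
  have hc2 : ∀ a, IsClosed {g : L2R | ⟪tensor a g, ψ⟫ = 0} := fun a =>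
    isClosed_eq ((tensor a).continuous.inner continuous_const) continuous_const
  exact closure_minimal (fun a ha => closure_minimal (fun g hg => hcore a ha g hg) (hc2 a) (hd2 g))
    (hc1 g) (hd1 a)

theorem SquareBounded.landauOp_graph {f : ℝ → ℝ} {c : ℝ} (h : SquareBounded v f c) :
    (landauOp B v).graph = (landauCoreGraph B v).topologicalClosure :=
  SymmGraph.closure_graph (symmGraph_landauCoreGraph B v) (landauCoreGraph_fst_eq_zero B v)
    (dense_fst_landauCoreGraph h)

end

section

local notation "⟪" x ", " y "⟫" => inner ℂ x y

open Polynomial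

/-! ### Self-adjointness from trivial deficiency spaces -/

section Deficiency

variable {E : Type*} [NormedAddCommGroup E] [InnerProductSpace ℂ E]

theorem SymmGraph.abs_im_mul_norm_le {G : Submodule ℂ (E × E)} (hs : SymmGraph G) (z : ℂ)
    {q : E × E} (hq : q ∈ G) : |z.im| * ‖q.1‖ ≤ ‖q.2 - z • q.1‖ := by
  rcases eq_or_lt_of_le (norm_nonneg q.1) with h0 | h0
  · rw [← h0, mul_zero]; exact norm_nonneg _
  have h1 : (⟪q.1, q.2⟫ : ℂ).im = 0 := by
    have h2 := hs q hq q hq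
    rw [← inner_conj_symm q.2 q.1] at h2
    exact Complex.conj_eq_iff_im.1 h2.symm
  have h3 : (⟪q.1, q.2 - z • q.1⟫ : ℂ).im = -(z.im * ‖q.1‖ ^ 2) := by
    rw [inner_sub_right, inner_smul_right, inner_self_eq_norm_sq_to_K, Complex.sub_im, h1, zero_sub]
    have h5 : ((‖q.1‖ : ℂ) ^ 2) = ((‖q.1‖ ^ 2 : ℝ) : ℂ) := by push_cast; rfl
    refine congrArg Neg.neg ((congrArg (fun w => (z * w).im) h5).trans ?_)
    exact Complex.im_mul_ofReal _ _
  have h4 : |z.im| * ‖q.1‖ ^ 2 ≤ ‖q.1‖ * ‖q.2 - z • q.1‖ := by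
    calc |z.im| * ‖q.1‖ ^ 2 = |(⟪q.1, q.2 - z • q.1⟫ : ℂ).im| := by
          rw [h3, abs_neg, abs_mul, abs_of_nonneg (sq_nonneg ‖q.1‖)]
      _ ≤ ‖(⟪q.1, q.2 - z • q.1⟫ : ℂ)‖ := Complex.abs_im_le_norm _
      _ ≤ _ := norm_inner_le_norm _ _
  nlinarith

/-- On the closed, hence complete, graph the map `q ↦ q.2 - z q.1` is bounded below since `z` is not
real. Its range is therefore closed, and it is everything once its orthogonal complement is trivial.
-/
theorem exists_sub_smul_eq_of_deficiency [CompleteSpace E] {A : E →ₗ.[ℂ] E}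
    (hs : SymmGraph A.graph) (hc : IsClosed (A.graph : Set (E × E))) {z : ℂ} (hz : z.im ≠ 0)
    (h : ∀ ψ, (∀ q ∈ A.graph, ⟪ψ, q.2 - z • q.1⟫ = 0) → ψ = 0) (f : E) :
    ∃ x : A.domain, A x - z • (x : E) = f := by
  have : CompleteSpace A.graph := hc.completeSpace_coe
  let T : A.graph →L[ℂ] E :=
    (ContinuousLinearMap.snd ℂ E E - z • ContinuousLinearMap.fst ℂ E E).comp A.graph.subtypeL
  have hT : ∀ q : A.graph, T q = q.1.2 - z • q.1.1 := fun q => rfl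
  have hz' : 0 < |z.im| := abs_pos.2 hz
  have hb : ∀ q : A.graph, ‖q‖ ≤ ((1 + (1 + ‖z‖) / |z.im|).toNNReal : ℝ) * ‖T q‖ := by
    intro q
    have h1 := hs.abs_im_mul_norm_le z q.2
    rw [← hT] at h1
    have h2 : ‖q.1.1‖ ≤ ‖T q‖ / |z.im| := by rw [le_div_iff₀ hz', mul_comm]; exact h1
    have h3 : ‖q.1.2‖ ≤ ‖T q‖ + ‖z‖ * ‖q.1.1‖ := by
      rw [← norm_smul]
      calc ‖q.1.2‖ = ‖T q + z • q.1.1‖ := by rw [hT, sub_add_cancel]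
        _ ≤ _ := norm_add_le _ _
    have h4 : ‖z‖ * ‖q.1.1‖ ≤ ‖z‖ * (‖T q‖ / |z.im|) := by gcongr
    have h5 : 0 ≤ ‖z‖ * (‖T q‖ / |z.im|) := by positivity
    have h6 : 0 ≤ ‖T q‖ / |z.im| := by positivity
    rw [Real.coe_toNNReal _ (by positivity)]
    have h7 : (1 + (1 + ‖z‖) / |z.im|) * ‖T q‖ =
      ‖T q‖ + ‖T q‖ / |z.im| + ‖z‖ * (‖T q‖ / |z.im|) := by ring
    rw [h7]
    have h8 : ‖q.1.1‖ ≤ ‖T q‖ + ‖T q‖ / |z.im| + ‖z‖ * (‖T q‖ / |z.im|) := by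
      linarith [norm_nonneg (T q)]
    have h9 : ‖q.1.2‖ ≤ ‖T q‖ + ‖T q‖ / |z.im| + ‖z‖ * (‖T q‖ / |z.im|) := by linarith
    exact max_le h8 h9
  have hcl := (T.antilipschitz_of_bound hb).isClosed_range T.uniformContinuous
  have htop : T.range = ⊤ := by
    have h1 : T.range.topologicalClosure = T.range :=
      IsClosed.submodule_topologicalClosure_eq (by
        rw [LinearMap.coe_range]; exact hcl)
    rw [← h1, Submodule.topologicalClosure_eq_top_iff, Submodule.eq_bot_iff]
    intro ψ hψ
    refine h ψ fun q hq => ?_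
    exact (Submodule.mem_orthogonal' _ _).1 hψ _ ⟨⟨q, hq⟩, rfl⟩
  obtain ⟨q, hq⟩ : f ∈ T.range := htop ▸ trivial
  obtain ⟨x, hx1, hx2⟩ := (LinearPMap.mem_graph_iff A).1 q.2
  exact ⟨x, by rw [hx1, hx2]; exact hq⟩

end Deficiency

/-! ### Decomposition into fibers -/

variable {B : ℝ} {v f : ℝ → ℝ} {c : ℝ}

theorem fiberPoly_eq (hB : 0 < B) (h : SquareBounded v f c) (p : ℂ) (P : ℂ[X]) :
    fiberPoly hB h p P = fiberPoly hB h (0 : ℝ) P + (2 * p * B) • polyToL2 hB (X * P) +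
      p ^ 2 • polyToL2 hB P := by
  simp only [fiberPoly, Complex.ofReal_zero, mul_zero, zero_mul, zero_smul, ne_eq, OfNat.ofNat_ne_zero,
    not_false_eq_true, zero_pow]
  abel

theorem fiberPoly_add (hB : 0 < B) (h : SquareBounded v f c) (p : ℂ) (P Q : ℂ[X]) :
    fiberPoly hB h p (P + Q) = fiberPoly hB h p P + fiberPoly hB h p Q := by
  simp only [fiberPoly, polyH_add, mul_add, map_add, smul_add]
  abel

theorem fiberPoly_smul (hB : 0 < B) (h : SquareBounded v f c) (p s : ℂ) (P : ℂ[X]) :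
    fiberPoly hB h p (s • P) = s • fiberPoly hB h p P := by
  simp only [fiberPoly, polyH_smul, mul_smul_comm, map_smul, smul_add, smul_smul]
  congr 3 <;> ring_nf

theorem integrable_mul_inner (Φ : L2V) (x : L2R) {χ : ℝ → ℂ} (hχ : Continuous χ)
    (hχc : HasCompactSupport χ) : Integrable fun ξ => χ ξ * ⟪Φ ξ, x⟫ := by
  have h1 : LocallyIntegrable (fun ξ => ⟪Φ ξ, x⟫) volume :=
    ((Lp.memLp Φ).inner_const x).locallyIntegrable (by norm_num)
  exact LocallyIntegrable.integrable_smul_left_of_hasCompactSupport h1 hχ hχc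

/-- Testing the weak equation with `exists_landau_core` gives the difference of both sides
integrated against an arbitrary test function `χ(ξ)`; a locally integrable function with this
property vanishes almost everywhere. -/
theorem ae_inner_fiberPoly (hB : 0 < B) (h : SquareBounded v f c) {a a' : L2P}
    (ha : ∀ q ∈ (landauCoreGraph B v).topologicalClosure, ⟪a', q.1⟫ = ⟪a, q.2⟫) (P : ℂ[X]) :
    ∀ᵐ ξ : ℝ, ⟪partialFourier a' ξ, polyToL2 hB P⟫ =
      ⟪partialFourier a ξ, fiberPoly hB h ((2 * Real.pi * ξ : ℝ) : ℂ) P⟫ := by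
  have hloc : ∀ (Φ : L2V) (x : L2R), LocallyIntegrable (fun ξ => ⟪Φ ξ, x⟫) volume := fun Φ x =>
    ((Lp.memLp Φ).inner_const x).locallyIntegrable (by norm_num)
  have hexp : ∀ ξ : ℝ, ⟪partialFourier a ξ, fiberPoly hB h ((2 * Real.pi * ξ : ℝ) : ℂ) P⟫ =
      ⟪partialFourier a ξ, fiberPoly hB h (0 : ℝ) P⟫ +
      ((4 * Real.pi * B : ℝ) : ℂ) * ((ξ : ℂ) * ⟪partialFourier a ξ, polyToL2 hB (X * P)⟫) +
      ((4 * Real.pi ^ 2 : ℝ) : ℂ) * ((ξ : ℂ) ^ 2 * ⟪partialFourier a ξ, polyToL2 hB P⟫) := by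
    intro ξ
    rw [fiberPoly_eq, inner_add_right, inner_add_right, inner_smul_right, inner_smul_right]
    push_cast
    ring
  have hli : LocallyIntegrable (fun ξ => ⟪partialFourier a' ξ, polyToL2 hB P⟫ -
      ⟪partialFourier a ξ, fiberPoly hB h ((2 * Real.pi * ξ : ℝ) : ℂ) P⟫) volume := by
    simp only [hexp]
    refine (hloc _ _).sub (((hloc _ _).add ?_).add ?_)
    · exact LocallyIntegrable.continuous_mul continuous_const
        (LocallyIntegrable.continuous_mul Complex.continuous_ofReal (hloc _ _))
    · exact LocallyIntegrable.continuous_mul continuous_const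
        (LocallyIntegrable.continuous_mul (Complex.continuous_ofReal.pow 2) (hloc _ _))
  have key := ae_eq_zero_of_integral_contDiff_smul_eq_zero hli ?_
  · filter_upwards [key] with ξ hξ using sub_eq_zero.1 hξ
  intro χ hχ hχc
  obtain ⟨g, g₁, g₂, e0, e1, e2, hm⟩ := exists_landau_core hB h hχ hχc
  have h1 := ha _ (hm P)
  simp only [inner_add_right, inner_smul_right, inner_tensor_right] at h1
  have hcc : Continuous fun ξ => (χ ξ : ℂ) := Complex.continuous_ofReal.comp hχ.continuous
  have hcs : HasCompactSupport fun ξ => (χ ξ : ℂ) :=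
    hχc.comp_left (g := fun r : ℝ => (r : ℂ)) rfl
  have i0 := integrable_mul_inner (partialFourier a') (polyToL2 hB P) hcc hcs
  have i1 := integrable_mul_inner (partialFourier a) (fiberPoly hB h (0 : ℝ) P) hcc hcs
  have i2 : Integrable fun ξ : ℝ => ((4 * Real.pi * B : ℝ) : ℂ) *
      (((ξ : ℂ) * χ ξ) * ⟪partialFourier a ξ, polyToL2 hB (X * P)⟫) := (integrable_mul_inner (partialFourier a) (polyToL2 hB (X * P))
    (Complex.continuous_ofReal.mul hcc) hcs.mul_left).const_mul ((4 * Real.pi * B : ℝ) : ℂ)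
  have i3 : Integrable fun ξ : ℝ => ((4 * Real.pi ^ 2 : ℝ) : ℂ) *
      (((ξ : ℂ) ^ 2 * χ ξ) * ⟪partialFourier a ξ, polyToL2 hB P⟫) := (integrable_mul_inner (partialFourier a) (polyToL2 hB P)
    ((Complex.continuous_ofReal.pow 2).mul hcc) hcs.mul_left).const_mul ((4 * Real.pi ^ 2 : ℝ) : ℂ)
  have c0 : ∀ (Φ : L2V) (x : L2R), ∫ ξ, fourierL2 g ξ * ⟪Φ ξ, x⟫ = ∫ ξ, (χ ξ : ℂ) * ⟪Φ ξ, x⟫ :=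
    fun Φ x => integral_congr_ae (by filter_upwards [e0] with ξ hξ using by rw [hξ])
  have c1 : ∀ (Φ : L2V) (x : L2R), ∫ ξ, fourierL2 g₁ ξ * ⟪Φ ξ, x⟫ =
      ∫ ξ : ℝ, ((ξ : ℂ) * χ ξ) * ⟪Φ ξ, x⟫ :=
    fun Φ x => integral_congr_ae (by filter_upwards [e1] with ξ hξ using by rw [hξ])
  have c2 : ∀ (Φ : L2V) (x : L2R), ∫ ξ, fourierL2 g₂ ξ * ⟪Φ ξ, x⟫ =
      ∫ ξ : ℝ, ((ξ : ℂ) ^ 2 * χ ξ) * ⟪Φ ξ, x⟫ :=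
    fun Φ x => integral_congr_ae (by filter_upwards [e2] with ξ hξ using by rw [hξ])
  rw [c0, c0, c1, c2, ← integral_const_mul, ← integral_const_mul, ← integral_add' i1 i2,
    ← integral_add' (i1.add i2) i3, ← sub_eq_zero, ← integral_sub' i0 ((i1.add i2).add i3)] at h1
  rw [← h1]
  refine integral_congr_ae (Eventually.of_forall fun ξ => ?_)
  simp only [hexp, Pi.sub_apply, Pi.add_apply, Complex.real_smul]
  ring

/-- The exceptional null set depends on the polynomial, so only the countably many Hermite
polynomials are used. Linearity and approximation in the graph then reach every element for the
remaining `ξ`. -/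
theorem ae_inner_fiberOp (hB : 0 < B) (h : SquareBounded v f c) {a a' : L2P}
    (ha : ∀ q ∈ (landauCoreGraph B v).topologicalClosure, ⟪a', q.1⟫ = ⟪a, q.2⟫) :
    ∀ᵐ ξ : ℝ, ∀ q ∈ (fiberOp B v (2 * Real.pi * ξ)).graph,
      ⟪partialFourier a' ξ, q.1⟫ = ⟪partialFourier a ξ, q.2⟫ := by
  filter_upwards [ae_all_iff.2 fun n => ae_inner_fiberPoly hB h ha (hermP B n)] with ξ hξ
  have hP : ∀ P : ℂ[X], ⟪partialFourier a' ξ, polyToL2 hB P⟫ =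
      ⟪partialFourier a ξ, fiberPoly hB h ((2 * Real.pi * ξ : ℝ) : ℂ) P⟫ := by
    intro P
    have hmem : P ∈ Submodule.span ℂ (range (hermP B)) := by rw [span_hermP hB]; trivial
    induction hmem using Submodule.span_induction with
    | mem P hP => obtain ⟨n, rfl⟩ := hP; exact hξ n
    | zero =>
      have h0 := fiberPoly_smul hB h ((2 * Real.pi * ξ : ℝ) : ℂ) 0 0
      rw [zero_smul, zero_smul] at h0
      rw [h0, map_zero, inner_zero_right, inner_zero_right]
    | add P Q _ _ h1 h2 => rw [map_add, fiberPoly_add, inner_add_right, inner_add_right, h1, h2]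
    | smul s P _ h1 => rw [map_smul, fiberPoly_smul, inner_smul_right, inner_smul_right, h1]
  rintro ⟨x, y⟩ hq
  obtain ⟨u, u', P, hu⟩ := exists_fiberApprox hB h hq
  refine tendsto_nhds_unique 
    (((innerSL ℂ (partialFourier a' ξ)).continuous.tendsto x).comp hu.tendsto) ?_
  refine (((innerSL ℂ (partialFourier a ξ)).continuous.tendsto y).comp hu.tendsto_fiber).congr ?_
  exact fun k => (hP (P k)).symm

theorem eq_zero_of_partialFourier {ψ : L2P} (h : ∀ᵐ ξ, partialFourier ψ ξ = 0) : ψ = 0 := by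
  have h1 : partialFourier ψ = 0 := (Lp.eq_zero_iff_ae_eq_zero).2 h
  rwa [map_eq_zero_iff _ partialFourier.injective] at h1

theorem isClosed_landauOp_graph (h : SquareBounded v f c) :
    IsClosed ((landauOp B v).graph : Set (L2P × L2P)) := by
  rw [h.landauOp_graph]; exact Submodule.isClosed_topologicalClosure _

theorem symmGraph_landauOp (h : SquareBounded v f c) : SymmGraph (landauOp B v).graph := by
  rw [h.landauOp_graph]; exact (symmGraph_landauCoreGraph B v).closure

variable {ε : ℝ → ℕ → ℝ} {b : ℝ → HilbertBasis ℕ ℂ L2R}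

/-- If `ψ` is orthogonal to the range of `H_L + V - z`, almost every fiber of its Fourier transform
satisfies `(z - ε) ⟪·, b n⟫ = 0`. Eigenvalues are real and `z` is not, so `ψ = 0`. -/
theorem SquareBounded.isSelfAdjoint_landauOp (hB : 0 < B) (h : SquareBounded v f c)
    (hE : ∀ p, EigenSystem (fiberOp B v p) (ε p) (b p)) : IsSelfAdjoint (landauOp B v) := by
  have key : ∀ z : ℂ, z.im ≠ 0 → ∀ g : L2P, ∃ x : (landauOp B v).domain,
      landauOp B v x - z • (x : L2P) = g := by
    intro z hz
    refine exists_sub_smul_eq_of_deficiency (symmGraph_landauOp h) (isClosed_landauOp_graph h) hz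
      fun ψ hψ => ?_
    have h1 : ∀ q ∈ (landauCoreGraph B v).topologicalClosure,
        ⟪(starRingEnd ℂ) z • ψ, q.1⟫ = ⟪ψ, q.2⟫ := by
      intro q hq
      have h2 := hψ q (h.landauOp_graph (B := B) ▸ hq)
      rw [inner_sub_right, inner_smul_right, sub_eq_zero] at h2
      rw [inner_smul_left, Complex.conj_conj, h2]
    refine eq_zero_of_partialFourier ?_
    have hsm : partialFourier ((starRingEnd ℂ) z • ψ) = (starRingEnd ℂ) z • partialFourier ψ :=
      map_smul _ _ _
    filter_upwards [ae_inner_fiberOp hB h h1,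
      Lp.coeFn_smul ((starRingEnd ℂ) z) (partialFourier ψ)] with ξ h3 h4
    refine HilbertBasis.ext_inner (b (2 * Real.pi * ξ)) fun n => ?_
    have h5 := h3 _ ((hE _).mem n)
    rw [hsm, h4, Pi.smul_apply, inner_smul_left, inner_smul_right, Complex.conj_conj] at h5
    have h6 : ⟪partialFourier ψ ξ, b (2 * Real.pi * ξ) n⟫ = 0 := by
      have h7 : (z - ε (2 * Real.pi * ξ) n) * ⟪partialFourier ψ ξ, b (2 * Real.pi * ξ) n⟫ = 0 := by
        rw [sub_mul, h5, sub_self]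
      refine (mul_eq_zero.1 h7).resolve_left fun h8 => hz ?_
      rw [sub_eq_zero.1 h8, Complex.ofReal_im]
    rw [inner_zero_right, ← inner_conj_symm, h6, map_zero]
  refine isSelfAdjoint_of_surjective (dense_domain_of_graph_eq h.landauOp_graph
    (dense_fst_landauCoreGraph h)) (symmGraph_landauOp h) Complex.I (key _ (by simp)) (key _ (by simp))

end

section

local notation "⟪" x ", " y "⟫" => inner ℂ x y

/-! ### Sums of push-forwards of densities -/

/-- The sum over `n` of the images under `e n` of the measures `w n (ξ) dξ`. -/
noncomputable def bandMeasure (w e : ℕ → ℝ → ℝ) : Measure ℝ :=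
  Measure.sum fun n => (volume.withDensity fun ξ => ENNReal.ofReal (w n ξ)).map (e n)

section BandMeasure

variable {w e : ℕ → ℝ → ℝ} {W : ℝ → ℝ}

theorem tsum_lintegral_ofReal (hw : ∀ n, Measurable (w n)) (hw0 : ∀ n ξ, 0 ≤ w n ξ)
    (hW : ∀ ξ, HasSum (fun n => w n ξ) (W ξ)) :
    ∑' n, ∫⁻ ξ, ENNReal.ofReal (w n ξ) = ∫⁻ ξ, ENNReal.ofReal (W ξ) := by
  rw [← lintegral_tsum fun n => (hw n).ennreal_ofReal.aemeasurable]
  refine lintegral_congr fun ξ => ?_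
  rw [← ENNReal.ofReal_tsum_of_nonneg (fun n => hw0 n ξ) (hW ξ).summable, (hW ξ).tsum_eq]

theorem isFiniteMeasure_bandMeasure (hw : ∀ n, Measurable (w n)) (hw0 : ∀ n ξ, 0 ≤ w n ξ)
    (he : ∀ n, Measurable (e n)) (hW : ∀ ξ, HasSum (fun n => w n ξ) (W ξ)) (hWi : Integrable W) :
    IsFiniteMeasure (bandMeasure w e) := by
  constructor
  have h1 : bandMeasure w e univ = ∑' n, ∫⁻ ξ, ENNReal.ofReal (w n ξ) := by
    rw [bandMeasure, Measure.sum_apply _ MeasurableSet.univ]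
    refine tsum_congr fun n => ?_
    rw [Measure.map_apply (he n) MeasurableSet.univ, preimage_univ,
      withDensity_apply _ MeasurableSet.univ, Measure.restrict_univ]
  rw [h1, tsum_lintegral_ofReal hw hw0 hW]
  exact hWi.lintegral_lt_top

theorem integral_bandMeasure (hw : ∀ n, Measurable (w n)) (hw0 : ∀ n ξ, 0 ≤ w n ξ)
    (he : ∀ n, Measurable (e n)) (hW : ∀ ξ, HasSum (fun n => w n ξ) (W ξ)) (hWi : Integrable W)
    {g : ℝ → ℂ} (hg : Measurable g) {C : ℝ} (hC : ∀ t, ‖g t‖ ≤ C) :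
    ∫ t, g t ∂bandMeasure w e = ∫ ξ, ∑' n, (w n ξ : ℂ) * g (e n ξ) := by
  have hfin := isFiniteMeasure_bandMeasure hw hw0 he hW hWi
  have hi : Integrable g (bandMeasure w e) :=
    Integrable.of_bound hg.aestronglyMeasurable C (Eventually.of_forall hC)
  have hm : ∀ n, AEStronglyMeasurable (fun ξ => (w n ξ : ℂ) * g (e n ξ)) volume := fun n =>
    ((Complex.measurable_ofReal.comp (hw n)).mul (hg.comp (he n))).aestronglyMeasurable
  rw [integral_tsum hm, bandMeasure, ← (hasSum_integral_measure (f := g) hi).tsum_eq]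
  · refine tsum_congr fun n => ?_
    rw [integral_map (he n).aemeasurable hg.aestronglyMeasurable,
      integral_withDensity_eq_integral_toReal_smul (hw n).ennreal_ofReal
        (Eventually.of_forall fun _ => ENNReal.ofReal_lt_top)]
    refine integral_congr_ae (Eventually.of_forall fun ξ => ?_)
    simp only [ENNReal.toReal_ofReal (hw0 n ξ), Complex.real_smul]
  · have h1 : ∀ n, ∫⁻ ξ, ‖(w n ξ : ℂ) * g (e n ξ)‖ₑ ≤
        ENNReal.ofReal C * ∫⁻ ξ, ENNReal.ofReal (w n ξ) := by
      intro n
      rw [← lintegral_const_mul _ (hw n).ennreal_ofReal]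
      refine lintegral_mono fun ξ => ?_
      rw [← ofReal_norm, norm_mul, Complex.norm_real, Real.norm_of_nonneg (hw0 n ξ),
        ← ENNReal.ofReal_mul ((norm_nonneg _).trans (hC 0)), mul_comm]
      exact ENNReal.ofReal_le_ofReal (mul_le_mul_of_nonneg_right (hC _) (hw0 n ξ))
    refine ne_top_of_le_ne_top ?_ (ENNReal.tsum_le_tsum h1)
    rw [ENNReal.tsum_mul_left, tsum_lintegral_ofReal hw hw0 hW]
    exact ENNReal.mul_ne_top ENNReal.ofReal_ne_top hWi.lintegral_lt_top.ne

theorem bandMeasure_absolutelyContinuous (he : ∀ n, Measurable (e n))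
    (hn : ∀ n (N : Set ℝ), volume N = 0 → volume (e n ⁻¹' N) = 0) :
    bandMeasure w e ≪ volume := by
  refine Measure.absolutelyContinuous_sum_left fun n => Measure.AbsolutelyContinuous.mk ?_
  intro N hN hN0
  rw [Measure.map_apply (he n) hN]
  exact withDensity_absolutelyContinuous _ _ (hn n N hN0)

end BandMeasure

/-! ### The spectral measures of the Landau operator -/

variable {B : ℝ} {v f : ℝ → ℝ} {c : ℝ} {ε : ℝ → ℕ → ℝ} {b : ℝ → HilbertBasis ℕ ℂ L2R}

/-- The eigenvectors are chosen separately for each `p`, with no measurability. The weight depends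
only on the eigenprojection, which is continuous in `p`. -/
theorem measurable_norm_inner_sq {n : ℕ}
    (hP : Continuous fun p => InnerProductSpace.rankOne ℂ (b p n) (b p n)) (Φ : L2V) :
    Measurable fun ξ => ‖(⟪b (2 * Real.pi * ξ) n, Φ ξ⟫ : ℂ)‖ ^ 2 := by
  have h1 : StronglyMeasurable fun ξ : ℝ =>
      InnerProductSpace.rankOne ℂ (b (2 * Real.pi * ξ) n) (b (2 * Real.pi * ξ) n) :=
    (hP.comp (continuous_const.mul continuous_id)).stronglyMeasurable
  have h2 : StronglyMeasurable fun ξ : ℝ => ⟪Φ ξ,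
      InnerProductSpace.rankOne ℂ (b (2 * Real.pi * ξ) n) (b (2 * Real.pi * ξ) n) (Φ ξ)⟫ :=
    (Lp.stronglyMeasurable Φ).inner
      (isBoundedBilinearMap_apply.continuous.comp_stronglyMeasurable
        (h1.prodMk (Lp.stronglyMeasurable Φ)))
  convert! Complex.measurable_re.comp h2.measurable using 1
  funext ξ
  rw [Function.comp_apply, InnerProductSpace.rankOne_apply, inner_smul_right, ← inner_conj_symm (Φ ξ),
    Complex.mul_conj, Complex.normSq_eq_norm_sq, Complex.ofReal_re]

/-- In each fiber Parseval's identity writes the resolvent pairing as a sum over the eigenbasis;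
integration over `ξ` turns it into the integral of `(t - z)⁻¹` against `bandMeasure`. -/
theorem SquareBounded.exists_spectralMeasure (hB : 0 < B) (h : SquareBounded v f c)
    (hE : ∀ p, EigenSystem (fiberOp B v p) (ε p) (b p)) (hne : ∀ n, ∃ x y, ε x n ≠ ε y n)
    (ψ : L2P) : ∃ μ : Measure ℝ, IsSpectralMeasure (landauOp B v) ψ μ ∧ μ ≪ volume := by
  set Φ := partialFourier ψ with hΦ
  set w : ℕ → ℝ → ℝ := fun n ξ => ‖(⟪b (2 * Real.pi * ξ) n, Φ ξ⟫ : ℂ)‖ ^ 2 with hwdef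
  set e : ℕ → ℝ → ℝ := fun n ξ => ε (2 * Real.pi * ξ) n with hedef
  have hea : ∀ n ξ, AnalyticAt ℝ (e n) ξ := fun n ξ =>
    ((analyticAt_eigenvalue hB h hE (2 * Real.pi * ξ) n).1).comp_of_eq
      (analyticAt_const.mul analyticAt_id) rfl
  have he : ∀ n, Measurable (e n) := fun n =>
    (continuous_iff_continuousAt.2 fun ξ => (hea n ξ).continuousAt).measurable
  have hw : ∀ n, Measurable (w n) := fun n => measurable_norm_inner_sq
    (continuous_iff_continuousAt.2 fun p => (analyticAt_eigenvalue hB h hE p n).2) Φ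
  have hw0 : ∀ n ξ, 0 ≤ w n ξ := fun n ξ => sq_nonneg _
  have hterm : ∀ n ξ, (⟪Φ ξ, b (2 * Real.pi * ξ) n⟫ : ℂ) * ⟪b (2 * Real.pi * ξ) n, Φ ξ⟫ = w n ξ := by
    intro n ξ
    rw [← inner_conj_symm, mul_comm, Complex.mul_conj, Complex.normSq_eq_norm_sq]
  have hW : ∀ ξ, HasSum (fun n => w n ξ) (‖Φ ξ‖ ^ 2) := by
    intro ξ
    have h1 := (b (2 * Real.pi * ξ)).hasSum_inner_mul_inner (Φ ξ) (Φ ξ)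
    simp only [hterm] at h1
    rw [inner_self_eq_norm_sq_to_K] at h1
    have h2 : ((‖Φ ξ‖ : ℂ) ^ 2) = ((‖Φ ξ‖ ^ 2 : ℝ) : ℂ) := by push_cast; rfl
    exact Complex.hasSum_ofReal.1 (h2 ▸ h1)
  have hWi : Integrable fun ξ => ‖Φ ξ‖ ^ 2 :=
    (memLp_two_iff_integrable_sq_norm (Lp.memLp Φ).1).1 (Lp.memLp Φ)
  refine ⟨bandMeasure w e, ⟨isFiniteMeasure_bandMeasure hw hw0 he hW hWi, ?_⟩,
    bandMeasure_absolutelyContinuous he fun n N hN => ?_⟩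
  · intro z hz g hg
    have hbd : ∀ t : ℝ, ‖((t : ℂ) - z)⁻¹‖ ≤ |z.im|⁻¹ := by
      intro t
      rw [norm_inv]
      refine inv_anti₀ (abs_pos.2 hz) ?_
      simpa using Complex.abs_im_le_norm ((t : ℂ) - z)
    rw [integral_bandMeasure (g := fun t : ℝ => ((t : ℂ) - z)⁻¹) hw hw0 he hW hWi
      ((Complex.measurable_ofReal.sub_const z).inv) hbd, ← partialFourier.inner_map_map,
      L2.inner_def]
    -- The resolvent equation gives `A g = ψ + z g`, so symmetry yields the weak equation that
    -- passes to the fibers.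
    have h1 : ∀ q ∈ (landauCoreGraph B v).topologicalClosure,
        ⟪ψ + z • (g : L2P), q.1⟫ = ⟪(g : L2P), q.2⟫ := by
      intro q hq
      have h2 := symmGraph_landauOp h _ ((landauOp B v).mem_graph g) q
        (h.landauOp_graph (B := B) ▸ hq)
      rw [h2, ← hg, sub_add_cancel]
    have hsm : partialFourier (ψ + z • (g : L2P)) = Φ + z • partialFourier (g : L2P) := by
      rw [map_add, map_smul]
    refine integral_congr_ae ?_
    filter_upwards [ae_inner_fiberOp hB h h1, Lp.coeFn_add Φ (z • partialFourier (g : L2P)),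
      Lp.coeFn_smul z (partialFourier (g : L2P))] with ξ h3 h4 h5
    rw [← ((b (2 * Real.pi * ξ)).hasSum_inner_mul_inner (Φ ξ) (partialFourier (g : L2P) ξ)).tsum_eq]
    refine tsum_congr fun n => ?_
    have h6 := h3 _ ((hE _).mem n)
    rw [hsm, h4, Pi.add_apply, h5, Pi.smul_apply, inner_add_left, inner_smul_left,
      inner_smul_right] at h6
    have h7 := congrArg (starRingEnd ℂ) h6
    simp only [map_add, map_mul, Complex.conj_conj, inner_conj_symm, Complex.conj_ofReal] at h7
    have h8 : (e n ξ : ℂ) - z ≠ 0 := fun h0 => hz (by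
      rw [← sub_eq_zero.1 h0, Complex.ofReal_im])
    rw [← hterm, mul_assoc (inner ℂ (Φ ξ) _)]
    congr 1
    rw [eq_mul_inv_iff_mul_eq₀ h8]
    linear_combination -h7
  -- Rescaling `p = 2πξ` preserves analyticity and nonconstancy of the branch.
  · refine measure_preimage_eq_zero_of_analytic (hea n) ?_ hN
    obtain ⟨x, y, hxy⟩ := hne n
    have h2 : 2 * Real.pi ≠ 0 := by positivity
    exact ⟨x / (2 * Real.pi), y / (2 * Real.pi), by
      simpa only [hedef, mul_div_cancel₀ _ h2] using hxy⟩

theorem not_const_of_tendsto {g : ℝ → ℝ} {a b : ℝ} (ha : Tendsto g atBot (𝓝 a))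
    (hb : Tendsto g atTop (𝓝 b)) (hab : a ≠ b) : ¬ ∃ c : ℝ, ∀ p : ℝ, g p = c := by
  rintro ⟨c, hc⟩
  obtain rfl : g = fun _ => c := funext hc
  exact hab ((tendsto_nhds_unique ha tendsto_const_nhds).trans
    (tendsto_nhds_unique tendsto_const_nhds hb))

end

end TransInv

/-! ### The theorem -/

theorem proposition3p1 (B : ℝ) (hB : 0 < B) (v : ℝ → ℝ) (hv : TransInv.CondV1 v)
    (vplus vminus : ℝ) (hplus : Tendsto v atTop (𝓝 vplus))
    (hminus : Tendsto v atBot (𝓝 vminus)) (hne : vplus ≠ vminus) :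
    (∃ ε : ℕ → ℝ → ℝ,
      (∀ p : ℝ, IsSelfAdjoint (TransInv.fiberOp B v p) ∧
        TransInv.HasSimpleDiscreteSpectrum (TransInv.fiberOp B v p) (fun n => ε n p)) ∧
      (∀ n : ℕ, Tendsto (ε n) atBot (𝓝 (vplus + B * (2 * (n : ℝ) + 1))) ∧
        Tendsto (ε n) atTop (𝓝 (vminus + B * (2 * (n : ℝ) + 1)))) ∧
      (∀ n : ℕ, ¬ ∃ c : ℝ, ∀ p : ℝ, ε n p = c)) ∧
    TransInv.HasPurelyACSpectrum (TransInv.landauOp B v) := by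
  obtain ⟨f, c, h⟩ := hv.exists_squareBounded hplus hminus
  choose ε b hE using TransInv.exists_eigenSystem_fiberOp hB h
  have hlim : ∀ n : ℕ, Tendsto (fun p => ε p n) atBot (𝓝 (vplus + B * (2 * (n : ℝ) + 1))) ∧
      Tendsto (fun p => ε p n) atTop (𝓝 (vminus + B * (2 * (n : ℝ) + 1))) := fun n =>
    ⟨TransInv.tendsto_eigenvalue hB h hE (TransInv.eventually_atBot_translate hB hplus) n,
      TransInv.tendsto_eigenvalue hB h hE (TransInv.eventually_atTop_translate hB hminus) n⟩
  have hnc : ∀ n : ℕ, ¬ ∃ c : ℝ, ∀ p : ℝ, ε p n = c := fun n =>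
    -- The Landau level is the same in both limits and cancels, leaving `vplus ≠ vminus`.
    TransInv.not_const_of_tendsto (hlim n).1 (hlim n).2 (by simpa using hne)
  refine ⟨⟨fun n p => ε p n, fun p => ⟨h.isSelfAdjoint_fiberOp hB p, ?_⟩, hlim, hnc⟩,
    h.isSelfAdjoint_landauOp hB hE, h.exists_spectralMeasure hB hE fun n => ?_⟩
  · exact (hE p).hasSimpleDiscreteSpectrum (h.symmGraph_fiberOp p)
      (TransInv.isInverseOf_fiberRes hB h le_rfl le_rfl)
      (TransInv.isCompactOperator_fiberRes hB h (TransInv.one_le_shiftBound _ _ _) p)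
  · by_contra! hcon
    exact hnc n ⟨ε 0 n, fun p => hcon p 0⟩
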